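/- **Setting.** Let $\mathcal C$ be a unitary fusion category: a $\mathbb C$-linear, semisimple, abelian, rigid monoidal category with finitely many isomorphism classes of simple objects, finite-dimensional morphism spaces and simple unit object $\mathbf 1$, together with a conjugation $f\in Hom(U,V)\mapsto \bar f\in Hom(V,U)$ that is antilinear and satisfies $\overline{g\circ f}=\bar f\circ\bar g$, $\overline{f\otimes g}=\bar f\otimes\bar g$, $\bar{\bar f}=f$, and $\bar f\circ f=0$ if and only if $f=0$. Choose representatives $i\in I$ of the isomorphism classes of simple objects (with $1\in I$ isomorphic to $\mathbf 1$ by a chosen isomorphism), put $N_{ab}^c=\dim Hom(a\otimes b,c)$, and choose a basis of every space $Hom(a\otimes b,c)$, labelled by $\alpha=1,\dots,N_{ab}^c$, the basis vector of $Hom(a\otimes 1,a)$ being the right unit constraint. Let $F^{abc}_d$ be the matrix of the associativity isomorphism $Hom((a\otimes b)\otimes c,d)\to Hom(a\otimes(b\otimes c),d)$ in the bases of trees, its entries being $F^{abc}_{d;(n,\gamma,\delta),(m,\mu,\nu)}$, where $\mu,\nu,\gamma,\delta$ label the bases of $Hom(a\otimes b,m)$, $Hom(m\otimes c,d)$, $Hom(b\otimes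 c,n)$, $Hom(a\otimes n,d)$. Assume that all matrices $F^{abc}_d$ are unitary and real. Let $d_i>0$ be the quantum dimension of $i$: for duality morphisms $\mathrm{coev}:\mathbf 1\to i\otimes i^*$ and $\mathrm{ev}:i^*\otimes i\to\mathbf 1$, $d_i=\sqrt{|\overline{\mathrm{coev}}\circ \mathrm{coev}|\,|\mathrm{ev}\circ\overline{\mathrm{ev}}|}$. For $i\in I$ let $T_i$ be the set of triples $x=(a,b,\alpha)$ with $a,b\in I$ and $\alpha\in\{1,\dots,N_{ai}^b\}$. Let $H_{\mathcal C}$ be the vector space with basis $e_{i;x,y}$ ($i\in I$, $x,y\in T_i$), with the operations $$e_{i;x,y}\,e_{i';x',y'}=\frac{\delta_{ii'}\delta_{yx'}}{\sqrt{d_i}}\,e_{i;x,y'},\qquad \eta=\sum_{i,x}\sqrt{d_i}\,e_{i;x,x},\qquad (e_{i;x,y})^*=e_{i;y,x}\ \text{(extended antilinearly)},$$ and, for $x=(a,b,\alpha)$ and $y=(c,d,\beta)$, $$\Delta(e_{i;x,y})=\sum_{j,k,\mu}\ \sum_{p,\sigma,\sigma'}\ \sum_{q,\tau,\tau'}\sqrt{\frac{d_jd_k}{d_i}}\;F^{ajk}_{b;(i,\mu,\alpha),(p,\sigma,\sigma')}\;\overline{F^{cjk}_{d;(i,\mu,\beta),(q,\tau,\tau')}}\;e_{j;(a,p,\sigma),(c,q,\tau)}\otimes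 e_{k;(p,b,\sigma'),(q,d,\tau')},$$ $$\varepsilon(e_{i;x,y})=\delta_{ab}\,\delta_{cd}\,\delta_{i1},$$ where $\mu,\sigma,\sigma',\tau,\tau'$ label the bases of $Hom(j\otimes k,i)$, $Hom(a\otimes j,p)$, $Hom(p\otimes k,b)$, $Hom(c\otimes j,q)$, $Hom(q\otimes k,d)$. For a finite quantum groupoid (weak Hopf algebra) $H$, $Rep(H)$ is the monoidal category of finite-dimensional $H$-modules, with tensor product $\Delta(\eta)(U\otimes V)$, the associativity isomorphisms of vector spaces, and the target counital subalgebra $H_t$ as unit object. Let $V_i$ be the module with basis $v^x_i$ ($x\in T_i$) and $e_{j;x,y}\,v^{z}_i=\delta_{ij}\delta_{yz}\,v^x_i/\sqrt{d_i}$. **Theorem.** There is an antipode with which $H_{\mathcal C}$, with the above operations, is a $C^*$-quantum groupoid, and then: 1. The $V_i$, $i\in I$, are simple and pairwise non-isomorphic, and every simple object of $Rep(H_{\mathcal C})$ is isomorphic to one of them. 2. The fusion rules of $Rep(H_{\mathcal C})$ are those of $\mathcal C$: $V_j\otimes V_k\cong\bigoplus_i N_{jk}^i\,V_i$. 3. For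 all $i,j,k$ and $\mu\in\{1,\dots,N_{jk}^i\}$, the formula $$v_i^{(a,b,\alpha)}\mapsto\sum_{p,\sigma,\sigma'}F^{ajk}_{b;(i,\mu,\alpha),(p,\sigma,\sigma')}\;v_j^{(a,p,\sigma)}\otimes v_k^{(p,b,\sigma')}$$ defines a morphism $t_{i}^{jk,\mu}:V_i\to V_j\otimes V_k$; for fixed $i,j,k$ these form a basis of $Hom(V_i,V_j\otimes V_k)$; and in these bases the $6j$-symbols of $Rep(H_{\mathcal C})$ are the $F$-symbols of $\mathcal C$: with $\mathbf a:(V_a\otimes V_b)\otimes V_c\to V_a\otimes(V_b\otimes V_c)$ the associativity isomorphism, $$\mathbf a\circ(t_m^{ab,\mu}\otimes \mathrm{id}_{V_c})\circ t_d^{mc,\nu}=\sum_{n,\gamma,\delta}\overline{F^{abc}_{d;(n,\gamma,\delta),(m,\mu,\nu)}}\;(\mathrm{id}_{V_a}\otimes t_n^{bc,\gamma})\circ t_d^{an,\delta}$$ (the complex conjugation has no effect, since $F$ is real). 4. There is a $\mathbb C$-linear monoidal equivalence $\mathcal C\to Rep(H_{\mathcal C})$ that sends every simple object $i\in I$ to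 an object isomorphic to $V_i$. -/

import Mathlib

open CategoryTheory MonoidalCategory
open scoped TensorProduct

universe u v w

noncomputable section

/-- A finite quantum groupoid (weak Hopf algebra) over `ℂ`. -/
structure QuantumGroupoid (H : Type u) [Ring H] [Algebra ℂ H] extends Coalgebra ℂ H where
  finite : Module.Finite ℂ H
  comul_mul : ∀ a b : H, comul (a * b) = comul a * comul b
  /-- `(Δ ⊗ id) Δ(η) = (Δ(η) ⊗ η) (η ⊗ Δ(η))` -/
  comul_one_left : comul.rTensor H (comul 1) =
    (comul 1 ⊗ₜ[ℂ] (1 : H)) * (TensorProduct.assoc ℂ H H H).symm ((1 : H) ⊗ₜ[ℂ] comul 1)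
  /-- `(Δ ⊗ id) Δ(η) = (η ⊗ Δ(η)) (Δ(η) ⊗ η)` -/
  comul_one_right : comul.rTensor H (comul 1) =
    (TensorProduct.assoc ℂ H H H).symm ((1 : H) ⊗ₜ[ℂ] comul 1) * (comul 1 ⊗ₜ[ℂ] (1 : H))
  /-- `ε(abc) = ε(a b₍₁₎) ε(b₍₂₎ c)` -/
  counit_mul_left : ∀ a b c : H, counit (a * b * c) =
    LinearMap.mul' ℂ ℂ (TensorProduct.map (counit ∘ₗ LinearMap.mulLeft ℂ a)
      (counit ∘ₗ LinearMap.mulRight ℂ c) (comul b))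
  /-- `ε(abc) = ε(a b₍₂₎) ε(b₍₁₎ c)` -/
  counit_mul_right : ∀ a b c : H, counit (a * b * c) =
    LinearMap.mul' ℂ ℂ (TensorProduct.map (counit ∘ₗ LinearMap.mulRight ℂ c)
      (counit ∘ₗ LinearMap.mulLeft ℂ a) (comul b))
  antipode : H →ₗ[ℂ] H
  /-- `h₍₁₎ S(h₍₂₎) = ε(η₍₁₎ h) η₍₂₎` -/
  mul_antipode : ∀ h : H, LinearMap.mul' ℂ H (antipode.lTensor H (comul h)) =
    TensorProduct.lid ℂ H (counit.rTensor H (comul 1 * (h ⊗ₜ[ℂ] 1)))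
  /-- `S(h₍₁₎) h₍₂₎ = ε(h η₍₂₎) η₍₁₎` -/
  antipode_mul : ∀ h : H, LinearMap.mul' ℂ H (antipode.rTensor H (comul h)) =
    TensorProduct.rid ℂ H (counit.lTensor H ((1 ⊗ₜ[ℂ] h) * comul 1))
  /-- `S(h₍₁₎) h₍₂₎ S(h₍₃₎) = S(h)` -/
  antipode_mul_antipode : ∀ h : H,
    LinearMap.mul' ℂ H (TensorProduct.map (LinearMap.mul' ℂ H ∘ₗ antipode.rTensor H) antipode
      (comul.rTensor H (comul h))) = antipode h

/-- A `C*`-quantum groupoid: a finite quantum groupoid on a (finite-dimensional) `C*`-algebra whose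
comultiplication is a `*`-homomorphism. -/
structure CStarQuantumGroupoid (H : Type u) [Ring H] [Algebra ℂ H] [StarRing H] [StarModule ℂ H]
    extends QuantumGroupoid H where
  cstar_norm : ∃ ν : AlgebraNorm ℂ H, ∀ x : H, ν (star x * x) = ν x * ν x
  comul_star : ∀ h : H, comul (star h) = star (comul h)

namespace QuantumGroupoid

variable {H : Type u} [Ring H] [Algebra ℂ H] (Q : QuantumGroupoid H)

/-- The target counital map `ε_t(h) = ε(η₍₁₎ h) η₍₂₎`. -/
def εt : H →ₗ[ℂ] H :=
  (TensorProduct.lid ℂ H).toLinearMap ∘ₗ Q.counit.rTensor H ∘ₗ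
    LinearMap.mulLeft ℂ (Q.comul 1) ∘ₗ (TensorProduct.mk ℂ H H).flip 1

/-- The map `h ↦ η₍₁₎ ε(η₍₂₎ h)`; on the target counital subalgebra it is the inverse of the
antipode. -/
def εbar : H →ₗ[ℂ] H :=
  (TensorProduct.rid ℂ H).toLinearMap ∘ₗ Q.counit.lTensor H ∘ₗ
    LinearMap.mulLeft ℂ (Q.comul 1) ∘ₗ TensorProduct.mk ℂ H H 1

/-- `ε(t₁ x) t₂` and `t₁ ε(t₂ x)` for `t = t₁ ⊗ t₂`. -/
def contrL (x : H) : H ⊗[ℂ] H →ₗ[ℂ] H :=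
  (TensorProduct.lid ℂ H).toLinearMap ∘ₗ (Q.counit ∘ₗ LinearMap.mulRight ℂ x).rTensor H

def contrR (x : H) : H ⊗[ℂ] H →ₗ[ℂ] H :=
  (TensorProduct.rid ℂ H).toLinearMap ∘ₗ (Q.counit ∘ₗ LinearMap.mulRight ℂ x).lTensor H

lemma contrL_tmul (x a b : H) : Q.contrL x (a ⊗ₜ b) = Q.counit (a * x) • b := by
  simp [contrL]

lemma contrR_tmul (x a b : H) : Q.contrR x (a ⊗ₜ b) = Q.counit (b * x) • a := by
  simp [contrR]

lemma contrL_mul_one_tmul (x b : H) (t : H ⊗[ℂ] H) :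
    Q.contrL x ((1 ⊗ₜ b) * t) = b * Q.contrL x t := by
  induction t with
  | zero => simp
  | add s t hs ht => simp [mul_add, hs, ht]
  | tmul p q => simp [contrL_tmul]

lemma contrL_one_comul (h : H) : Q.contrL 1 (Q.comul h) = h := by
  have := congrArg (TensorProduct.lid ℂ H) (LinearMap.congr_fun Q.rTensor_counit_comp_comul h)
  simp only [LinearMap.comp_apply, TensorProduct.mk_apply, TensorProduct.lid_tmul, one_smul] at this
  have e : (Q.counit ∘ₗ LinearMap.mulRight ℂ (1 : H)) = Q.counit := by ext; simp
  rw [contrL, e]; exact this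

lemma contrR_one_comul (h : H) : Q.contrR 1 (Q.comul h) = h := by
  have := congrArg (TensorProduct.rid ℂ H) (LinearMap.congr_fun Q.lTensor_counit_comp_comul h)
  simp only [LinearMap.comp_apply, LinearMap.flip_apply, TensorProduct.mk_apply,
    TensorProduct.rid_tmul, one_smul] at this
  have e : (Q.counit ∘ₗ LinearMap.mulRight ℂ (1 : H)) = Q.counit := by ext; simp
  rw [contrR, e]; exact this

lemma εt_eq (x : H) : Q.εt x = Q.contrL x (Q.comul 1) := by
  simp only [εt, LinearMap.comp_apply, LinearMap.flip_apply, TensorProduct.mk_apply,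
    LinearMap.mulLeft_apply]
  generalize Q.comul 1 = t
  induction t with
  | zero => simp
  | add s t hs ht => simp only [add_mul, map_add, hs, ht]
  | tmul p q => simp [contrL_tmul]

lemma εbar_eq (x : H) : Q.εbar x = Q.contrR x (Q.comul 1) := by
  simp only [εbar, LinearMap.comp_apply, TensorProduct.mk_apply,
    LinearMap.mulLeft_apply]
  generalize Q.comul 1 = t
  induction t with
  | zero => simp
  | add s t hs ht => simp only [add_mul, map_add, hs, ht]
  | tmul p q => simp [contrR_tmul]

lemma εt_one : Q.εt 1 = 1 := by rw [εt_eq, contrL_one_comul]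

lemma εbar_one : Q.εbar 1 = 1 := by rw [εbar_eq, contrR_one_comul]

/-- `ε(g ε_t(x)) = ε(g x)` -/
lemma counit_mul_εt (g x : H) : Q.counit (g * Q.εt x) = Q.counit (g * x) := by
  have h := Q.counit_mul_right g 1 x
  rw [mul_one] at h
  rw [h, εt_eq]
  generalize Q.comul 1 = t
  induction t with
  | zero => simp
  | add s t hs ht => simp only [map_add, mul_add, hs, ht]
  | tmul p q => simp [contrL_tmul]

lemma εt_mul_εt (g x : H) : Q.εt (g * Q.εt x) = Q.εt (g * x) := by
  rw [Q.εt_eq (g * Q.εt x), Q.εt_eq (g * x)]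
  generalize Q.comul 1 = t
  induction t with
  | zero => simp
  | add s t hs ht => simp only [map_add, hs, ht]
  | tmul p q => simp only [contrL_tmul, ← mul_assoc, counit_mul_εt]

lemma εt_εt (x : H) : Q.εt (Q.εt x) = Q.εt x := by
  simpa using Q.εt_mul_εt 1 x

lemma εbar_mul_εt (g x : H) : Q.εbar (g * Q.εt x) = Q.εbar (g * x) := by
  rw [εbar_eq, εbar_eq]
  generalize Q.comul 1 = t
  induction t with
  | zero => simp
  | add s t hs ht => simp only [map_add, hs, ht]
  | tmul p q => simp only [contrR_tmul, ← mul_assoc, counit_mul_εt]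

lemma comul_mul_comul_one (h : H) : Q.comul h * Q.comul 1 = Q.comul h := by
  rw [← Q.comul_mul, mul_one]

lemma comul_one_mul_comul (h : H) : Q.comul 1 * Q.comul h = Q.comul h := by
  rw [← Q.comul_mul, one_mul]

lemma coassoc_apply' (h : H) : TensorProduct.assoc ℂ H H H (Q.comul.rTensor H (Q.comul h)) =
    Q.comul.lTensor H (Q.comul h) := LinearMap.congr_fun Q.coassoc h


/-- `ε(h₍₁₎ x) h₍₂₎ = h ε_t(x)` -/
lemma contrL_comul (h x : H) : Q.contrL x (Q.comul h) = h * Q.εt x := by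
  -- the functional `p ⊗ (u ⊗ v) ↦ ε(p x) (ε ⊗ id)(w (u ⊗ v))`
  let G : H ⊗[ℂ] H → H ⊗[ℂ] (H ⊗[ℂ] H) →ₗ[ℂ] H := fun w =>
    (TensorProduct.lid ℂ H).toLinearMap ∘ₗ
      TensorProduct.map (Q.counit ∘ₗ LinearMap.mulRight ℂ x) (Q.contrL 1 ∘ₗ LinearMap.mulLeft ℂ w)
  have G_tmul : ∀ w p u v, G w (p ⊗ₜ (u ⊗ₜ v)) =
      Q.counit (p * x) • Q.contrL 1 (w * (u ⊗ₜ v)) := by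
    intro w p u v; simp [G]
  have e1 : ∀ t : H ⊗[ℂ] H, G (Q.comul h) (Q.comul.lTensor H t) = h * Q.contrL x t := by
    intro t
    induction t with
    | zero => simp
    | add s t hs ht => simp only [map_add, mul_add, hs, ht]
    | tmul p q => simp [G, contrL_tmul, ← Q.comul_mul, contrL_one_comul]
  have e3 : ∀ (w d : H ⊗[ℂ] H) (a b q : H), G (a ⊗ₜ b) (TensorProduct.assoc ℂ H H H (d ⊗ₜ q)) =
      (LinearMap.mul' ℂ ℂ (TensorProduct.map (Q.counit ∘ₗ LinearMap.mulRight ℂ x)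
        (Q.counit ∘ₗ LinearMap.mulLeft ℂ a) d)) • (b * q) := by
    intro w d a b q
    induction d with
    | zero => simp
    | add s t hs ht => simp only [map_add, TensorProduct.add_tmul, add_smul, hs, ht]
    | tmul u v => simp [G_tmul, contrL_tmul, smul_smul]
  have e2 : ∀ (w t : H ⊗[ℂ] H), G w (TensorProduct.assoc ℂ H H H (Q.comul.rTensor H t)) =
      Q.contrL x (w * t) := by
    intro w t
    induction t with
    | zero => simp
    | add s t hs ht => simp only [map_add, mul_add, hs, ht]
    | tmul p q =>
      induction w with
      | zero => simp [G]
      | add s t hs ht =>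
        have : G (s + t) = G s + G t := by
          refine TensorProduct.ext_threefold' fun p u v => ?_
          simp [G_tmul, add_mul]
        rw [this, LinearMap.add_apply, hs, ht, add_mul, map_add]
      | tmul a b =>
        rw [LinearMap.rTensor_tmul, e3 0, ← Q.counit_mul_right, Algebra.TensorProduct.tmul_mul_tmul,
          contrL_tmul]
  have key := congrArg (G (Q.comul h)) (Q.coassoc_apply' 1)
  rw [e1, e2, comul_mul_comul_one, ← εt_eq] at key
  exact key

/-- `h₍₁₎ ε(h₍₂₎ x) = h η₍₁₎ ε(η₍₂₎ x)` -/
lemma contrR_comul (h x : H) : Q.contrR x (Q.comul h) = h * Q.εbar x := by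
  let G : H ⊗[ℂ] H → H ⊗[ℂ] (H ⊗[ℂ] H) →ₗ[ℂ] H := fun w =>
    (TensorProduct.rid ℂ H).toLinearMap ∘ₗ
      TensorProduct.map (Q.contrR 1 ∘ₗ LinearMap.mulLeft ℂ w) (Q.counit ∘ₗ LinearMap.mulRight ℂ x)
      ∘ₗ (TensorProduct.assoc ℂ H H H).symm.toLinearMap
  have G_tmul : ∀ w p u v, G w (p ⊗ₜ (u ⊗ₜ v)) =
      Q.counit (v * x) • Q.contrR 1 (w * (p ⊗ₜ u)) := by
    intro w p u v; simp [G]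
  have e1 : ∀ t : H ⊗[ℂ] H, G (Q.comul h) (TensorProduct.assoc ℂ H H H (Q.comul.rTensor H t)) =
      h * Q.contrR x t := by
    intro t
    induction t with
    | zero => simp
    | add s t hs ht => simp only [map_add, mul_add, hs, ht]
    | tmul p q => simp [G, contrR_tmul, ← Q.comul_mul, contrR_one_comul]
  have e3 : ∀ (d : H ⊗[ℂ] H) (a b p : H), G (a ⊗ₜ b) (p ⊗ₜ d) =
      (LinearMap.mul' ℂ ℂ (TensorProduct.map (Q.counit ∘ₗ LinearMap.mulLeft ℂ b)
        (Q.counit ∘ₗ LinearMap.mulRight ℂ x) d)) • (a * p) := by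
    intro d a b q
    induction d with
    | zero => simp
    | add s t hs ht => simp only [map_add, TensorProduct.tmul_add, add_smul, hs, ht]
    | tmul u v => simp [G_tmul, contrR_tmul, smul_smul, mul_comm]
  have e2 : ∀ (w t : H ⊗[ℂ] H), G w (Q.comul.lTensor H t) = Q.contrR x (w * t) := by
    intro w t
    induction t with
    | zero => simp
    | add s t hs ht => simp only [map_add, mul_add, hs, ht]
    | tmul p q =>
      induction w with
      | zero => simp [G]
      | add s t hs ht =>
        have : G (s + t) = G s + G t := by
          refine TensorProduct.ext_threefold' fun p u v => ?_
          simp [G_tmul, add_mul]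
        rw [this, LinearMap.add_apply, hs, ht, add_mul, map_add]
      | tmul a b =>
        rw [LinearMap.lTensor_tmul, e3, ← Q.counit_mul_left, Algebra.TensorProduct.tmul_mul_tmul,
          contrR_tmul]
  have key := congrArg (G (Q.comul h)) (Q.coassoc_apply' 1)
  rw [e1, e2, comul_mul_comul_one, ← εbar_eq] at key
  exact key.symm

/-- `Δ(η) (η₍₁₎ ε(η₍₂₎ x) ⊗ 1) = Δ(η) (1 ⊗ ε_t(x))` -/
lemma comul_one_mul_εbar (x : H) :
    Q.comul 1 * (Q.εbar x ⊗ₜ[ℂ] 1) = Q.comul 1 * (1 ⊗ₜ[ℂ] Q.εt x) := by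
  have e1 : ∀ t : H ⊗[ℂ] H, (Q.contrL x).lTensor H (Q.comul.lTensor H t) =
      t * (1 ⊗ₜ[ℂ] Q.εt x) := by
    intro t
    induction t with
    | zero => simp
    | add s t hs ht => simp only [map_add, add_mul, hs, ht]
    | tmul p q => simp [contrL_comul]
  have e3 : ∀ (d : H ⊗[ℂ] H) (q : H), (Q.contrL x).lTensor H (TensorProduct.assoc ℂ H H H (d ⊗ₜ q)) =
      Q.contrR x d ⊗ₜ q := by
    intro d q
    induction d with
    | zero => simp
    | add s t hs ht => simp only [map_add, TensorProduct.add_tmul, hs, ht]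
    | tmul u v => simp [contrR_tmul, contrL_tmul, TensorProduct.smul_tmul]
  have e2 : ∀ t : H ⊗[ℂ] H,
      (Q.contrL x).lTensor H (TensorProduct.assoc ℂ H H H (Q.comul.rTensor H t)) =
      t * (Q.εbar x ⊗ₜ[ℂ] 1) := by
    intro t
    induction t with
    | zero => simp
    | add s t hs ht => simp only [map_add, add_mul, hs, ht]
    | tmul p q => simp [e3, contrR_comul]
  rw [← e1, ← e2, coassoc_apply']

/-- `Δ(z) = Δ(η) (z ⊗ 1)` for `z` in the target counital subalgebra. -/
lemma comul_εt (x : H) : Q.comul (Q.εt x) = Q.comul 1 * (Q.εt x ⊗ₜ[ℂ] 1) := by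
  let G : H ⊗[ℂ] (H ⊗[ℂ] H) →ₗ[ℂ] H ⊗[ℂ] H := (TensorProduct.lid ℂ (H ⊗[ℂ] H)).toLinearMap ∘ₗ
    (Q.counit ∘ₗ LinearMap.mulRight ℂ x).rTensor (H ⊗[ℂ] H)
  have key := congrArg G (Q.coassoc_apply' 1)
  have e1 : ∀ t : H ⊗[ℂ] H, G (Q.comul.lTensor H t) = Q.comul (Q.contrL x t) := by
    intro t
    induction t with
    | zero => simp
    | add s t hs ht => simp only [map_add, hs, ht]
    | tmul p q => simp [G, contrL_tmul]
  have e2 : ∀ s t : H ⊗[ℂ] H, G (TensorProduct.assoc ℂ H H H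
      ((TensorProduct.assoc ℂ H H H).symm (1 ⊗ₜ s) * (t ⊗ₜ 1))) = s * (Q.contrL x t ⊗ₜ 1) := by
    intro s t
    induction t with
    | zero => simp
    | add t t' ht ht' =>
      simp only [TensorProduct.add_tmul, mul_add, map_add, ht, ht']
    | tmul p q =>
      induction s with
      | zero => simp
      | add s s' hs hs' =>
        simp only [TensorProduct.tmul_add, map_add, add_mul, hs, hs']
      | tmul u v =>
        simp [G, contrL_tmul, TensorProduct.smul_tmul']
  rw [e1, Q.comul_one_right, e2, ← εt_eq] at key
  exact key.symm

/-- `ε_t(h₍₁₎) ⊗ h₍₂₎ = ε_t(η₍₁₎) ⊗ η₍₂₎ h` -/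
lemma εt_comul (h : H) : Q.εt.rTensor H (Q.comul h) =
    Q.εt.rTensor H (Q.comul 1) * (1 ⊗ₜ[ℂ] h) := by
  -- `p ⊗ (u ⊗ v) ↦ ε_t(p) ⊗ (ε ⊗ id)((u ⊗ v) w)`
  let G : H ⊗[ℂ] H → H ⊗[ℂ] (H ⊗[ℂ] H) →ₗ[ℂ] H ⊗[ℂ] H := fun w =>
      TensorProduct.map Q.εt (Q.contrL 1 ∘ₗ LinearMap.mulRight ℂ w)
  have G_tmul : ∀ w p u v, G w (p ⊗ₜ (u ⊗ₜ v)) = Q.εt p ⊗ₜ Q.contrL 1 ((u ⊗ₜ v) * w) := by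
    intro w p u v; simp [G]
  have e1 : ∀ t : H ⊗[ℂ] H, G (Q.comul h) (Q.comul.lTensor H t) =
      Q.εt.rTensor H t * (1 ⊗ₜ[ℂ] h) := by
    intro t
    induction t with
    | zero => simp
    | add s t hs ht => simp only [map_add, add_mul, hs, ht]
    | tmul p q => simp [G, ← Q.comul_mul, contrL_one_comul]
  have e4 : ∀ p a : H, Q.εt (p * a) =
      TensorProduct.lid ℂ H (TensorProduct.map (Q.counit ∘ₗ LinearMap.mulRight ℂ a) Q.εt
        (TensorProduct.comm ℂ H H (Q.comul p))) := by
    intro p a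
    let L : H ⊗[ℂ] H → H →ₗ[ℂ] H := fun s => (TensorProduct.lid ℂ H).toLinearMap ∘ₗ
      Q.counit.rTensor H ∘ₗ LinearMap.mulLeft ℂ s ∘ₗ (TensorProduct.mk ℂ H H).flip 1
    have L_add : ∀ s t, L (s + t) = L s + L t := by
      intro s t; ext y; simp [L, add_mul]
    have e5 : ∀ s : H ⊗[ℂ] H, L s (p * a) = TensorProduct.lid ℂ H
        (TensorProduct.map (Q.counit ∘ₗ LinearMap.mulRight ℂ a) (L s)
          (TensorProduct.comm ℂ H H (Q.comul p))) := by
      intro s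
      induction s with
      | zero =>
        have : L 0 = 0 := by ext y; simp [L]
        simp [this]
      | add s t hs ht =>
        simp only [L_add, LinearMap.add_apply, TensorProduct.map_add_right, map_add, hs, ht]
      | tmul P q =>
        have : L (P ⊗ₜ q) (p * a) = Q.counit (P * p * a) • q := by simp [L, mul_assoc]
        rw [this, Q.counit_mul_left]
        generalize Q.comul p = d
        induction d with
        | zero => simp
        | add s t hs ht => simp only [map_add, add_smul, hs, ht]
        | tmul u v => simp [L, smul_smul]
    exact e5 (Q.comul 1)
  have e2 : ∀ (w t : H ⊗[ℂ] H), G w (TensorProduct.assoc ℂ H H H (Q.comul.rTensor H t)) =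
      Q.εt.rTensor H (t * w) := by
    intro w t
    induction t with
    | zero => simp
    | add s t hs ht => simp only [map_add, add_mul, hs, ht]
    | tmul p q =>
      induction w with
      | zero => simp [G]
      | add s t hs ht =>
        have : G (s + t) = G s + G t := by
          refine TensorProduct.ext_threefold' fun p u v => ?_
          simp [G_tmul, mul_add, TensorProduct.tmul_add]
        rw [this, LinearMap.add_apply, hs, ht, mul_add, map_add]
      | tmul a b =>
        simp only [LinearMap.rTensor_tmul, Algebra.TensorProduct.tmul_mul_tmul]
        rw [e4]
        generalize Q.comul p = d
        induction d with
        | zero => simp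
        | add s t hs ht => simp only [map_add, TensorProduct.add_tmul, hs, ht]
        | tmul u v => simp [G_tmul, contrL_tmul, TensorProduct.smul_tmul]
  have key := congrArg (G (Q.comul h)) (Q.coassoc_apply' 1)
  rw [e1, e2, comul_one_mul_comul] at key
  exact key

end QuantumGroupoid

namespace QuantumGroupoid

variable {H : Type u} [Ring H] [Algebra ℂ H]

/-- The finite-dimensional representations of (the algebra underlying) a quantum groupoid. -/
structure Rep (Q : QuantumGroupoid H) where
  V : Type u
  [acg : AddCommGroup V]
  [mod : Module ℂ V]
  [fin : FiniteDimensional ℂ V]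
  ρ : H →ₐ[ℂ] Module.End ℂ V

namespace Rep

attribute [instance] Rep.acg Rep.mod Rep.fin

variable {Q : QuantumGroupoid H}

/-- Morphisms of representations: `H`-equivariant linear maps. -/
@[ext]
structure Hom (U W : Rep Q) where
  toLin : U.V →ₗ[ℂ] W.V
  comm : ∀ h : H, toLin ∘ₗ U.ρ h = W.ρ h ∘ₗ toLin

instance : Category (Rep Q) where
  Hom := Hom
  id U := ⟨LinearMap.id, fun _ => rfl⟩
  comp f g := ⟨g.toLin ∘ₗ f.toLin, fun h => by
    rw [LinearMap.comp_assoc, f.comm, ← LinearMap.comp_assoc, g.comm, LinearMap.comp_assoc]⟩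

variable {U V W X U' V' W' : Rep Q}

@[ext]
lemma hom_ext {f g : U ⟶ W} (h : Hom.toLin f = Hom.toLin g) : f = g := Hom.ext h

@[simp] lemma id_toLin (U : Rep Q) : Hom.toLin (𝟙 U) = LinearMap.id := rfl

@[simp] lemma comp_toLin (f : U ⟶ V) (g : V ⟶ W) :
    Hom.toLin (f ≫ g) = Hom.toLin g ∘ₗ Hom.toLin f := rfl

lemma comm_apply (f : U ⟶ W) (h : H) (v : U.V) :
    Hom.toLin f (U.ρ h v) = W.ρ h (Hom.toLin f v) := LinearMap.congr_fun (Hom.comm f h) v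

/-- The space of equivariant linear maps. -/
def homSubmodule (U W : Rep Q) : Submodule ℂ (U.V →ₗ[ℂ] W.V) where
  carrier := {f | ∀ h : H, f ∘ₗ U.ρ h = W.ρ h ∘ₗ f}
  zero_mem' h := by simp
  add_mem' {f g} hf hg h := by
    rw [LinearMap.add_comp, LinearMap.comp_add, hf h, hg h]
  smul_mem' c f hf h := by
    rw [LinearMap.smul_comp, LinearMap.comp_smul, hf h]

def homEquiv (U W : Rep Q) : (U ⟶ W) ≃ homSubmodule U W where
  toFun f := ⟨Hom.toLin f, Hom.comm f⟩
  invFun f := ⟨f.1, f.2⟩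

instance : AddCommGroup (U ⟶ W) := (homEquiv U W).addCommGroup

instance : Module ℂ (U ⟶ W) := (homEquiv U W).module ℂ

@[simp] lemma add_toLin (f g : U ⟶ W) : Hom.toLin (f + g) = Hom.toLin f + Hom.toLin g := rfl

@[simp] lemma smul_toLin (c : ℂ) (f : U ⟶ W) : Hom.toLin (c • f) = c • Hom.toLin f := rfl

instance : Preadditive (Rep Q) where
  add_comp _ _ _ f g h := by ext1; simp [LinearMap.comp_add]
  comp_add _ _ _ f g h := by ext1; simp [LinearMap.add_comp]

instance : Linear ℂ (Rep Q) where
  smul_comp _ _ _ c f g := by ext1; simp [LinearMap.comp_smul]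
  comp_smul _ _ _ f c g := by ext1; simp [LinearMap.smul_comp]

/-- An equivariant linear equivalence is an isomorphism of representations. -/
def isoOfInverse (f : U ⟶ W) (g : W.V →ₗ[ℂ] U.V) (h₁ : g ∘ₗ Hom.toLin f = LinearMap.id)
    (h₂ : Hom.toLin f ∘ₗ g = LinearMap.id) : U ≅ W where
  hom := f
  inv := ⟨g, fun h => by
    calc g ∘ₗ W.ρ h = g ∘ₗ W.ρ h ∘ₗ (Hom.toLin f ∘ₗ g) := by rw [h₂]; rfl
      _ = g ∘ₗ (W.ρ h ∘ₗ Hom.toLin f) ∘ₗ g := by simp only [LinearMap.comp_assoc]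
      _ = (g ∘ₗ Hom.toLin f) ∘ₗ U.ρ h ∘ₗ g := by
        rw [← Hom.comm f h]; simp only [LinearMap.comp_assoc]
      _ = U.ρ h ∘ₗ g := by rw [h₁]; rfl⟩
  hom_inv_id := by ext1; exact h₁
  inv_hom_id := by ext1; exact h₂

/-- If `φ : H → End M` is linear and multiplicative but not necessarily unital, the range
`φ(1) M` is a representation of `H`. -/
def corner (Q : QuantumGroupoid H) {M : Type u} [AddCommGroup M] [Module ℂ M]
    [FiniteDimensional ℂ M] (φ : H →ₗ[ℂ] Module.End ℂ M)
    (hφ : ∀ a b, φ (a * b) = φ a ∘ₗ φ b) : Rep Q where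
  V := LinearMap.range (φ 1)
  ρ := AlgHom.ofLinearMap
    { toFun := fun h => (φ 1).rangeRestrict ∘ₗ φ h ∘ₗ (LinearMap.range (φ 1)).subtype
      map_add' := fun a b => by ext v; simp
      map_smul' := fun c a => by ext v; simp }
    (by
      ext ⟨_, v, rfl⟩
      have h := LinearMap.congr_fun (hφ 1 1) v
      rw [mul_one] at h
      simp only [LinearMap.coe_mk, AddHom.coe_mk, LinearMap.comp_apply, Submodule.subtype_apply,
        LinearMap.codRestrict_apply, Module.End.one_apply, LinearMap.rangeRestrict] at h ⊢
      rw [← h, ← h])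
    (fun a b => by
      ext v
      have h1 := hφ 1 b
      have h2 := hφ a b
      rw [one_mul] at h1
      simp only [LinearMap.coe_mk, AddHom.coe_mk, LinearMap.comp_apply, Submodule.subtype_apply,
        LinearMap.codRestrict_apply, Module.End.mul_apply, LinearMap.rangeRestrict, h2]
      rw [← LinearMap.comp_apply (φ 1) (φ b), ← h1])

section corner

variable {M : Type u} [AddCommGroup M] [Module ℂ M] [FiniteDimensional ℂ M]
  (φ : H →ₗ[ℂ] Module.End ℂ M) (hφ : ∀ a b, φ (a * b) = φ a ∘ₗ φ b)

/-- The inclusion of `φ(1) M` in `M`. -/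
def cornerIncl : (corner Q φ hφ).V →ₗ[ℂ] M := (LinearMap.range (φ 1)).subtype

/-- The projection of `M` onto `φ(1) M`. -/
def cornerProj : M →ₗ[ℂ] (corner Q φ hφ).V := (φ 1).rangeRestrict

lemma incl_proj : cornerIncl (Q := Q) φ hφ ∘ₗ cornerProj φ hφ = φ 1 := rfl

lemma incl_injective : Function.Injective (cornerIncl (Q := Q) φ hφ) :=
  Subtype.val_injective

lemma proj_incl : cornerProj (Q := Q) φ hφ ∘ₗ cornerIncl φ hφ = LinearMap.id := by
  ext ⟨_, v, rfl⟩
  have h := LinearMap.congr_fun (hφ 1 1) v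
  rw [mul_one] at h
  exact Subtype.ext h.symm

lemma incl_ρ (h : H) : cornerIncl (Q := Q) φ hφ ∘ₗ (corner Q φ hφ).ρ h =
    φ h ∘ₗ cornerIncl φ hφ := by
  have h1 := hφ 1 h
  rw [one_mul] at h1
  conv_rhs => rw [h1]
  rfl

end corner

section act

variable {M N L M' N' : Type u} [AddCommGroup M] [Module ℂ M] [AddCommGroup N] [Module ℂ N]
  [AddCommGroup L] [Module ℂ L] [AddCommGroup M'] [Module ℂ M'] [AddCommGroup N'] [Module ℂ N']

/-- The action `(a ⊗ b) (m ⊗ n) = a m ⊗ b n` of `H ⊗ H` on `M ⊗ N`. -/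
def act (φ : H →ₗ[ℂ] Module.End ℂ M) (ψ : H →ₗ[ℂ] Module.End ℂ N) :
    H ⊗[ℂ] H →ₗ[ℂ] Module.End ℂ (M ⊗[ℂ] N) :=
  TensorProduct.homTensorHomMap (RingHom.id ℂ) M N M N ∘ₗ TensorProduct.map φ ψ

@[simp] lemma act_tmul (φ : H →ₗ[ℂ] Module.End ℂ M) (ψ : H →ₗ[ℂ] Module.End ℂ N) (a b : H) :
    act φ ψ (a ⊗ₜ b) = TensorProduct.map (φ a) (ψ b) := by
  simp [act]

lemma act_mul (φ : H →ₗ[ℂ] Module.End ℂ M) (ψ : H →ₗ[ℂ] Module.End ℂ N)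
    (hφ : ∀ a b, φ (a * b) = φ a ∘ₗ φ b) (hψ : ∀ a b, ψ (a * b) = ψ a ∘ₗ ψ b)
    (s t : H ⊗[ℂ] H) : act φ ψ (s * t) = act φ ψ s ∘ₗ act φ ψ t := by
  induction s with
  | zero => simp
  | add s s' hs hs' => rw [add_mul, map_add, map_add, hs, hs', LinearMap.add_comp]
  | tmul a b =>
    induction t with
    | zero => simp
    | add t t' ht ht' => rw [mul_add, map_add, map_add, ht, ht', LinearMap.comp_add]
    | tmul c d =>
      simp only [Algebra.TensorProduct.tmul_mul_tmul, act_tmul, hφ, hψ, TensorProduct.map_comp]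

lemma map_comp_act {φ : H →ₗ[ℂ] Module.End ℂ M} {ψ : H →ₗ[ℂ] Module.End ℂ N}
    {φ' : H →ₗ[ℂ] Module.End ℂ M'} {ψ' : H →ₗ[ℂ] Module.End ℂ N'}
    (f : M →ₗ[ℂ] M') (g : N →ₗ[ℂ] N') (hf : ∀ h, f ∘ₗ φ h = φ' h ∘ₗ f)
    (hg : ∀ h, g ∘ₗ ψ h = ψ' h ∘ₗ g) (t : H ⊗[ℂ] H) :
    TensorProduct.map f g ∘ₗ act φ ψ t = act φ' ψ' t ∘ₗ TensorProduct.map f g := by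
  induction t with
  | zero => simp
  | add s t hs ht => rw [map_add, map_add, LinearMap.comp_add, hs, ht, LinearMap.add_comp]
  | tmul a b => simp only [act_tmul, ← TensorProduct.map_comp, hf, hg]

/-- The action of `H` on `M ⊗ N` through the comultiplication. -/
def actΔ (Q : QuantumGroupoid H) (φ : H →ₗ[ℂ] Module.End ℂ M) (ψ : H →ₗ[ℂ] Module.End ℂ N) :
    H →ₗ[ℂ] Module.End ℂ (M ⊗[ℂ] N) :=
  act φ ψ ∘ₗ Q.comul

lemma actΔ_apply (φ : H →ₗ[ℂ] Module.End ℂ M) (ψ : H →ₗ[ℂ] Module.End ℂ N) (h : H) :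
    actΔ Q φ ψ h = act φ ψ (Q.comul h) := rfl

lemma actΔ_mul (φ : H →ₗ[ℂ] Module.End ℂ M) (ψ : H →ₗ[ℂ] Module.End ℂ N)
    (hφ : ∀ a b, φ (a * b) = φ a ∘ₗ φ b) (hψ : ∀ a b, ψ (a * b) = ψ a ∘ₗ ψ b) (a b : H) :
    actΔ Q φ ψ (a * b) = actΔ Q φ ψ a ∘ₗ actΔ Q φ ψ b := by
  simp only [actΔ_apply, Q.comul_mul, act_mul φ ψ hφ hψ]

lemma assoc_actΔ (φ : H →ₗ[ℂ] Module.End ℂ M) (ψ : H →ₗ[ℂ] Module.End ℂ N)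
    (χ : H →ₗ[ℂ] Module.End ℂ L) (h : H) :
    (TensorProduct.assoc ℂ M N L).toLinearMap ∘ₗ actΔ Q (actΔ Q φ ψ) χ h =
      actΔ Q φ (actΔ Q ψ χ) h ∘ₗ (TensorProduct.assoc ℂ M N L).toLinearMap := by
  let A : H ⊗[ℂ] (H ⊗[ℂ] H) →ₗ[ℂ] Module.End ℂ (M ⊗[ℂ] (N ⊗[ℂ] L)) :=
    TensorProduct.homTensorHomMap (RingHom.id ℂ) M (N ⊗[ℂ] L) M (N ⊗[ℂ] L) ∘ₗ TensorProduct.map φ (act ψ χ)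
  have e1 : ∀ t : H ⊗[ℂ] H, act φ (actΔ Q ψ χ) t = A (Q.comul.lTensor H t) := by
    intro t
    induction t with
    | zero => simp
    | add s t hs ht => rw [map_add, map_add, map_add, hs, ht]
    | tmul a b => simp [A, actΔ_apply]
  have e3 : ∀ (d : H ⊗[ℂ] H) (b : H), (TensorProduct.assoc ℂ M N L).toLinearMap ∘ₗ
      TensorProduct.map (act φ ψ d) (χ b) = A (TensorProduct.assoc ℂ H H H (d ⊗ₜ b)) ∘ₗ
        (TensorProduct.assoc ℂ M N L).toLinearMap := by
    intro d b
    induction d with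
    | zero => simp
    | add s t hs ht =>
      rw [map_add, TensorProduct.map_add_left, LinearMap.comp_add, hs, ht, TensorProduct.add_tmul,
        map_add, map_add, LinearMap.add_comp]
    | tmul u v =>
      refine TensorProduct.ext_threefold fun x y z => ?_
      simp [A]
  have e2 : ∀ t : H ⊗[ℂ] H, (TensorProduct.assoc ℂ M N L).toLinearMap ∘ₗ act (actΔ Q φ ψ) χ t =
      A (TensorProduct.assoc ℂ H H H (Q.comul.rTensor H t)) ∘ₗ
        (TensorProduct.assoc ℂ M N L).toLinearMap := by
    intro t
    induction t with
    | zero => simp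
    | add s t hs ht =>
      rw [map_add, LinearMap.comp_add, hs, ht, map_add, map_add, map_add, LinearMap.add_comp]
    | tmul a b => rw [act_tmul, actΔ_apply, e3, LinearMap.rTensor_tmul]
  rw [actΔ_apply, e2, Q.coassoc_apply', ← e1]
  rfl

end act

lemma ρ_mul (U : Rep Q) (a b : H) : U.ρ.toLinearMap (a * b) =
    U.ρ.toLinearMap a ∘ₗ U.ρ.toLinearMap b := by
  simp only [AlgHom.toLinearMap_apply, map_mul]; rfl

/-- The tensor product `Δ(η) (U ⊗ V)` of representations. -/
def tens (U V : Rep Q) : Rep Q :=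
  corner Q (actΔ Q U.ρ.toLinearMap V.ρ.toLinearMap) (actΔ_mul _ _ U.ρ_mul V.ρ_mul)

/-- The inclusion of the tensor product of representations in that of vector spaces. -/
def incl (U V : Rep Q) : (tens U V).V →ₗ[ℂ] U.V ⊗[ℂ] V.V :=
  cornerIncl _ (actΔ_mul _ _ U.ρ_mul V.ρ_mul)

/-- The projection of the tensor product of vector spaces onto that of representations. -/
def proj (U V : Rep Q) : U.V ⊗[ℂ] V.V →ₗ[ℂ] (tens U V).V :=
  cornerProj _ (actΔ_mul _ _ U.ρ_mul V.ρ_mul)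

lemma incl_comp_proj (U V : Rep Q) : incl U V ∘ₗ proj U V =
    actΔ Q U.ρ.toLinearMap V.ρ.toLinearMap 1 := rfl

lemma proj_comp_incl (U V : Rep Q) : proj U V ∘ₗ incl U V = LinearMap.id :=
  proj_incl _ (actΔ_mul _ _ U.ρ_mul V.ρ_mul)

lemma incl_comp_ρ (U V : Rep Q) (h : H) : incl U V ∘ₗ (tens U V).ρ h =
    actΔ Q U.ρ.toLinearMap V.ρ.toLinearMap h ∘ₗ incl U V :=
  incl_ρ _ (actΔ_mul _ _ U.ρ_mul V.ρ_mul) h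

lemma act_one_comp_incl (U V : Rep Q) :
    actΔ Q U.ρ.toLinearMap V.ρ.toLinearMap 1 ∘ₗ incl U V = incl U V := by
  rw [← incl_comp_proj, LinearMap.comp_assoc, proj_comp_incl, LinearMap.comp_id]

lemma eq_of_incl {M : Type*} [AddCommGroup M] [Module ℂ M] {U V : Rep Q}
    {f g : M →ₗ[ℂ] (tens U V).V} (h : incl U V ∘ₗ f = incl U V ∘ₗ g) : f = g := by
  have := congrArg (fun k => proj U V ∘ₗ k) h
  simpa only [← LinearMap.comp_assoc, proj_comp_incl, LinearMap.id_comp] using this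

/-- The tensor product of equivariant maps. -/
def tensMap (f : U ⟶ U') (g : V ⟶ V') : tens U V ⟶ tens U' V' :=
  ⟨proj U' V' ∘ₗ TensorProduct.map (Hom.toLin f) (Hom.toLin g) ∘ₗ incl U V, fun h => by
    apply eq_of_incl
    have e := fun t => map_comp_act (φ := U.ρ.toLinearMap) (ψ := V.ρ.toLinearMap)
      (φ' := U'.ρ.toLinearMap) (ψ' := V'.ρ.toLinearMap) _ _ (Hom.comm f) (Hom.comm g) t
    calc _ = (incl U' V' ∘ₗ proj U' V') ∘ₗ TensorProduct.map (Hom.toLin f) (Hom.toLin g) ∘ₗ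
          incl U V ∘ₗ (tens U V).ρ h := by simp only [LinearMap.comp_assoc]
      _ = (actΔ Q U'.ρ.toLinearMap V'.ρ.toLinearMap 1 ∘ₗ
          actΔ Q U'.ρ.toLinearMap V'.ρ.toLinearMap h) ∘ₗ
          TensorProduct.map (Hom.toLin f) (Hom.toLin g) ∘ₗ incl U V := by
        rw [incl_comp_proj, incl_comp_ρ, ← LinearMap.comp_assoc _ _ (TensorProduct.map _ _), actΔ_apply _ _ h, e]
        simp only [LinearMap.comp_assoc]; rfl
      _ = (actΔ Q U'.ρ.toLinearMap V'.ρ.toLinearMap h ∘ₗ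
          actΔ Q U'.ρ.toLinearMap V'.ρ.toLinearMap 1) ∘ₗ
          TensorProduct.map (Hom.toLin f) (Hom.toLin g) ∘ₗ incl U V := by
        rw [← actΔ_mul _ _ U'.ρ_mul V'.ρ_mul, ← actΔ_mul _ _ U'.ρ_mul V'.ρ_mul, one_mul, mul_one]
      _ = _ := by
        rw [← LinearMap.comp_assoc _ _ (incl U' V'), incl_comp_ρ, ← incl_comp_proj]
        simp only [LinearMap.comp_assoc]⟩

lemma incl_tensMap (f : U ⟶ U') (g : V ⟶ V') : incl U' V' ∘ₗ Hom.toLin (tensMap f g) =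
    TensorProduct.map (Hom.toLin f) (Hom.toLin g) ∘ₗ incl U V := by
  have e := map_comp_act (φ := U.ρ.toLinearMap) (ψ := V.ρ.toLinearMap)
      (φ' := U'.ρ.toLinearMap) (ψ' := V'.ρ.toLinearMap) _ _ (Hom.comm f) (Hom.comm g) (Q.comul 1)
  calc _ = (incl U' V' ∘ₗ proj U' V') ∘ₗ TensorProduct.map (Hom.toLin f) (Hom.toLin g) ∘ₗ
          incl U V := rfl
    _ = TensorProduct.map (Hom.toLin f) (Hom.toLin g) ∘ₗ
          actΔ Q U.ρ.toLinearMap V.ρ.toLinearMap 1 ∘ₗ incl U V := by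
      rw [incl_comp_proj, actΔ_apply, ← LinearMap.comp_assoc, ← e]; rfl
    _ = _ := by rw [act_one_comp_incl]

/-- The inclusion of `(U ⊗ V) ⊗ W` in the tensor product of vector spaces. -/
def inclL (U V W : Rep Q) : (tens (tens U V) W).V →ₗ[ℂ] (U.V ⊗[ℂ] V.V) ⊗[ℂ] W.V :=
  (incl U V).rTensor W.V ∘ₗ incl (tens U V) W

/-- The inclusion of `U ⊗ (V ⊗ W)` in the tensor product of vector spaces. -/
def inclR (U V W : Rep Q) : (tens U (tens V W)).V →ₗ[ℂ] U.V ⊗[ℂ] (V.V ⊗[ℂ] W.V) :=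
  (incl V W).lTensor U.V ∘ₗ incl U (tens V W)

def projL (U V W : Rep Q) : (U.V ⊗[ℂ] V.V) ⊗[ℂ] W.V →ₗ[ℂ] (tens (tens U V) W).V :=
  proj (tens U V) W ∘ₗ (proj U V).rTensor W.V

def projR (U V W : Rep Q) : U.V ⊗[ℂ] (V.V ⊗[ℂ] W.V) →ₗ[ℂ] (tens U (tens V W)).V :=
  proj U (tens V W) ∘ₗ (proj V W).lTensor U.V

lemma projL_inclL (U V W : Rep Q) : projL U V W ∘ₗ inclL U V W = LinearMap.id := by
  rw [projL, inclL, LinearMap.comp_assoc, ← LinearMap.comp_assoc _ _ ((proj U V).rTensor W.V),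
    ← LinearMap.rTensor_comp, proj_comp_incl, LinearMap.rTensor_id, LinearMap.id_comp,
    proj_comp_incl]

lemma projR_inclR (U V W : Rep Q) : projR U V W ∘ₗ inclR U V W = LinearMap.id := by
  rw [projR, inclR, LinearMap.comp_assoc, ← LinearMap.comp_assoc _ _ ((proj V W).lTensor U.V),
    ← LinearMap.lTensor_comp, proj_comp_incl, LinearMap.lTensor_id, LinearMap.id_comp,
    proj_comp_incl]

lemma eq_of_inclL {M : Type*} [AddCommGroup M] [Module ℂ M] {U V W : Rep Q}
    {f g : M →ₗ[ℂ] (tens (tens U V) W).V} (h : inclL U V W ∘ₗ f = inclL U V W ∘ₗ g) : f = g := by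
  have := congrArg (fun k => projL U V W ∘ₗ k) h
  simpa only [← LinearMap.comp_assoc, projL_inclL, LinearMap.id_comp] using this

lemma eq_of_inclR {M : Type*} [AddCommGroup M] [Module ℂ M] {U V W : Rep Q}
    {f g : M →ₗ[ℂ] (tens U (tens V W)).V} (h : inclR U V W ∘ₗ f = inclR U V W ∘ₗ g) : f = g := by
  have := congrArg (fun k => projR U V W ∘ₗ k) h
  simpa only [← LinearMap.comp_assoc, projR_inclR, LinearMap.id_comp] using this

/-- The two actions of `H` on triple tensor products of vector spaces. -/
def act₃L (U V W : Rep Q) : H →ₗ[ℂ] Module.End ℂ ((U.V ⊗[ℂ] V.V) ⊗[ℂ] W.V) :=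
  actΔ Q (actΔ Q U.ρ.toLinearMap V.ρ.toLinearMap) W.ρ.toLinearMap

def act₃R (U V W : Rep Q) : H →ₗ[ℂ] Module.End ℂ (U.V ⊗[ℂ] (V.V ⊗[ℂ] W.V)) :=
  actΔ Q U.ρ.toLinearMap (actΔ Q V.ρ.toLinearMap W.ρ.toLinearMap)

lemma rTensor_incl_act (U V W : Rep Q) (h : H) : (incl U V).rTensor W.V ∘ₗ
    actΔ Q (tens U V).ρ.toLinearMap W.ρ.toLinearMap h =
    act₃L U V W h ∘ₗ (incl U V).rTensor W.V :=
  map_comp_act (φ := (tens U V).ρ.toLinearMap) (ψ := W.ρ.toLinearMap)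
    (incl U V) LinearMap.id (incl_comp_ρ U V) (fun _ => rfl) _

lemma lTensor_incl_act (U V W : Rep Q) (h : H) : (incl V W).lTensor U.V ∘ₗ
    actΔ Q U.ρ.toLinearMap (tens V W).ρ.toLinearMap h =
    act₃R U V W h ∘ₗ (incl V W).lTensor U.V :=
  map_comp_act (φ := U.ρ.toLinearMap) (ψ := (tens V W).ρ.toLinearMap)
    LinearMap.id (incl V W) (fun _ => rfl) (incl_comp_ρ V W) _

lemma inclL_ρ (U V W : Rep Q) (h : H) : inclL U V W ∘ₗ (tens (tens U V) W).ρ h =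
    act₃L U V W h ∘ₗ inclL U V W := by
  rw [inclL, LinearMap.comp_assoc, incl_comp_ρ, ← LinearMap.comp_assoc, rTensor_incl_act,
    LinearMap.comp_assoc]

lemma inclR_ρ (U V W : Rep Q) (h : H) : inclR U V W ∘ₗ (tens U (tens V W)).ρ h =
    act₃R U V W h ∘ₗ inclR U V W := by
  rw [inclR, LinearMap.comp_assoc, incl_comp_ρ, ← LinearMap.comp_assoc, lTensor_incl_act,
    LinearMap.comp_assoc]

lemma inclL_projL (U V W : Rep Q) : inclL U V W ∘ₗ projL U V W = act₃L U V W 1 := by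
  have h1 : ∀ t : H ⊗[ℂ] H, act (actΔ Q U.ρ.toLinearMap V.ρ.toLinearMap) W.ρ.toLinearMap t ∘ₗ
      (incl U V ∘ₗ proj U V).rTensor W.V =
      act (actΔ Q U.ρ.toLinearMap V.ρ.toLinearMap) W.ρ.toLinearMap t := by
    intro t
    induction t with
    | zero => simp
    | add s t hs ht => rw [map_add, LinearMap.add_comp, hs, ht]
    | tmul a b =>
      rw [act_tmul, incl_comp_proj, LinearMap.rTensor, ← TensorProduct.map_comp,
        ← actΔ_mul _ _ U.ρ_mul V.ρ_mul, mul_one, LinearMap.comp_id]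
  calc _ = (incl U V).rTensor W.V ∘ₗ (incl (tens U V) W ∘ₗ proj (tens U V) W) ∘ₗ
        (proj U V).rTensor W.V := by simp only [inclL, projL, LinearMap.comp_assoc]
    _ = act₃L U V W 1 ∘ₗ (incl U V ∘ₗ proj U V).rTensor W.V := by
      rw [incl_comp_proj, ← LinearMap.comp_assoc, rTensor_incl_act, LinearMap.comp_assoc,
        LinearMap.rTensor_comp]
    _ = _ := h1 _

lemma inclR_projR (U V W : Rep Q) : inclR U V W ∘ₗ projR U V W = act₃R U V W 1 := by
  have h1 : ∀ t : H ⊗[ℂ] H, act U.ρ.toLinearMap (actΔ Q V.ρ.toLinearMap W.ρ.toLinearMap) t ∘ₗ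
      (incl V W ∘ₗ proj V W).lTensor U.V =
      act U.ρ.toLinearMap (actΔ Q V.ρ.toLinearMap W.ρ.toLinearMap) t := by
    intro t
    induction t with
    | zero => simp
    | add s t hs ht => rw [map_add, LinearMap.add_comp, hs, ht]
    | tmul a b =>
      rw [act_tmul, incl_comp_proj, LinearMap.lTensor, ← TensorProduct.map_comp,
        ← actΔ_mul _ _ V.ρ_mul W.ρ_mul, mul_one, LinearMap.comp_id]
  calc _ = (incl V W).lTensor U.V ∘ₗ (incl U (tens V W) ∘ₗ proj U (tens V W)) ∘ₗ
        (proj V W).lTensor U.V := by simp only [inclR, projR, LinearMap.comp_assoc]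
    _ = act₃R U V W 1 ∘ₗ (incl V W ∘ₗ proj V W).lTensor U.V := by
      rw [incl_comp_proj, ← LinearMap.comp_assoc, lTensor_incl_act, LinearMap.comp_assoc,
        LinearMap.lTensor_comp]
    _ = _ := h1 _

lemma act₃L_inclL (U V W : Rep Q) : act₃L U V W 1 ∘ₗ inclL U V W = inclL U V W := by
  rw [← inclL_projL, LinearMap.comp_assoc, projL_inclL, LinearMap.comp_id]

lemma act₃R_inclR (U V W : Rep Q) : act₃R U V W 1 ∘ₗ inclR U V W = inclR U V W := by
  rw [← inclR_projR, LinearMap.comp_assoc, projR_inclR, LinearMap.comp_id]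

/-- The map `(U ⊗ V) ⊗ W → U ⊗ (V ⊗ W)` induced by the associativity of the tensor product of
vector spaces. -/
def assocLin (U V W : Rep Q) : (tens (tens U V) W).V →ₗ[ℂ] (tens U (tens V W)).V :=
  projR U V W ∘ₗ (TensorProduct.assoc ℂ U.V V.V W.V).toLinearMap ∘ₗ inclL U V W

def assocInvLin (U V W : Rep Q) : (tens U (tens V W)).V →ₗ[ℂ] (tens (tens U V) W).V :=
  projL U V W ∘ₗ (TensorProduct.assoc ℂ U.V V.V W.V).symm.toLinearMap ∘ₗ inclR U V W

lemma inclR_assocLin (U V W : Rep Q) : inclR U V W ∘ₗ assocLin U V W =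
    (TensorProduct.assoc ℂ U.V V.V W.V).toLinearMap ∘ₗ inclL U V W := by
  rw [assocLin, ← LinearMap.comp_assoc, inclR_projR, ← LinearMap.comp_assoc, act₃R, ← assoc_actΔ,
    LinearMap.comp_assoc]
  exact congrArg _ (act₃L_inclL U V W)

lemma assoc_symm_act (U V W : Rep Q) (h : H) :
    (TensorProduct.assoc ℂ U.V V.V W.V).symm.toLinearMap ∘ₗ act₃R U V W h =
    act₃L U V W h ∘ₗ (TensorProduct.assoc ℂ U.V V.V W.V).symm.toLinearMap := by
  have := assoc_actΔ (Q := Q) U.ρ.toLinearMap V.ρ.toLinearMap W.ρ.toLinearMap h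
  refine LinearMap.ext fun x => ?_
  obtain ⟨y, rfl⟩ := (TensorProduct.assoc ℂ U.V V.V W.V).surjective x
  have h2 := LinearMap.congr_fun this y
  simp only [LinearMap.comp_apply, LinearEquiv.coe_coe, LinearEquiv.symm_apply_apply] at h2 ⊢
  rw [LinearEquiv.symm_apply_eq]
  exact h2.symm

lemma inclL_assocInvLin (U V W : Rep Q) : inclL U V W ∘ₗ assocInvLin U V W =
    (TensorProduct.assoc ℂ U.V V.V W.V).symm.toLinearMap ∘ₗ inclR U V W := by
  rw [assocInvLin, ← LinearMap.comp_assoc, inclL_projL, ← LinearMap.comp_assoc, ← assoc_symm_act,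
    LinearMap.comp_assoc, act₃R_inclR]

/-- The associativity isomorphism. -/
def assocIso (U V W : Rep Q) : tens (tens U V) W ≅ tens U (tens V W) :=
  isoOfInverse ⟨assocLin U V W, fun h => by
      apply eq_of_inclR
      rw [← LinearMap.comp_assoc, inclR_assocLin, LinearMap.comp_assoc, inclL_ρ,
        ← LinearMap.comp_assoc, act₃L, assoc_actΔ, LinearMap.comp_assoc, ← inclR_assocLin,
        ← LinearMap.comp_assoc _ _ (inclR U V W), inclR_ρ, LinearMap.comp_assoc]
      rfl⟩
    (assocInvLin U V W)
    (by
      apply eq_of_inclL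
      change inclL U V W ∘ₗ assocInvLin U V W ∘ₗ assocLin U V W = _
      rw [← LinearMap.comp_assoc, inclL_assocInvLin, LinearMap.comp_assoc, inclR_assocLin]
      refine LinearMap.ext fun x => ?_
      simp)
    (by
      apply eq_of_inclR
      change inclR U V W ∘ₗ assocLin U V W ∘ₗ assocInvLin U V W = _
      rw [← LinearMap.comp_assoc, inclR_assocLin, LinearMap.comp_assoc, inclL_assocInvLin]
      refine LinearMap.ext fun x => ?_
      simp)

/-- The action `h · z = ε_t(h z)`. -/
def unitAct (Q : QuantumGroupoid H) : H →ₗ[ℂ] Module.End ℂ H where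
  toFun h := Q.εt ∘ₗ LinearMap.mulLeft ℂ h
  map_add' a b := by ext v; simp [add_mul]
  map_smul' c a := by ext v; simp

lemma unitAct_mul (Q : QuantumGroupoid H) (a b : H) :
    unitAct Q (a * b) = unitAct Q a ∘ₗ unitAct Q b := by
  ext v; simp [unitAct, εt_mul_εt]

/-- The tensor unit: the target counital subalgebra `H_t = ε_t(H)`, with `h · z = ε_t(h z)`. -/
def unitObj (Q : QuantumGroupoid H) : Rep Q :=
  haveI := Q.finite
  corner Q (unitAct Q) (unitAct_mul Q)

end Rep
end QuantumGroupoid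

namespace QuantumGroupoid

variable {H : Type u} [Ring H] [Algebra ℂ H]
namespace Rep
variable {Q : QuantumGroupoid H} {U V W X U' V' W' : Rep Q}

lemma incl_tensMap_apply (f : U ⟶ U') (g : V ⟶ V') (y : (tens U V).V) :
    incl U' V' (Hom.toLin (tensMap f g) y) =
      TensorProduct.map (Hom.toLin f) (Hom.toLin g) (incl U V y) :=
  LinearMap.congr_fun (incl_tensMap f g) y

lemma incl_inj (U V : Rep Q) : Function.Injective (incl U V) :=
  incl_injective _ (actΔ_mul _ _ U.ρ_mul V.ρ_mul)

lemma inclL_inj (U V W : Rep Q) : Function.Injective (inclL U V W) :=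
  Function.LeftInverse.injective (g := projL U V W) (LinearMap.congr_fun (projL_inclL U V W))

lemma inclR_inj (U V W : Rep Q) : Function.Injective (inclR U V W) :=
  Function.LeftInverse.injective (g := projR U V W) (LinearMap.congr_fun (projR_inclR U V W))

lemma act_one_incl_apply (U V : Rep Q) (y : (tens U V).V) :
    act U.ρ.toLinearMap V.ρ.toLinearMap (Q.comul 1) (incl U V y) = incl U V y :=
  LinearMap.congr_fun (act_one_comp_incl U V) y

lemma assocIso_hom_apply (U V W : Rep Q) (y : (tens (tens U V) W).V) :
    inclR U V W (Hom.toLin (assocIso U V W).hom y) =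
      TensorProduct.assoc ℂ U.V V.V W.V (inclL U V W y) :=
  LinearMap.congr_fun (inclR_assocLin U V W) y

lemma inclL_tensMap (f : U ⟶ U') (g : V ⟶ V') (k : W ⟶ W') (y : (tens (tens U V) W).V) :
    inclL U' V' W' (Hom.toLin (tensMap (tensMap f g) k) y) =
      TensorProduct.map (TensorProduct.map (Hom.toLin f) (Hom.toLin g)) (Hom.toLin k)
        (inclL U V W y) := by
  rw [inclL, LinearMap.comp_apply, incl_tensMap_apply, inclL, LinearMap.comp_apply]
  generalize incl (tens U V) W y = w
  induction w with
  | zero => simp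
  | add s t hs ht => simp only [map_add, hs, ht]
  | tmul a b => simp [incl_tensMap_apply]

lemma inclR_tensMap (f : U ⟶ U') (g : V ⟶ V') (k : W ⟶ W') (y : (tens U (tens V W)).V) :
    inclR U' V' W' (Hom.toLin (tensMap f (tensMap g k)) y) =
      TensorProduct.map (Hom.toLin f) (TensorProduct.map (Hom.toLin g) (Hom.toLin k))
        (inclR U V W y) := by
  rw [inclR, LinearMap.comp_apply, incl_tensMap_apply, inclR, LinearMap.comp_apply]
  generalize incl U (tens V W) y = w
  induction w with
  | zero => simp
  | add s t hs ht => simp only [map_add, hs, ht]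
  | tmul a b => simp [incl_tensMap_apply]

/-- The inclusion `H_t ⊆ H`. -/
def uincl (Q : QuantumGroupoid H) : (unitObj Q).V →ₗ[ℂ] H :=
  haveI := Q.finite
  cornerIncl (unitAct Q) (unitAct_mul Q)

/-- The projection `ε_t : H → H_t`. -/
def uproj (Q : QuantumGroupoid H) : H →ₗ[ℂ] (unitObj Q).V :=
  haveI := Q.finite
  cornerProj (unitAct Q) (unitAct_mul Q)

lemma uincl_inj (Q : QuantumGroupoid H) : Function.Injective (uincl Q) :=
  haveI := Q.finite
  incl_injective (unitAct Q) (unitAct_mul Q)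

lemma uproj_uincl (Q : QuantumGroupoid H) : uproj Q ∘ₗ uincl Q = LinearMap.id :=
  haveI := Q.finite
  proj_incl (unitAct Q) (unitAct_mul Q)

lemma uincl_uproj (Q : QuantumGroupoid H) (x : H) : uincl Q (uproj Q x) = Q.εt x := by
  have := Q.finite
  have h := LinearMap.congr_fun (incl_proj (Q := Q) (unitAct Q) (unitAct_mul Q)) x
  exact h.trans (by simp [unitAct])

lemma εt_uincl (Q : QuantumGroupoid H) (z : (unitObj Q).V) : Q.εt (uincl Q z) = uincl Q z := by
  have : z = uproj Q (uincl Q z) := (LinearMap.congr_fun (uproj_uincl Q) z).symm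
  rw [this, uincl_uproj, εt_εt]

lemma uincl_ρ (Q : QuantumGroupoid H) (h : H) :
    uincl Q ∘ₗ (unitObj Q).ρ h = unitAct Q h ∘ₗ uincl Q :=
  haveI := Q.finite
  incl_ρ (unitAct Q) (unitAct_mul Q) h

/-- `z ⊗ v ↦ z v` -/
def lact (V : Rep Q) : H ⊗[ℂ] V.V →ₗ[ℂ] V.V := TensorProduct.lift V.ρ.toLinearMap

/-- `v ⊗ z ↦ η₍₁₎ ε(η₍₂₎ z) v`; for `z` in the target counital subalgebra this is `S⁻¹(z) v`. -/
def ract (V : Rep Q) : V.V ⊗[ℂ] H →ₗ[ℂ] V.V :=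
  TensorProduct.lift (V.ρ.toLinearMap ∘ₗ Q.εbar).flip

@[simp] lemma lact_tmul (V : Rep Q) (z : H) (v : V.V) : lact V (z ⊗ₜ v) = V.ρ z v := by
  simp [lact]

@[simp] lemma ract_tmul (V : Rep Q) (z : H) (v : V.V) :
    ract V (v ⊗ₜ z) = V.ρ (Q.εbar z) v := by
  simp [ract]

lemma lact_act (V : Rep Q) (h z : H) (hz : Q.εt z = z) (v : V.V) :
    lact V (act (unitAct Q) V.ρ.toLinearMap (Q.comul h) (z ⊗ₜ v)) = V.ρ (h * z) v := by
  have e1 : ∀ t : H ⊗[ℂ] H, lact V (act (unitAct Q) V.ρ.toLinearMap t (z ⊗ₜ v)) =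
      V.ρ (LinearMap.mul' ℂ H (Q.εt.rTensor H (t * (z ⊗ₜ 1)))) v := by
    intro t
    induction t with
    | zero => simp
    | add s t hs ht => simp only [map_add, LinearMap.add_apply, add_mul, hs, ht]
    | tmul a b => simp [unitAct]
  have e2 : ∀ t : H ⊗[ℂ] H, LinearMap.mul' ℂ H (Q.εt.rTensor H t) =
      Q.contrL 1 (Q.comul 1 * t) := by
    intro t
    induction t with
    | zero => simp
    | add s t hs ht => simp only [map_add, mul_add, hs, ht]
    | tmul a b =>
      simp only [LinearMap.rTensor_tmul, LinearMap.mul'_apply, εt_eq]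
      generalize Q.comul 1 = s
      induction s with
      | zero => simp
      | add s t hs ht => simp only [map_add, add_mul, hs, ht]
      | tmul p q => simp [contrL_tmul]
  have e3 : Q.comul h * (z ⊗ₜ 1) = Q.comul (h * z) := by
    rw [← hz, Q.comul_mul, comul_εt, ← mul_assoc, comul_mul_comul_one]
  rw [e1, e2, e3, comul_one_mul_comul, contrL_one_comul]

lemma ract_act (V : Rep Q) (h z : H) (v : V.V) :
    ract V (act V.ρ.toLinearMap (unitAct Q) (Q.comul h) (v ⊗ₜ z)) = V.ρ (h * Q.εbar z) v := by
  have e1 : ∀ t : H ⊗[ℂ] H, ract V (act V.ρ.toLinearMap (unitAct Q) t (v ⊗ₜ z)) =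
      V.ρ (Q.contrR z (Q.comul 1 * t)) v := by
    intro t
    induction t with
    | zero => simp
    | add s t hs ht => simp only [map_add, LinearMap.add_apply, mul_add, hs, ht]
    | tmul a b =>
      have h1 : Q.εbar (Q.εt (b * z)) = Q.εbar (b * z) := by
        simpa using Q.εbar_mul_εt 1 (b * z)
      have h2 : Q.contrR z (Q.comul 1 * (a ⊗ₜ b)) = Q.εbar (b * z) * a := by
        rw [εbar_eq]
        generalize Q.comul 1 = s
        induction s with
        | zero => simp
        | add s t hs ht => simp only [map_add, add_mul, hs, ht]
        | tmul p q => simp [contrR_tmul, mul_assoc]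
      simp [unitAct, h1, h2]
  rw [e1, comul_one_mul_comul, contrR_comul]

lemma act_one_lact (V : Rep Q) (z : H) (hz : Q.εt z = z) (v : V.V) :
    act (unitAct Q) V.ρ.toLinearMap (Q.comul 1) (1 ⊗ₜ V.ρ z v) =
      act (unitAct Q) V.ρ.toLinearMap (Q.comul 1) (z ⊗ₜ v) := by
  let Ψ : H ⊗[ℂ] H →ₗ[ℂ] H ⊗[ℂ] V.V :=
    TensorProduct.map Q.εt (LinearMap.applyₗ v ∘ₗ V.ρ.toLinearMap)
  have e1 : ∀ t : H ⊗[ℂ] H, act (unitAct Q) V.ρ.toLinearMap t (1 ⊗ₜ V.ρ z v) =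
      Ψ (t * (1 ⊗ₜ z)) := by
    intro t
    induction t with
    | zero => simp
    | add s t hs ht => simp only [map_add, LinearMap.add_apply, add_mul, hs, ht]
    | tmul a b => simp [unitAct, Ψ]
  have e2 : ∀ t : H ⊗[ℂ] H, act (unitAct Q) V.ρ.toLinearMap t (z ⊗ₜ v) =
      Ψ (t * (z ⊗ₜ 1)) := by
    intro t
    induction t with
    | zero => simp
    | add s t hs ht => simp only [map_add, LinearMap.add_apply, add_mul, hs, ht]
    | tmul a b => simp [unitAct, Ψ]
  have e3 : ∀ t, Ψ t = (LinearMap.applyₗ v ∘ₗ V.ρ.toLinearMap).lTensor H (Q.εt.rTensor H t) := by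
    intro t
    rw [← LinearMap.comp_apply, LinearMap.lTensor_comp_rTensor]
  have e4 : Q.εt.rTensor H (Q.comul 1 * (1 ⊗ₜ z)) = Q.εt.rTensor H (Q.comul 1) * (1 ⊗ₜ z) := by
    generalize Q.comul 1 = t
    induction t with
    | zero => simp
    | add s t hs ht => simp only [map_add, add_mul, hs, ht]
    | tmul a b => simp
  rw [e1, e2, e3, e3, e4, ← εt_comul]
  conv_rhs => rw [← hz, ← comul_εt, hz]

lemma act_one_ract (U : Rep Q) (z : H) (hz : Q.εt z = z) (v : U.V) :
    act U.ρ.toLinearMap (unitAct Q) (Q.comul 1) (U.ρ (Q.εbar z) v ⊗ₜ 1) =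
      act U.ρ.toLinearMap (unitAct Q) (Q.comul 1) (v ⊗ₜ z) := by
  let Ψ : H ⊗[ℂ] H →ₗ[ℂ] U.V ⊗[ℂ] H :=
    TensorProduct.map (LinearMap.applyₗ v ∘ₗ U.ρ.toLinearMap) Q.εt
  have e1 : ∀ t : H ⊗[ℂ] H, act U.ρ.toLinearMap (unitAct Q) t (U.ρ (Q.εbar z) v ⊗ₜ 1) =
      Ψ (t * (Q.εbar z ⊗ₜ 1)) := by
    intro t
    induction t with
    | zero => simp
    | add s t hs ht => simp only [map_add, LinearMap.add_apply, add_mul, hs, ht]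
    | tmul a b => simp [unitAct, Ψ]
  have e2 : ∀ t : H ⊗[ℂ] H, act U.ρ.toLinearMap (unitAct Q) t (v ⊗ₜ z) =
      Ψ (t * (1 ⊗ₜ z)) := by
    intro t
    induction t with
    | zero => simp
    | add s t hs ht => simp only [map_add, LinearMap.add_apply, add_mul, hs, ht]
    | tmul a b => simp [unitAct, Ψ]
  rw [e1, e2, comul_one_mul_εbar, hz]

lemma act_one_middle (U V : Rep Q) (z : H) (hz : Q.εt z = z) (x : U.V) (y : V.V) :
    act U.ρ.toLinearMap V.ρ.toLinearMap (Q.comul 1) (x ⊗ₜ V.ρ z y) =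
      act U.ρ.toLinearMap V.ρ.toLinearMap (Q.comul 1) (U.ρ (Q.εbar z) x ⊗ₜ y) := by
  have e1 : ∀ (t : H ⊗[ℂ] H) (a b : H),
      act U.ρ.toLinearMap V.ρ.toLinearMap t (U.ρ a x ⊗ₜ V.ρ b y) =
      act U.ρ.toLinearMap V.ρ.toLinearMap (t * (a ⊗ₜ b)) (x ⊗ₜ y) := by
    intro t a b
    induction t with
    | zero => simp
    | add s t hs ht => simp only [map_add, LinearMap.add_apply, add_mul, hs, ht]
    | tmul p q => simp
  have h1 := e1 (Q.comul 1) 1 z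
  have h2 := e1 (Q.comul 1) (Q.εbar z) 1
  simp only [map_one, Module.End.one_apply] at h1 h2
  rw [h1, h2, comul_one_mul_εbar, hz]

/-- The inclusion of `H_t ⊗ V` in the tensor product of vector spaces `H ⊗ V`. -/
def lincl (V : Rep Q) : (tens (unitObj Q) V).V →ₗ[ℂ] H ⊗[ℂ] V.V :=
  (uincl Q).rTensor V.V ∘ₗ incl (unitObj Q) V

def rincl (V : Rep Q) : (tens V (unitObj Q)).V →ₗ[ℂ] V.V ⊗[ℂ] H :=
  (uincl Q).lTensor V.V ∘ₗ incl V (unitObj Q)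

lemma rTensor_uincl_act (V : Rep Q) (t : H ⊗[ℂ] H) : (uincl Q).rTensor V.V ∘ₗ
    act (unitObj Q).ρ.toLinearMap V.ρ.toLinearMap t =
      act (unitAct Q) V.ρ.toLinearMap t ∘ₗ (uincl Q).rTensor V.V :=
  map_comp_act (φ := (unitObj Q).ρ.toLinearMap) (ψ := V.ρ.toLinearMap)
    (uincl Q) LinearMap.id (uincl_ρ Q) (fun _ => rfl) _

lemma lTensor_uincl_act (V : Rep Q) (t : H ⊗[ℂ] H) : (uincl Q).lTensor V.V ∘ₗ
    act V.ρ.toLinearMap (unitObj Q).ρ.toLinearMap t =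
      act V.ρ.toLinearMap (unitAct Q) t ∘ₗ (uincl Q).lTensor V.V :=
  map_comp_act (φ := V.ρ.toLinearMap) (ψ := (unitObj Q).ρ.toLinearMap)
    LinearMap.id (uincl Q) (fun _ => rfl) (uincl_ρ Q) _

lemma lincl_inj (V : Rep Q) : Function.Injective (lincl V) := by
  have h : Function.LeftInverse ((uproj Q).rTensor V.V) ((uincl Q).rTensor V.V) := fun x => by
    rw [← LinearMap.comp_apply, ← LinearMap.rTensor_comp, uproj_uincl, LinearMap.rTensor_id]; rfl
  exact h.injective.comp (incl_inj _ _)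

lemma rincl_inj (V : Rep Q) : Function.Injective (rincl V) := by
  have h : Function.LeftInverse ((uproj Q).lTensor V.V) ((uincl Q).lTensor V.V) := fun x => by
    rw [← LinearMap.comp_apply, ← LinearMap.lTensor_comp, uproj_uincl, LinearMap.lTensor_id]; rfl
  exact h.injective.comp (incl_inj _ _)

lemma lincl_ρ (V : Rep Q) (h : H) (y : (tens (unitObj Q) V).V) :
    lincl V ((tens (unitObj Q) V).ρ h y) =
      act (unitAct Q) V.ρ.toLinearMap (Q.comul h) (lincl V y) := by
  rw [lincl, LinearMap.comp_apply, ← LinearMap.comp_apply (incl _ _), incl_comp_ρ,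
    LinearMap.comp_apply, actΔ_apply, ← LinearMap.comp_apply, rTensor_uincl_act]
  rfl

lemma rincl_ρ (V : Rep Q) (h : H) (y : (tens V (unitObj Q)).V) :
    rincl V ((tens V (unitObj Q)).ρ h y) =
      act V.ρ.toLinearMap (unitAct Q) (Q.comul h) (rincl V y) := by
  rw [rincl, LinearMap.comp_apply, ← LinearMap.comp_apply (incl _ _), incl_comp_ρ,
    LinearMap.comp_apply, actΔ_apply, ← LinearMap.comp_apply, lTensor_uincl_act]
  rfl

lemma lincl_proj (V : Rep Q) (y : (unitObj Q).V ⊗[ℂ] V.V) :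
    lincl V (proj _ _ y) =
      act (unitAct Q) V.ρ.toLinearMap (Q.comul 1) ((uincl Q).rTensor V.V y) := by
  rw [lincl, LinearMap.comp_apply, ← LinearMap.comp_apply (incl _ _), incl_comp_proj,
    actΔ_apply, ← LinearMap.comp_apply, rTensor_uincl_act]
  rfl

lemma rincl_proj (V : Rep Q) (y : V.V ⊗[ℂ] (unitObj Q).V) :
    rincl V (proj _ _ y) =
      act V.ρ.toLinearMap (unitAct Q) (Q.comul 1) ((uincl Q).lTensor V.V y) := by
  rw [rincl, LinearMap.comp_apply, ← LinearMap.comp_apply (incl _ _), incl_comp_proj,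
    actΔ_apply, ← LinearMap.comp_apply, lTensor_uincl_act]
  rfl

/-- The left unit isomorphism `z ⊗ v ↦ z v`. -/
def leftIso (V : Rep Q) : tens (unitObj Q) V ≅ V :=
  isoOfInverse ⟨lact V ∘ₗ lincl V, fun h => by
      refine LinearMap.ext fun y => ?_
      simp only [LinearMap.comp_apply, lincl_ρ]
      simp only [lincl, LinearMap.comp_apply]
      generalize incl (unitObj Q) V y = w
      induction w with
      | zero => simp
      | add s t hs ht => simp only [map_add, hs, ht]
      | tmul z v =>
        rw [LinearMap.rTensor_tmul, lact_act V h _ (εt_uincl Q z), lact_tmul, map_mul]; rfl⟩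
    (proj (unitObj Q) V ∘ₗ TensorProduct.mk ℂ _ _ (uproj Q 1))
    (by
      refine LinearMap.ext fun y => lincl_inj V ?_
      have h1 : lincl V y = act (unitAct Q) V.ρ.toLinearMap (Q.comul 1) (lincl V y) := by
        rw [← lincl_ρ, map_one]; rfl
      rw [LinearMap.id_apply, h1]
      simp only [LinearMap.comp_apply, lincl_proj, TensorProduct.mk_apply, LinearMap.rTensor_tmul,
        uincl_uproj, εt_one]
      simp only [lincl, LinearMap.comp_apply]
      generalize incl (unitObj Q) V y = w
      induction w with
      | zero => simp
      | add s t hs ht => simp only [map_add, TensorProduct.tmul_add, hs, ht]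
      | tmul z v =>
        rw [LinearMap.rTensor_tmul, lact_tmul, act_one_lact V _ (εt_uincl Q z)])
    (by
      refine LinearMap.ext fun v => ?_
      simp only [LinearMap.comp_apply, lincl_proj, TensorProduct.mk_apply, LinearMap.rTensor_tmul,
        uincl_uproj, εt_one, lact_act V 1 1 Q.εt_one]
      simp)

/-- The right unit isomorphism `v ⊗ z ↦ S⁻¹(z) v`. -/
def rightIso (V : Rep Q) : tens V (unitObj Q) ≅ V :=
  isoOfInverse ⟨ract V ∘ₗ rincl V, fun h => by
      refine LinearMap.ext fun y => ?_
      simp only [LinearMap.comp_apply, rincl_ρ]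
      simp only [rincl, LinearMap.comp_apply]
      generalize incl V (unitObj Q) y = w
      induction w with
      | zero => simp
      | add s t hs ht => simp only [map_add, hs, ht]
      | tmul v z =>
        rw [LinearMap.lTensor_tmul, ract_act, ract_tmul, map_mul]; rfl⟩
    (proj V (unitObj Q) ∘ₗ (TensorProduct.mk ℂ _ _).flip (uproj Q 1))
    (by
      refine LinearMap.ext fun y => rincl_inj V ?_
      have h1 : rincl V y = act V.ρ.toLinearMap (unitAct Q) (Q.comul 1) (rincl V y) := by
        rw [← rincl_ρ, map_one]; rfl
      rw [LinearMap.id_apply, h1]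
      simp only [LinearMap.comp_apply, rincl_proj, LinearMap.flip_apply, TensorProduct.mk_apply,
        LinearMap.lTensor_tmul, uincl_uproj, εt_one]
      simp only [rincl, LinearMap.comp_apply]
      generalize incl V (unitObj Q) y = w
      induction w with
      | zero => simp
      | add s t hs ht => simp only [map_add, TensorProduct.add_tmul, hs, ht]
      | tmul v z =>
        rw [LinearMap.lTensor_tmul, ract_tmul, act_one_ract V _ (εt_uincl Q z)])
    (by
      refine LinearMap.ext fun v => ?_
      simp only [LinearMap.comp_apply, rincl_proj, LinearMap.flip_apply, TensorProduct.mk_apply,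
        LinearMap.lTensor_tmul, uincl_uproj, εt_one, ract_act]
      simp [εbar_one])

lemma leftIso_hom (V : Rep Q) : Hom.toLin (leftIso V).hom = lact V ∘ₗ lincl V := rfl

lemma rightIso_hom (V : Rep Q) : Hom.toLin (rightIso V).hom = ract V ∘ₗ rincl V := rfl

instance : MonoidalCategoryStruct (Rep Q) where
  tensorObj := tens
  whiskerLeft U _ _ f := tensMap (𝟙 U) f
  whiskerRight f V := tensMap f (𝟙 V)
  tensorHom := tensMap
  tensorUnit := unitObj Q
  associator := assocIso
  leftUnitor := leftIso
  rightUnitor := rightIso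

lemma tensMap_id (U V : Rep Q) : tensMap (𝟙 U) (𝟙 V) = 𝟙 (tens U V) := by
  ext1
  refine LinearMap.ext fun y => incl_inj _ _ ?_
  rw [incl_tensMap_apply]
  simp

lemma tensMap_comp {U₁ V₁ W₁ U₂ V₂ W₂ : Rep Q} (f₁ : U₁ ⟶ V₁) (f₂ : U₂ ⟶ V₂) (g₁ : V₁ ⟶ W₁)
    (g₂ : V₂ ⟶ W₂) : tensMap f₁ f₂ ≫ tensMap g₁ g₂ = tensMap (f₁ ≫ g₁) (f₂ ≫ g₂) := by
  ext1
  refine LinearMap.ext fun y => incl_inj _ _ ?_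
  rw [incl_tensMap_apply, comp_toLin, LinearMap.comp_apply, incl_tensMap_apply, incl_tensMap_apply,
    comp_toLin, comp_toLin, TensorProduct.map_comp]
  rfl

lemma assoc_naturality {U₁ V₁ W₁ U₂ V₂ W₂ : Rep Q} (f : U₁ ⟶ U₂) (g : V₁ ⟶ V₂) (k : W₁ ⟶ W₂) :
    tensMap (tensMap f g) k ≫ (assocIso U₂ V₂ W₂).hom =
      (assocIso U₁ V₁ W₁).hom ≫ tensMap f (tensMap g k) := by
  ext1
  refine LinearMap.ext fun y => inclR_inj _ _ _ ?_
  rw [comp_toLin, comp_toLin, LinearMap.comp_apply, LinearMap.comp_apply, assocIso_hom_apply,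
    inclL_tensMap, inclR_tensMap, assocIso_hom_apply]
  generalize inclL U₁ V₁ W₁ y = w
  have := TensorProduct.map_map_comp_assoc_eq (Hom.toLin f) (Hom.toLin g) (Hom.toLin k)
  exact (LinearMap.congr_fun this w).symm

lemma left_naturality (f : U ⟶ V) :
    tensMap (𝟙 (unitObj Q)) f ≫ (leftIso V).hom = (leftIso U).hom ≫ f := by
  ext1
  refine LinearMap.ext fun y => ?_
  simp only [comp_toLin, leftIso_hom, LinearMap.comp_apply, lincl, incl_tensMap_apply]
  generalize incl (unitObj Q) U y = w
  induction w with
  | zero => simp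
  | add s t hs ht => simp only [map_add, hs, ht]
  | tmul z v => simp [comm_apply]

lemma right_naturality (f : U ⟶ V) :
    tensMap f (𝟙 (unitObj Q)) ≫ (rightIso V).hom = (rightIso U).hom ≫ f := by
  ext1
  refine LinearMap.ext fun y => ?_
  simp only [comp_toLin, rightIso_hom, LinearMap.comp_apply, rincl, incl_tensMap_apply]
  generalize incl U (unitObj Q) y = w
  induction w with
  | zero => simp
  | add s t hs ht => simp only [map_add, hs, ht]
  | tmul z v => simp [comm_apply]

lemma triangle_aux (U V : Rep Q) : (assocIso U (unitObj Q) V).hom ≫ tensMap (𝟙 U) (leftIso V).hom =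
    tensMap (rightIso U).hom (𝟙 V) := by
  ext1
  refine LinearMap.ext fun y => incl_inj _ _ ?_
  rw [← act_one_incl_apply, ← act_one_incl_apply U V (Hom.toLin (tensMap (rightIso U).hom (𝟙 V)) y)]
  simp only [comp_toLin, LinearMap.comp_apply, incl_tensMap_apply, id_toLin, leftIso_hom,
    rightIso_hom]
  have e1 : TensorProduct.map LinearMap.id (lact V ∘ₗ lincl V) =
      (lact V ∘ₗ (uincl Q).rTensor V.V).lTensor U.V ∘ₗ (incl (unitObj Q) V).lTensor U.V := by
    rw [← LinearMap.lTensor_comp]; rfl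
  have e2 : TensorProduct.map (ract U ∘ₗ rincl U) LinearMap.id =
      (ract U ∘ₗ (uincl Q).lTensor U.V).rTensor V.V ∘ₗ (incl U (unitObj Q)).rTensor V.V := by
    rw [← LinearMap.rTensor_comp]; rfl
  have e3 := assocIso_hom_apply U (unitObj Q) V y
  rw [e1, e2]
  simp only [inclR, inclL, LinearMap.comp_apply] at e3 ⊢
  rw [e3]
  generalize (LinearMap.rTensor V.V (incl U (unitObj Q))) ((incl (tens U (unitObj Q)) V) y) = w
  induction w with
  | zero => simp
  | add s t hs ht => simp only [map_add, hs, ht]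
  | tmul w v =>
    induction w with
    | zero => simp
    | add s t hs ht => simp only [map_add, TensorProduct.add_tmul, hs, ht]
    | tmul u z => simp [act_one_middle U V _ (εt_uincl Q z)]

lemma pentagon_aux (W X Y Z : Rep Q) :
    tensMap (assocIso W X Y).hom (𝟙 Z) ≫ (assocIso W (tens X Y) Z).hom ≫
      tensMap (𝟙 W) (assocIso X Y Z).hom =
    (assocIso (tens W X) Y Z).hom ≫ (assocIso W X (tens Y Z)).hom := by
  ext1
  refine LinearMap.ext fun y => ?_
  have hinj : Function.Injective ((inclR X Y Z).lTensor W.V ∘ₗ incl W (tens X (tens Y Z))) := by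
    have h : Function.LeftInverse ((projR X Y Z).lTensor W.V) ((inclR X Y Z).lTensor W.V) :=
      fun x => by
        rw [← LinearMap.comp_apply, ← LinearMap.lTensor_comp, projR_inclR, LinearMap.lTensor_id]
        rfl
    exact h.injective.comp (incl_inj _ _)
  apply hinj
  simp only [comp_toLin, LinearMap.comp_apply, incl_tensMap_apply, id_toLin]
  have a1 : ∀ w, (inclR X Y Z).lTensor W.V
      (TensorProduct.map LinearMap.id (Hom.toLin (assocIso X Y Z).hom) w) =
      (TensorProduct.assoc ℂ X.V Y.V Z.V).toLinearMap.lTensor W.V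
        (((incl X Y).rTensor Z.V).lTensor W.V ((incl (tens X Y) Z).lTensor W.V w)) := by
    intro w
    simp only [← LinearMap.comp_apply, ← LinearMap.lTensor_comp]
    rw [LinearMap.lTensor, LinearMap.lTensor, ← TensorProduct.map_comp]
    exact congrArg (fun k => TensorProduct.map LinearMap.id k w) (inclR_assocLin X Y Z)
  rw [a1]
  have a2 : ∀ v, (incl (tens X Y) Z).lTensor W.V (incl W (tens (tens X Y) Z) v) =
      inclR W (tens X Y) Z v := fun _ => rfl
  have a3 : ∀ v, (inclR X Y Z).lTensor W.V (incl W (tens X (tens Y Z)) v) =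
      ((incl Y Z).lTensor X.V).lTensor W.V (inclR W X (tens Y Z) v) := by
    intro v
    rw [inclR, LinearMap.lTensor_comp]; rfl
  rw [a2, a3, assocIso_hom_apply, assocIso_hom_apply]
  have a4 : ∀ v, inclL W (tens X Y) Z v =
      (incl W (tens X Y)).rTensor Z.V (incl (tens W (tens X Y)) Z v) := fun _ => rfl
  have a5 : ∀ c, ((incl Y Z).lTensor X.V).lTensor W.V (TensorProduct.assoc ℂ W.V X.V (tens Y Z).V
      ((incl W X).rTensor (tens Y Z).V c)) = TensorProduct.assoc ℂ W.V X.V (Y.V ⊗[ℂ] Z.V)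
        ((incl W X).rTensor _ ((incl Y Z).lTensor _ c)) := by
    intro c
    induction c with
    | zero => simp
    | add s t hs ht => simp only [map_add, hs, ht]
    | tmul x b =>
      simp only [LinearMap.rTensor_tmul, LinearMap.lTensor_tmul]
      generalize incl W X x = d
      induction d with
      | zero => simp
      | add s t hs ht => simp only [map_add, TensorProduct.add_tmul, hs, ht]
      | tmul p q => simp
  have a6 : ∀ v, inclL W X (tens Y Z) v =
      (incl W X).rTensor (tens Y Z).V (incl (tens W X) (tens Y Z) v) := fun _ => rfl
  have a7 : ∀ v, (incl Y Z).lTensor (tens W X).V (incl (tens W X) (tens Y Z) v) =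
      inclR (tens W X) Y Z v := fun _ => rfl
  have a8 : inclL (tens W X) Y Z y =
      (incl (tens W X) Y).rTensor Z.V (incl (tens (tens W X) Y) Z y) := rfl
  rw [a4, incl_tensMap_apply, a6, a5, a7, assocIso_hom_apply, a8]
  generalize incl (tens (tens W X) Y) Z y = u
  have b1 : ∀ (b : W.V ⊗[ℂ] (tens X Y).V) (z : Z.V), ((incl X Y).rTensor Z.V).lTensor W.V
      (TensorProduct.assoc ℂ W.V (tens X Y).V Z.V (b ⊗ₜ z)) =
      TensorProduct.assoc ℂ W.V (X.V ⊗[ℂ] Y.V) Z.V ((incl X Y).lTensor W.V b ⊗ₜ z) := by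
    intro b z
    induction b with
    | zero => simp
    | add s t hs ht => simp only [map_add, TensorProduct.add_tmul, hs, ht]
    | tmul p q => simp
  have b2 : ∀ a, (incl X Y).lTensor W.V (incl W (tens X Y) (Hom.toLin (assocIso W X Y).hom a)) =
      TensorProduct.assoc ℂ W.V X.V Y.V (inclL W X Y a) := assocIso_hom_apply W X Y
  have b3 : ∀ (b : (tens W X).V ⊗[ℂ] Y.V) (z : Z.V), (incl W X).rTensor (Y.V ⊗[ℂ] Z.V)
      (TensorProduct.assoc ℂ (tens W X).V Y.V Z.V (b ⊗ₜ z)) =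
      TensorProduct.assoc ℂ (W.V ⊗[ℂ] X.V) Y.V Z.V ((incl W X).rTensor Y.V b ⊗ₜ z) := by
    intro b z
    induction b with
    | zero => simp
    | add s t hs ht => simp only [map_add, TensorProduct.add_tmul, hs, ht]
    | tmul p q => simp
  have b4 : ∀ a, (incl W X).rTensor Y.V (incl (tens W X) Y a) = inclL W X Y a := fun _ => rfl
  induction u with
  | zero => simp
  | add s t hs ht => simp only [map_add, hs, ht]
  | tmul a z =>
    simp only [TensorProduct.map_tmul, LinearMap.id_apply, LinearMap.rTensor_tmul]
    rw [b1, b2, b3, b4]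
    generalize inclL W X Y a = d
    induction d with
    | zero => simp
    | add s t hs ht => simp only [map_add, TensorProduct.add_tmul, hs, ht]
    | tmul d y =>
      induction d with
      | zero => simp
      | add s t hs ht => simp only [map_add, TensorProduct.add_tmul, hs, ht]
      | tmul w x => simp

instance : MonoidalCategory (Rep Q) :=
  MonoidalCategory.ofTensorHom
    (id_tensorHom_id := tensMap_id)
    (id_tensorHom := fun _ _ _ _ => rfl)
    (tensorHom_id := fun _ _ => rfl)
    (tensorHom_comp_tensorHom := tensMap_comp)
    (associator_naturality := assoc_naturality)
    (leftUnitor_naturality := left_naturality)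
    (rightUnitor_naturality := right_naturality)
    (pentagon := pentagon_aux)
    (triangle := triangle_aux)

end Rep
end QuantumGroupoid


attribute [local instance] Abelian.hasFiniteBiproducts in
/-- A fusion category over `ℂ`. -/
class FusionCategory (C : Type u) [Category.{v} C] [Abelian C] [Linear ℂ C] [MonoidalCategory C]
    [MonoidalPreadditive C] [MonoidalLinear ℂ C] [RigidCategory C] : Prop where
  finite_hom : ∀ X Y : C, Module.Finite ℂ (X ⟶ Y)
  simple_unit : Simple (𝟙_ C)
  semisimple : ∀ X : C, ∃ (n : ℕ) (S : Fin n → C), (∀ k, Simple (S k)) ∧ Nonempty (X ≅ ⨁ S)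
  finite_simple : ∃ (n : ℕ) (S : Fin n → C), ∀ X : C, Simple X → ∃ k, Nonempty (X ≅ S k)

/-- A unitary fusion category: a fusion category over `ℂ` with a conjugation `f ↦ f̄` on morphisms,
here written `dagger f`. -/
class UnitaryFusionCategory (C : Type u) [Category.{v} C] [Abelian C] [Linear ℂ C]
    [MonoidalCategory C] [MonoidalPreadditive C] [MonoidalLinear ℂ C] [RigidCategory C]
    extends FusionCategory C where
  dagger : ∀ {U V : C}, (U ⟶ V) → (V ⟶ U)
  dagger_add : ∀ {U V : C} (f g : U ⟶ V), dagger (f + g) = dagger f + dagger g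
  dagger_smul : ∀ {U V : C} (c : ℂ) (f : U ⟶ V), dagger (c • f) = star c • dagger f
  dagger_comp : ∀ {U V W : C} (f : U ⟶ V) (g : V ⟶ W), dagger (f ≫ g) = dagger g ≫ dagger f
  dagger_tensor : ∀ {U V U' V' : C} (f : U ⟶ V) (g : U' ⟶ V'),
    dagger (f ⊗ₘ g) = dagger f ⊗ₘ dagger g
  dagger_dagger : ∀ {U V : C} (f : U ⟶ V), dagger (dagger f) = f
  comp_dagger_eq_zero : ∀ {U V : C} (f : U ⟶ V), f ≫ dagger f = 0 ↔ f = 0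

section QuantumDimension

variable {C : Type u} [Category.{v} C] [Abelian C] [Linear ℂ C] [MonoidalCategory C]
  [MonoidalPreadditive C] [MonoidalLinear ℂ C] [RigidCategory C] [UnitaryFusionCategory C]

attribute [local instance] FusionCategory.finite_hom FusionCategory.simple_unit

/-- The complex number `c` with `f = c • 𝟙`, for an endomorphism `f` of the unit object. -/
def unitScalar (f : 𝟙_ C ⟶ 𝟙_ C) : ℂ := (endomorphism_simple_eq_smul_id ℂ f).choose

lemma unitScalar_smul (f : 𝟙_ C ⟶ 𝟙_ C) : unitScalar f • 𝟙 (𝟙_ C) = f :=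
  (endomorphism_simple_eq_smul_id ℂ f).choose_spec

/-- The quantum dimension of `X`, when `X` is simple. With `η : 1 → X ⊗ Xᘁ` and
`ε : Xᘁ ⊗ X → 1` the duality morphisms, it is `√(|η̄ ∘ η| |ε ∘ ε̄|)`; this does not depend on the
choice of the dual and of the duality morphisms, and it is the value of the loop `X` when these are
normalized so that `η̄ ∘ η = ε ∘ ε̄`. -/
def qdim (X : C) : ℝ :=
  √(‖unitScalar (η_ X Xᘁ ≫ UnitaryFusionCategory.dagger (η_ X Xᘁ))‖ *
    ‖unitScalar (UnitaryFusionCategory.dagger (ε_ X Xᘁ) ≫ ε_ X Xᘁ)‖)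

lemma dagger_zero {U V : C} : UnitaryFusionCategory.dagger (0 : U ⟶ V) = 0 := by
  have := UnitaryFusionCategory.dagger_add (0 : U ⟶ V) 0
  simpa using this

lemma qdim_pos (X : C) [Simple X] : 0 < qdim X := by
  have hX : 𝟙 X ≠ 0 := id_nonzero X
  have hη : η_ X Xᘁ ≠ 0 := by
    intro h
    apply hX
    have := ExactPairing.evaluation_coevaluation X Xᘁ
    rw [h] at this
    have h2 := congrArg (fun k => (λ_ X).inv ≫ k ≫ (ρ_ X).hom) this
    simpa using h2.symm
  have hε : ε_ X Xᘁ ≠ 0 := by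
    intro h
    apply hX
    have := ExactPairing.evaluation_coevaluation X Xᘁ
    rw [h] at this
    have h2 := congrArg (fun k => (λ_ X).inv ≫ k ≫ (ρ_ X).hom) this
    simpa using h2.symm
  have key : ∀ f : 𝟙_ C ⟶ 𝟙_ C, f ≠ 0 → 0 < ‖unitScalar f‖ := by
    intro f hf
    rw [norm_pos_iff]
    intro h0
    apply hf
    rw [← unitScalar_smul f, h0, zero_smul]
  have h1 : η_ X Xᘁ ≫ UnitaryFusionCategory.dagger (η_ X Xᘁ) ≠ 0 := fun h =>
    hη ((UnitaryFusionCategory.comp_dagger_eq_zero _).1 h)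
  have h2 : UnitaryFusionCategory.dagger (ε_ X Xᘁ) ≫ ε_ X Xᘁ ≠ 0 := fun h => by
    have h3 := UnitaryFusionCategory.comp_dagger_eq_zero (UnitaryFusionCategory.dagger (ε_ X Xᘁ))
    rw [UnitaryFusionCategory.dagger_dagger] at h3
    have h4 := congrArg UnitaryFusionCategory.dagger (h3.1 h)
    rw [UnitaryFusionCategory.dagger_dagger, dagger_zero] at h4
    exact hε h4
  exact Real.sqrt_pos.2 (mul_pos (key _ h1) (key _ h2))

end QuantumDimension

/-- Representatives of the simple objects of a fusion category, bases of the spaces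
`Hom(a ⊗ b, c)`, and the `F`-matrices with respect to them. -/
structure FusionBasis (C : Type u) [Category.{v} C] [Abelian C] [Linear ℂ C] [MonoidalCategory C]
    (ι : Type w) [Fintype ι] where
  X : ι → C
  simple : ∀ i, Simple (X i)
  eq_of_iso : ∀ i j, Nonempty (X i ≅ X j) → i = j
  exists_iso : ∀ Y : C, Simple Y → ∃ i, Nonempty (Y ≅ X i)
  /-- the label of the unit object -/
  one : ι
  oneIso : X one ≅ 𝟙_ C
  /-- the basis of `Hom(a ⊗ b, c)`, indexed by `1, …, N_{ab}^c` -/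
  vertex : ∀ a b c, Module.Basis (Fin (Module.finrank ℂ (X a ⊗ X b ⟶ X c))) ℂ (X a ⊗ X b ⟶ X c)
  /-- the basis vector of the one-dimensional space `Hom(a ⊗ 1, a)` is the unit constraint -/
  vertex_one : ∀ a α, vertex a one a α = (X a ◁ oneIso.hom) ≫ (ρ_ (X a)).hom
  /-- the entry `F^{abc}_{d;nm}`, with `n ∈ b ⊗ c` and `m ∈ a ⊗ b`, together with the labels of the
  basis vectors at the vertices -/
  F : ∀ a b c d, Matrix
    ((n : ι) × Fin (Module.finrank ℂ (X b ⊗ X c ⟶ X n)) × Fin (Module.finrank ℂ (X a ⊗ X n ⟶ X d)))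
    ((m : ι) × Fin (Module.finrank ℂ (X a ⊗ X b ⟶ X m)) × Fin (Module.finrank ℂ (X m ⊗ X c ⟶ X d)))
    ℂ
  /-- `F^{abc}_d` is the matrix of the associativity isomorphism
  `Hom((a ⊗ b) ⊗ c, d) → Hom(a ⊗ (b ⊗ c), d)` in the bases of trees -/
  F_spec : ∀ a b c d t, (α_ (X a) (X b) (X c)).inv ≫ (vertex a b t.1 t.2.1 ▷ X c) ≫
    vertex t.1 c d t.2.2 = ∑ s, F a b c d s t • ((X a ◁ vertex b c s.1 s.2.1) ≫
      vertex a s.1 d s.2.2)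

namespace FusionBasis

section

variable {C : Type u} [Category.{v} C] [Abelian C] [Linear ℂ C] [MonoidalCategory C]
  {ι : Type w} [Fintype ι] (B : FusionBasis C ι)

/-- The fusion coefficient `N_{ab}^c`. -/
abbrev N (a b c : ι) : ℕ := Module.finrank ℂ (B.X a ⊗ B.X b ⟶ B.X c)

/-- All `F`-matrices are unitary. -/
def IsUnitary [DecidableEq ι] : Prop := ∀ a b c d,
  B.F a b c d * (B.F a b c d).conjTranspose = 1 ∧ (B.F a b c d).conjTranspose * B.F a b c d = 1

/-- All `F`-matrices are real. -/
def IsReal : Prop := ∀ a b c d s t, (B.F a b c d s t).im = 0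

/-- The labels `(a, b, α)` of the basis vectors `v^{ab}_i` of `V_i`, where `α` labels the basis of
`Hom(a ⊗ i, b)`. -/
abbrev Idx (i : ι) : Type w := (a : ι) × (b : ι) × Fin (B.N a i b)

/-- The vector space underlying `H_𝒞`, with basis `e^{ab}_{i;cd}`: an element is given by its
coordinates, arranged for each `i` in a matrix with rows `(a, b, α)` and columns `(c, d, β)`. -/
def H : Type w := (i : ι) → Matrix (B.Idx i) (B.Idx i) ℂ

instance : AddCommGroup B.H := inferInstanceAs (AddCommGroup ((i : ι) → Matrix _ _ ℂ))
instance : Module ℂ B.H := inferInstanceAs (Module ℂ ((i : ι) → Matrix _ _ ℂ))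

/-- The basis vector `e^{ab}_{i;cd}`, with `x = (a, b, α)` and `y = (c, d, β)`. -/
def e [DecidableEq ι] (i : ι) (x y : B.Idx i) : B.H := Pi.single i (Matrix.single x y 1)

end

variable {C : Type u} [Category.{v} C] [Abelian C] [Linear ℂ C] [MonoidalCategory C]
  [MonoidalPreadditive C] [MonoidalLinear ℂ C] [RigidCategory C] [UnitaryFusionCategory C]
  {ι : Type w} [Fintype ι] [DecidableEq ι] (B : FusionBasis C ι)

/-- `√d_i` -/
def rtd (i : ι) : ℝ := √(qdim (B.X i))

lemma rtd_pos (i : ι) : 0 < B.rtd i :=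
  haveI := B.simple i
  Real.sqrt_pos.2 (qdim_pos (B.X i))

lemma rtd_ne (i : ι) : (B.rtd i : ℂ) ≠ 0 := by exact_mod_cast (B.rtd_pos i).ne'

/-- Multiplication: `e^{ab}_{i;cd} e^{cd}_{i;a'b'} = e^{ab}_{i;a'b'} / √d_i`, the other products of
basis vectors being zero. -/
instance : Mul B.H := ⟨fun x y i => ((B.rtd i : ℂ))⁻¹ • (x i * y i)⟩

/-- Unit: `η = ∑ √d_i e^{ab}_{i;ab}`. -/
instance : One B.H := ⟨fun i => (B.rtd i : ℂ) • 1⟩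

variable {B} in
lemma mul_apply (x y : B.H) (i : ι) : (x * y) i = ((B.rtd i : ℂ))⁻¹ • (x i * y i) := rfl

lemma one_apply (i : ι) : (1 : B.H) i = (B.rtd i : ℂ) • 1 := rfl

variable {B} in
lemma add_apply (x y : B.H) (i : ι) : (x + y) i = x i + y i := rfl

variable {B} in
lemma smul_apply (c : ℂ) (x : B.H) (i : ι) : (c • x) i = c • x i := rfl

instance : Ring B.H :=
  { (inferInstance : AddCommGroup B.H), (inferInstance : Mul B.H), (inferInstance : One B.H) with
    left_distrib := fun a b c => by
      funext i; simp only [mul_apply, add_apply, mul_add, smul_add]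
    right_distrib := fun a b c => by
      funext i; simp only [mul_apply, add_apply, add_mul, smul_add]
    zero_mul := fun a => by
      funext i; rw [mul_apply]; change _ • ((0 : Matrix _ _ ℂ) * _) = 0; simp
    mul_zero := fun a => by
      funext i; rw [mul_apply]; change _ • (_ * (0 : Matrix _ _ ℂ)) = 0; simp
    mul_assoc := fun a b c => by
      funext i; simp only [mul_apply, Matrix.smul_mul, Matrix.mul_smul, Matrix.mul_assoc]
    one_mul := fun a => by
      funext i
      rw [mul_apply, one_apply, Matrix.smul_mul, smul_smul, inv_mul_cancel₀ (B.rtd_ne i), one_smul,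
        Matrix.one_mul]
    mul_one := fun a => by
      funext i
      rw [mul_apply, one_apply, Matrix.mul_smul, smul_smul, inv_mul_cancel₀ (B.rtd_ne i), one_smul,
        Matrix.mul_one] }

instance : Algebra ℂ B.H := Algebra.ofModule
  (fun c x y => by
    funext i; simp only [mul_apply, smul_apply, Matrix.smul_mul]; rw [smul_comm])
  (fun c x y => by
    funext i; simp only [mul_apply, smul_apply, Matrix.mul_smul]; rw [smul_comm])

/-- Star: the antilinear map with `(e^{ab}_{i;cd})^* = e^{cd}_{i;ab}`. -/
instance : StarRing B.H where
  star x := fun i => (x i).conjTranspose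
  star_involutive x := by funext i; exact Matrix.conjTranspose_conjTranspose _
  star_mul x y := by
    funext i
    change ((B.rtd i : ℂ)⁻¹ • (x i * y i)).conjTranspose =
      (B.rtd i : ℂ)⁻¹ • ((y i).conjTranspose * (x i).conjTranspose)
    rw [Matrix.conjTranspose_smul, Matrix.conjTranspose_mul]
    simp
  star_add x y := by funext i; exact Matrix.conjTranspose_add _ _

instance : StarModule ℂ B.H := ⟨fun c x => by
  funext i; exact Matrix.conjTranspose_smul c (x i)⟩

/-- `Δ(e^{ab}_{i;cd}) = ∑ √(d_j d_k / d_i) F^{ajk}_{b;ip} \overline{F^{cjk}_{d;iq}}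
e^{ap}_{j;cq} ⊗ e^{pb}_{k;qd}`, the sum running over `j`, `k`, `p`, `q` and the labels of the basis
vectors of `Hom(j ⊗ k, i)`, `Hom(a ⊗ j, p)`, `Hom(p ⊗ k, b)`, `Hom(c ⊗ j, q)`, `Hom(q ⊗ k, d)`. -/
def comulBasis (i : ι) : B.Idx i → B.Idx i → B.H ⊗[ℂ] B.H
  | ⟨a, b, α⟩, ⟨c, d, β⟩ =>
    ∑ j, ∑ k, ∑ μ : Fin (B.N j k i),
      ∑ s : (p : ι) × Fin (B.N a j p) × Fin (B.N p k b),
      ∑ t : (q : ι) × Fin (B.N c j q) × Fin (B.N q k d),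
        (((B.rtd j * B.rtd k / B.rtd i : ℝ) : ℂ) *
          B.F a j k b ⟨i, μ, α⟩ s * star (B.F c j k d ⟨i, μ, β⟩ t)) •
          (B.e j ⟨a, s.1, s.2.1⟩ ⟨c, t.1, t.2.1⟩ ⊗ₜ[ℂ] B.e k ⟨s.1, b, s.2.2⟩ ⟨t.1, d, t.2.2⟩)

/-- The comultiplication of `H_𝒞`. -/
def comul : B.H →ₗ[ℂ] B.H ⊗[ℂ] B.H where
  toFun h := ∑ i, ∑ x, ∑ y, h i x y • B.comulBasis i x y
  map_add' g h := by
    simp only [add_apply, Matrix.add_apply, add_smul, Finset.sum_add_distrib]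
  map_smul' c h := by
    simp only [smul_apply, Matrix.smul_apply, smul_assoc, Finset.smul_sum, RingHom.id_apply]

/-- The counit of `H_𝒞`: `ε(e^{ab}_{i;cd}) = δ_{a,b} δ_{c,d} δ_{i,1}`. -/
def counit : B.H →ₗ[ℂ] ℂ where
  toFun h := ∑ i, ∑ x : B.Idx i, ∑ y : B.Idx i,
    if i = B.one ∧ x.1 = x.2.1 ∧ y.1 = y.2.1 then h i x y else 0
  map_add' g h := by
    simp only [← Finset.sum_add_distrib, add_apply, Matrix.add_apply]
    refine Finset.sum_congr rfl fun i _ => Finset.sum_congr rfl fun x _ =>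
      Finset.sum_congr rfl fun y _ => ?_
    split_ifs <;> simp
  map_smul' c h := by
    simp only [smul_apply, Matrix.smul_apply, Finset.smul_sum, RingHom.id_apply, smul_ite,
      smul_zero]

/-- The representation `V_i` of `H_𝒞`, with basis `v^{ab}_i` and
`e^{ab}_{j;cd} v^{pq}_i = δ_{i,j} δ_{c,p} δ_{d,q} v^{ab}_i / √d_i`. -/
def simpleRep (Q : QuantumGroupoid B.H) (i : ι) : Q.Rep where
  V := B.Idx i → ℂ
  ρ := AlgHom.ofLinearMap
    { toFun := fun h => (B.rtd i : ℂ)⁻¹ • Matrix.toLin' (h i)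
      map_add' := fun g h => by rw [add_apply, map_add, smul_add]
      map_smul' := fun c h => by rw [smul_apply, map_smul, RingHom.id_apply, smul_comm] }
    (by
      change (B.rtd i : ℂ)⁻¹ • Matrix.toLin' ((1 : B.H) i) = 1
      rw [one_apply, map_smul, smul_smul, inv_mul_cancel₀ (B.rtd_ne i), one_smul,
        Matrix.toLin'_one]
      rfl)
    (fun g h => by
      change (B.rtd i : ℂ)⁻¹ • Matrix.toLin' ((g * h) i) =
        ((B.rtd i : ℂ)⁻¹ • Matrix.toLin' (g i)) * ((B.rtd i : ℂ)⁻¹ • Matrix.toLin' (h i))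
      rw [mul_apply, map_smul, Matrix.toLin'_mul, smul_mul_smul_comm, smul_smul]
      rfl)

/-- The basis vector `v^{ab}_i` of `V_i`, with `x = (a, b, α)`. -/
def basisVec (Q : QuantumGroupoid B.H) (i : ι) (x : B.Idx i) : (B.simpleRep Q i).V :=
  (Pi.single x 1 : B.Idx i → ℂ)

end FusionBasis

/-- The direct sum of finitely many representations. -/
def QuantumGroupoid.Rep.directSum {H : Type w} [Ring H] [Algebra ℂ H] {Q : QuantumGroupoid H}
    {κ : Type w} [Fintype κ] (W : κ → Q.Rep) : Q.Rep where
  V := (k : κ) → (W k).V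
  ρ := AlgHom.ofLinearMap
    { toFun := fun h => LinearMap.pi fun k => (W k).ρ h ∘ₗ LinearMap.proj k
      map_add' := fun g h => by ext1 v; funext k; simp
      map_smul' := fun c h => by ext1 v; funext k; simp }
    (by ext1 v; funext k; simp)
    (fun g h => by ext1 v; funext k; simp)

end

/-!
The proof is a Tannaka reconstruction. Let `G` be the direct sum of the chosen simple objects. The
functor `W X = Hom(G, G ⊗ X)` is a fibre functor on `C` with values in the bimodules over the
commutative algebra `End(G)`, and `H_𝒞` is its algebra of natural endomorphisms: the duals of the
vertices form a basis of `W(i)` indexed by `T_i`, the element `√d_i e_{i;x,y}` acts as a matrix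
unit on `W(i)`, and semisimplicity extends the action to every `W X` (`rep`, `Wmap_rep`). An
element of `H_𝒞`, or of a tensor power of it, is determined by its action on the fibres at the
simple objects (`rep_ext`, `act2_ext`, `act3_ext`), so every axiom becomes an identity between
maps of fibres.

* The fibre functor has a lax structure `mu : W X ⊗ W Y → W (X ⊗ Y)`, which has a section `nu`
  whose image is the tensor product over `End(G)`: `mu ∘ nu = id`, and `nu ∘ mu` is the projection
  `balance` (`mu_nu`, `nu_mu`). In the bases of the fibres, `nu` has the entries of `F` as
  coefficients (`nu_Wmap_dv`), and, because `F` is unitary, `mu` has their complex conjugates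
  (`cw_Wmap_vertex_mu`). These are the two factors in the definition of `Δ`, so that `Δ(h)` acts
  on `W X ⊗ W Y` as `nu ∘ h ∘ mu` (`act2_comul`). Multiplicativity, coassociativity and the axioms
  for `Δ(η)` then follow from the associativity of `mu`.
* The counit is the matrix coefficient of the unit vector of `W(𝟙)` (`counit_eq`); here the
  quantum dimension of the unit is `1` (`qdim_unit`).
* The antipode is the transpose of the action on `W Xᘁ` for the pairing given by the evaluation
  (`antiRep`). The image of the coevaluation is a canonical element inverse to this pairing
  (`contr_canon`), and this zigzag identity gives the axioms of the antipode.
* The `C*`-norm is the largest of the operator norms on the fibres at the simple objects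
  (`exists_cstar_norm`).

With values in `Rep(H_𝒞)` the fibre functor is strong monoidal (`fibCore`), since the tensor
product of representations is cut out by `Δ(η)`, which acts as `balance`. It is fully faithful by
Schur's lemma (`exists_Wmap`). Matrix units exhibit every representation as a retract of a fibre
(`exists_retract`), and idempotents of `C` split, so the functor is an equivalence
(`fib_isEquivalence`). It sends `i` to `V_i`. Therefore the `V_i` are the simple representations,
the `t_i^{jk,μ}` are the images of the duals of the vertices, and the fusion rules and the
`6j`-symbols are the images of the decomposition of `j ⊗ k` (`sum_vertex_dv`) and of the change of
basis between dual trees (`dualTree_assoc`).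
-/

set_option linter.unusedSectionVars false

noncomputable section

namespace FusionBasis

attribute [local instance] Abelian.hasFiniteBiproducts FusionCategory.finite_hom
  FusionCategory.simple_unit FusionBasis.simple

section

variable {C : Type u} [Category.{v} C] [Abelian C] [Linear ℂ C] [MonoidalCategory C]
  [MonoidalPreadditive C] [MonoidalLinear ℂ C] [RigidCategory C] [UnitaryFusionCategory C]
  {ι : Type w} [Fintype ι] (B : FusionBasis C ι)

/-! ### Simple objects and completeness relations -/

section Schur

variable {B}

lemma hom_eq_zero {i j : ι} (h : i ≠ j) (f : B.X i ⟶ B.X j) : f = 0 := by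
  by_contra hf
  have := isIso_of_hom_simple hf
  exact h (B.eq_of_iso i j ⟨asIso f⟩)

lemma exists_smul_id (i : ι) (f : B.X i ⟶ B.X i) : ∃ c : ℂ, c • 𝟙 (B.X i) = f :=
  endomorphism_simple_eq_smul_id ℂ f

lemma smul_id_injective {X : C} [Simple X] {c d : ℂ} (h : c • 𝟙 X = d • 𝟙 X) :
    c = d := by
  by_contra hcd
  have h1 : (c - d) • 𝟙 X = 0 := by rw [sub_smul, h, sub_self]
  rcases smul_eq_zero.1 h1 with h2 | h2
  · exact hcd (sub_eq_zero.1 h2)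
  · exact id_nonzero X h2

variable (B) in
/-- The complex number `c` with `f = c • 𝟙`, for an endomorphism `f` of a simple object. -/
def scal (i : ι) : (B.X i ⟶ B.X i) →ₗ[ℂ] ℂ where
  toFun f := (exists_smul_id i f).choose
  map_add' f g := smul_id_injective (X := B.X i) (by
    rw [add_smul, (exists_smul_id i f).choose_spec, (exists_smul_id i g).choose_spec,
      (exists_smul_id i (f + g)).choose_spec])
  map_smul' c f := smul_id_injective (X := B.X i) (by
    rw [RingHom.id_apply, smul_eq_mul, mul_smul, (exists_smul_id i f).choose_spec,
      (exists_smul_id i (c • f)).choose_spec])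

lemma scal_smul_id (i : ι) (f : B.X i ⟶ B.X i) : B.scal i f • 𝟙 (B.X i) = f :=
  (exists_smul_id i f).choose_spec

lemma scal_id (i : ι) : B.scal i (𝟙 _) = 1 :=
  smul_id_injective (X := B.X i) (by rw [scal_smul_id, one_smul])

lemma scal_comp {i : ι} {Y : C} (f : B.X i ⟶ B.X i) (g : B.X i ⟶ Y) :
    f ≫ g = B.scal i f • g := by
  conv_lhs => rw [← scal_smul_id i f, Linear.smul_comp, Category.id_comp]

variable (B)

/-- Every identity morphism factors through finitely many of the chosen simple objects. -/
lemma exists_complete (Y : C) : ∃ (n : ℕ) (c : Fin n → ι) (p : ∀ k, Y ⟶ B.X (c k))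
    (j : ∀ k, B.X (c k) ⟶ Y), ∑ k, p k ≫ j k = 𝟙 Y := by
  obtain ⟨n, S, hS, ⟨φ⟩⟩ := FusionCategory.semisimple Y
  choose c hc using fun k => B.exists_iso (S k) (hS k)
  have ψ := fun k => (hc k).some
  refine ⟨n, c, fun k => φ.hom ≫ Limits.biproduct.π S k ≫ (ψ k).hom,
    fun k => (ψ k).inv ≫ Limits.biproduct.ι S k ≫ φ.inv, ?_⟩
  have h1 : ∀ k, (φ.hom ≫ Limits.biproduct.π S k ≫ (ψ k).hom) ≫
      (ψ k).inv ≫ Limits.biproduct.ι S k ≫ φ.inv =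
      φ.hom ≫ (Limits.biproduct.π S k ≫ Limits.biproduct.ι S k) ≫ φ.inv := by
    intro k; simp
  simp_rw [h1]
  rw [← Preadditive.comp_sum, ← Preadditive.sum_comp, Limits.biproduct.total]
  simp

variable {B}

/-- Morphisms are detected by precomposition with morphisms from the simple objects. -/
lemma hom_ext_left {Y Z : C} {f g : Y ⟶ Z} (h : ∀ (c : ι) (j : B.X c ⟶ Y), j ≫ f = j ≫ g) :
    f = g := by
  obtain ⟨n, c, p, j, hpj⟩ := B.exists_complete Y
  rw [← Category.id_comp f, ← Category.id_comp g, ← hpj, Preadditive.sum_comp, Preadditive.sum_comp]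
  exact Finset.sum_congr rfl fun k _ => by rw [Category.assoc, Category.assoc, h]

lemma hom_ext_right {Y Z : C} {f g : Y ⟶ Z} (h : ∀ (c : ι) (p : Z ⟶ B.X c), f ≫ p = g ≫ p) :
    f = g := by
  obtain ⟨n, c, p, j, hpj⟩ := B.exists_complete Z
  rw [← Category.comp_id f, ← Category.comp_id g, ← hpj, Preadditive.comp_sum, Preadditive.comp_sum]
  exact Finset.sum_congr rfl fun k _ => by rw [← Category.assoc, ← Category.assoc, h]

variable (B)

/-- The composition pairing of `Hom(b, Y)` with `Hom(Y, b)`. -/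
def homPairing (Y : C) (b : ι) : (B.X b ⟶ Y) →ₗ[ℂ] Module.Dual ℂ (Y ⟶ B.X b) :=
  LinearMap.mk₂ ℂ (fun g f => B.scal b (g ≫ f))
    (fun g g' f => by rw [Preadditive.add_comp, map_add])
    (fun c g f => by rw [Linear.smul_comp, map_smul])
    (fun g f f' => by rw [Preadditive.comp_add, map_add])
    (fun c g f => by rw [Linear.comp_smul, map_smul])

lemma homPairing_apply {Y : C} {b : ι} (g : B.X b ⟶ Y) (f : Y ⟶ B.X b) :
    B.homPairing Y b g f = B.scal b (g ≫ f) := rfl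

lemma homPairing_injective (Y : C) (b : ι) : Function.Injective (B.homPairing Y b) := by
  rw [injective_iff_map_eq_zero]
  intro g hg
  refine hom_ext_right (B := B) fun c p => ?_
  rw [Limits.zero_comp]
  by_cases h : b = c
  · subst h
    rw [← scal_smul_id b (g ≫ p), ← homPairing_apply, hg, LinearMap.zero_apply, zero_smul]
  · exact hom_eq_zero h _

lemma homPairing_flip_injective (Y : C) (b : ι) :
    Function.Injective (B.homPairing Y b).flip := by
  rw [injective_iff_map_eq_zero]
  intro f hf
  refine hom_ext_left (B := B) fun c g => ?_
  rw [Limits.comp_zero]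
  by_cases h : c = b
  · subst h
    rw [← scal_smul_id c (g ≫ f), ← homPairing_apply, ← LinearMap.flip_apply, hf,
      LinearMap.zero_apply, zero_smul]
  · exact hom_eq_zero h _

/-- The composition pairing is perfect. -/
lemma homPairing_bijective (Y : C) (b : ι) : Function.Bijective (B.homPairing Y b) := by
  refine ⟨B.homPairing_injective Y b, ?_⟩
  have h1 := LinearMap.finrank_le_finrank_of_injective (B.homPairing_injective Y b)
  have h2 := LinearMap.finrank_le_finrank_of_injective (B.homPairing_flip_injective Y b)
  rw [Subspace.dual_finrank_eq] at h1 h2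
  refine (LinearMap.injective_iff_surjective_of_finrank_eq_finrank ?_).1
    (B.homPairing_injective Y b)
  rw [Subspace.dual_finrank_eq]
  exact le_antisymm h1 h2

/-- The dual basis vector in `Hom(c, a ⊗ b)` of a vertex `a ⊗ b → c`. -/
def dv (a b c : ι) (α : Fin (B.N a b c)) : B.X c ⟶ B.X a ⊗ B.X b :=
  (LinearEquiv.ofBijective _ (B.homPairing_bijective (B.X a ⊗ B.X b) c)).symm
    ((B.vertex a b c).coord α)

variable {B}

lemma dv_pairing (a b c : ι) (α : Fin (B.N a b c)) (f : B.X a ⊗ B.X b ⟶ B.X c) :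
    B.scal c (B.dv a b c α ≫ f) = (B.vertex a b c).coord α f := by
  rw [← homPairing_apply]
  exact LinearMap.congr_fun ((LinearEquiv.ofBijective _
    (B.homPairing_bijective (B.X a ⊗ B.X b) c)).apply_symm_apply ((B.vertex a b c).coord α)) f

lemma dv_comp (a b c : ι) (α : Fin (B.N a b c)) (f : B.X a ⊗ B.X b ⟶ B.X c) :
    B.dv a b c α ≫ f = (B.vertex a b c).coord α f • 𝟙 _ := by
  rw [← dv_pairing, scal_smul_id]

lemma dv_vertex (a b c : ι) (α β : Fin (B.N a b c)) :
    B.dv a b c α ≫ B.vertex a b c β = if α = β then 𝟙 _ else 0 := by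
  rw [dv_comp, Module.Basis.coord_apply, Module.Basis.repr_self, Finsupp.single_apply, ite_smul]
  simp [eq_comm]

lemma dv_vertex_self (a b c : ι) (α : Fin (B.N a b c)) :
    B.dv a b c α ≫ B.vertex a b c α = 𝟙 _ := by
  rw [dv_vertex, if_pos rfl]

lemma dv_vertex_of_ne {a b c : ι} {α β : Fin (B.N a b c)} (h : α ≠ β) :
    B.dv a b c α ≫ B.vertex a b c β = 0 := by
  rw [dv_vertex, if_neg h]

lemma sum_vertex_coord {a b c : ι} (f : B.X a ⊗ B.X b ⟶ B.X c) :
    ∑ α, (B.vertex a b c).coord α f • B.vertex a b c α = f := (B.vertex a b c).sum_repr f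

/-- The vertices and their duals decompose `a ⊗ b` into simple objects. -/
lemma sum_vertex_dv (a b : ι) :
    ∑ c, ∑ α, B.vertex a b c α ≫ B.dv a b c α = 𝟙 (B.X a ⊗ B.X b) := by
  refine hom_ext_right (B := B) fun d f => ?_
  rw [Category.id_comp, Preadditive.sum_comp, Finset.sum_eq_single d]
  · rw [Preadditive.sum_comp]
    conv_rhs => rw [← sum_vertex_coord f]
    refine Finset.sum_congr rfl fun α _ => ?_
    rw [Category.assoc, dv_comp, Linear.comp_smul, Category.comp_id]
  · intro c _ hc
    rw [Preadditive.sum_comp]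
    refine Finset.sum_eq_zero fun α _ => ?_
    rw [Category.assoc, hom_eq_zero hc (B.dv a b c α ≫ f), Limits.comp_zero]
  · simp

end Schur

/-! ### The generator and its endomorphisms -/

/-- The direct sum of the simple objects. -/
def G : C := ⨁ B.X

/-- The inclusion of the summand `a` of `G`. -/
def inc (a : ι) : B.X a ⟶ B.G := Limits.biproduct.ι B.X a

/-- The projection of `G` onto the summand `a`. -/
def prj (a : ι) : B.G ⟶ B.X a := Limits.biproduct.π B.X a

variable {B}

@[simp] lemma inc_prj (a : ι) : B.inc a ≫ B.prj a = 𝟙 _ := Limits.biproduct.ι_π_self B.X a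

lemma inc_prj_of_ne {a b : ι} (h : a ≠ b) : B.inc a ≫ B.prj b = 0 :=
  Limits.biproduct.ι_π_ne B.X h

variable (B)

/-- The idempotent of `G` that projects onto the summand `a`. -/
def idem (a : ι) : B.G ⟶ B.G := B.prj a ≫ B.inc a

lemma sum_idem : ∑ a, B.idem a = 𝟙 B.G := by
  refine Limits.biproduct.hom_ext _ _ fun b => ?_
  change _ ≫ B.prj b = _ ≫ B.prj b
  rw [Preadditive.sum_comp, Category.id_comp, Finset.sum_eq_single b]
  · simp [idem]
  · intro a _ h
    rw [idem, Category.assoc, inc_prj_of_ne h, Limits.comp_zero]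
  · simp

variable {B}

@[simp] lemma inc_idem (a : ι) : B.inc a ≫ B.idem a = B.inc a := by
  rw [idem, ← Category.assoc, inc_prj, Category.id_comp]

@[simp] lemma idem_prj (a : ι) : B.idem a ≫ B.prj a = B.prj a := by
  rw [idem, Category.assoc, inc_prj, Category.comp_id]

lemma prj_comp_inc (a b : ι) (f : B.X a ⟶ B.X b) (h : a ≠ b) : B.prj a ≫ f ≫ B.inc b = 0 := by
  rw [hom_eq_zero h f]; simp

variable (B)

/-- The coordinates of an endomorphism of `G`, which is diagonal by Schur's lemma. -/
def coef (a : ι) : (B.G ⟶ B.G) →ₗ[ℂ] ℂ :=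
  B.scal a ∘ₗ Linear.rightComp ℂ _ (B.prj a) ∘ₗ Linear.leftComp ℂ _ (B.inc a)

variable {B}

lemma coef_apply (a : ι) (r : B.G ⟶ B.G) : B.coef a r = B.scal a (B.inc a ≫ r ≫ B.prj a) := by
  simp [coef]

lemma inc_comp (a : ι) (r : B.G ⟶ B.G) : B.inc a ≫ r = B.coef a r • B.inc a := by
  have h0 : ∀ b, B.inc a ≫ r ≫ B.idem b = (B.inc a ≫ r ≫ B.prj b) ≫ B.inc b := by
    intro b; simp [idem]
  calc B.inc a ≫ r = ∑ b, B.inc a ≫ r ≫ B.idem b := by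
        rw [← Preadditive.comp_sum, ← Preadditive.comp_sum, sum_idem, Category.comp_id]
    _ = _ := by
      rw [Finset.sum_eq_single a]
      · rw [h0, scal_comp, coef_apply]
      · intro b _ hb
        rw [h0, hom_eq_zero (Ne.symm hb) (B.inc a ≫ r ≫ B.prj b), Limits.zero_comp]
      · simp

lemma idem_comp (a : ι) (r : B.G ⟶ B.G) : B.idem a ≫ r = B.coef a r • B.idem a := by
  rw [idem, Category.assoc, inc_comp, Linear.comp_smul]

lemma eq_sum_idem (r : B.G ⟶ B.G) : r = ∑ a, B.coef a r • B.idem a := by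
  conv_lhs => rw [← Category.id_comp r, ← sum_idem, Preadditive.sum_comp]
  exact Finset.sum_congr rfl fun a _ => idem_comp a r

lemma idem_idem (a : ι) : B.idem a ≫ B.idem a = B.idem a := by
  nth_rw 1 [idem]
  rw [Category.assoc, inc_idem, idem]

lemma idem_idem_of_ne {a b : ι} (h : a ≠ b) : B.idem a ≫ B.idem b = 0 := by
  rw [idem, idem, Category.assoc, ← Category.assoc (B.inc a), inc_prj_of_ne h]; simp

lemma comp_idem (a : ι) (r : B.G ⟶ B.G) : r ≫ B.idem a = B.coef a r • B.idem a := by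
  conv_lhs => rw [eq_sum_idem r, Preadditive.sum_comp]
  rw [Finset.sum_eq_single a]
  · rw [Linear.smul_comp, idem_idem]
  · intro b _ hb
    rw [Linear.smul_comp, idem_idem_of_ne hb, smul_zero]
  · simp

lemma coef_idem (a : ι) : B.coef a (B.idem a) = 1 := by
  rw [coef_apply, idem_prj, inc_prj, scal_id]

lemma coef_idem_of_ne {a b : ι} (h : a ≠ b) : B.coef a (B.idem b) = 0 := by
  rw [coef_apply, idem, Category.assoc, ← Category.assoc (B.inc a), inc_prj_of_ne h]; simp

lemma coef_id (a : ι) : B.coef a (𝟙 _) = 1 := by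
  rw [coef_apply, Category.id_comp, inc_prj, scal_id]

variable (B) in
/-- The sum of the coordinates of an endomorphism of `G`. -/
def tr : (B.G ⟶ B.G) →ₗ[ℂ] ℂ := ∑ a, B.coef a

lemma tr_apply (r : B.G ⟶ B.G) : B.tr r = ∑ a, B.coef a r := by simp [tr]

lemma tr_idem (a : ι) : B.tr (B.idem a) = 1 := by
  rw [tr_apply, Finset.sum_eq_single a]
  · exact coef_idem a
  · intro b _ hb; exact coef_idem_of_ne hb
  · simp

lemma tr_idem_comp (a : ι) (r : B.G ⟶ B.G) : B.tr (B.idem a ≫ r) = B.coef a r := by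
  rw [idem_comp, map_smul, tr_idem, smul_eq_mul, mul_one]

lemma tr_comp_idem (a : ι) (r : B.G ⟶ B.G) : B.tr (r ≫ B.idem a) = B.coef a r := by
  rw [comp_idem, map_smul, tr_idem, smul_eq_mul, mul_one]

variable (B) in
/-- Every object is a retract of a sum of copies of `G`. -/
lemma exists_complete_G (Y : C) : ∃ (n : ℕ) (p : Fin n → (Y ⟶ B.G)) (j : Fin n → (B.G ⟶ Y)),
    ∑ k, p k ≫ j k = 𝟙 Y := by
  obtain ⟨n, c, p, j, h⟩ := B.exists_complete Y
  refine ⟨n, fun k => p k ≫ B.inc (c k), fun k => B.prj (c k) ≫ j k, ?_⟩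
  rw [← h]
  exact Finset.sum_congr rfl fun k _ => by simp [← Category.assoc (B.inc _)]

/-! ### The fibre functor -/

variable (B) in
/-- The fibre functor `X ↦ Hom(G, G ⊗ X)`, whose endomorphism algebra is `H_𝒞`. -/
abbrev W (X : C) : Type v := B.G ⟶ B.G ⊗ X

variable (B) in
/-- The action of the fibre functor on morphisms: postcomposition with `G ◁ f`. -/
def Wmap {X Y : C} (f : X ⟶ Y) : B.W X →ₗ[ℂ] B.W Y := Linear.rightComp ℂ _ (B.G ◁ f)

lemma Wmap_apply {X Y : C} (f : X ⟶ Y) (x : B.W X) : B.Wmap f x = x ≫ B.G ◁ f := rfl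

lemma Wmap_id (X : C) : B.Wmap (𝟙 X) = LinearMap.id := by ext x; simp [Wmap_apply]

lemma Wmap_comp {X Y Z : C} (f : X ⟶ Y) (g : Y ⟶ Z) :
    B.Wmap (f ≫ g) = B.Wmap g ∘ₗ B.Wmap f := by ext x; simp [Wmap_apply]

lemma Wmap_add {X Y : C} (f g : X ⟶ Y) : B.Wmap (f + g) = B.Wmap f + B.Wmap g := by
  ext x; simp [Wmap_apply]

lemma Wmap_zero {X Y : C} : B.Wmap (0 : X ⟶ Y) = 0 := by
  ext x; simp [Wmap_apply]

lemma Wmap_smul {X Y : C} (c : ℂ) (f : X ⟶ Y) : B.Wmap (c • f) = c • B.Wmap f := by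
  ext x; simp [Wmap_apply]

lemma Wmap_sum {X Y : C} {κ : Type*} (s : Finset κ) (f : κ → (X ⟶ Y)) :
    B.Wmap (∑ k ∈ s, f k) = ∑ k ∈ s, B.Wmap (f k) := by
  ext x; simp [Wmap_apply, whiskerLeft_sum, Preadditive.comp_sum]

variable (B) in
/-- The lax monoidal structure of the fibre functor: `f ⊗ g` is sent to `G ⟶ G ⊗ Y ⟶ (G ⊗ X) ⊗ Y`,
the composite of `g` and `f ▷ Y`, followed by the associator. -/
def mu (X Y : C) : B.W X ⊗[ℂ] B.W Y →ₗ[ℂ] B.W (X ⊗ Y) :=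
  TensorProduct.lift (LinearMap.mk₂ ℂ (fun f g => g ≫ f ▷ Y ≫ (α_ B.G X Y).hom)
    (fun f f' g => by simp)
    (fun c f g => by simp)
    (fun f g g' => by simp)
    (fun c f g => by simp))

@[simp] lemma mu_tmul {X Y : C} (f : B.W X) (g : B.W Y) :
    B.mu X Y (f ⊗ₜ g) = g ≫ f ▷ Y ≫ (α_ B.G X Y).hom := by simp [mu]

variable (B) in
/-- The action of the idempotents of `G` on the source of `Hom(G, G ⊗ X)`. -/
def lE (a : ι) (X : C) : B.W X →ₗ[ℂ] B.W X := Linear.leftComp ℂ _ (B.idem a)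

variable (B) in
/-- The action of the idempotents of `G` on the factor `G` of the target of `Hom(G, G ⊗ X)`. -/
def rE (a : ι) (X : C) : B.W X →ₗ[ℂ] B.W X := Linear.rightComp ℂ _ (B.idem a ▷ X)

@[simp] lemma lE_apply (a : ι) {X : C} (f : B.W X) : B.lE a X f = B.idem a ≫ f := rfl

@[simp] lemma rE_apply (a : ι) {X : C} (f : B.W X) : B.rE a X f = f ≫ B.idem a ▷ X := rfl

lemma sum_lE {X : C} (f : B.W X) : ∑ a, B.idem a ≫ f = f := by
  rw [← Preadditive.sum_comp, sum_idem, Category.id_comp]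

lemma sum_rE {X : C} (f : B.W X) : ∑ a, f ≫ B.idem a ▷ X = f := by
  rw [← Preadditive.comp_sum, ← sum_whiskerRight, sum_idem, id_whiskerRight, Category.comp_id]

variable (B) in
/-- The projection of `W X ⊗ W Y` onto the tensor product over `End(G)`, which is spanned by the
idempotents. It is the action of `Δ(η)` (`act2_comul_one`). -/
def balance (X Y : C) : B.W X ⊗[ℂ] B.W Y →ₗ[ℂ] B.W X ⊗[ℂ] B.W Y :=
  ∑ a, TensorProduct.map (B.lE a X) (B.rE a Y)

lemma balance_tmul {X Y : C} (f : B.W X) (g : B.W Y) :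
    B.balance X Y (f ⊗ₜ g) = ∑ a, (B.idem a ≫ f) ⊗ₜ (g ≫ B.idem a ▷ Y) := by
  simp [balance]

variable (B) in
/-- The section of `mu` whose image is that of `balance`. It is written in terms of a
decomposition of `G ⊗ X` into copies of `G`; since `nu ∘ mu = balance` and `mu` is surjective, it
does not depend on this choice. -/
def nu (X Y : C) : B.W (X ⊗ Y) →ₗ[ℂ] B.W X ⊗[ℂ] B.W Y :=
  let h := B.exists_complete_G (B.G ⊗ X)
  ∑ k, ∑ a, TensorProduct.mk ℂ _ _ (B.idem a ≫ h.choose_spec.choose_spec.choose k) ∘ₗ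
    Linear.rightComp ℂ _ ((α_ B.G X Y).inv ≫ h.choose_spec.choose k ▷ Y ≫ B.idem a ▷ Y)

variable (B) in
/-- The defining formula of `nu`, for the decomposition of `G ⊗ X` chosen in its definition. -/
lemma exists_nu (X : C) : ∃ (n : ℕ) (p : Fin n → (B.G ⊗ X ⟶ B.G)) (j : Fin n → B.W X),
    ∑ k, p k ≫ j k = 𝟙 _ ∧ ∀ (Y : C) (f : B.W (X ⊗ Y)), B.nu X Y f =
      ∑ k, ∑ a, (B.idem a ≫ j k) ⊗ₜ[ℂ] (f ≫ (α_ B.G X Y).inv ≫ p k ▷ Y ≫ B.idem a ▷ Y) := by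
  let h := B.exists_complete_G (B.G ⊗ X)
  refine ⟨h.choose, h.choose_spec.choose, h.choose_spec.choose_spec.choose,
    h.choose_spec.choose_spec.choose_spec, fun Y f => ?_⟩
  simp [nu]

@[simp] lemma mu_nu {X Y : C} (f : B.W (X ⊗ Y)) : B.mu X Y (B.nu X Y f) = f := by
  obtain ⟨n, p, j, hpj, hnu⟩ := B.exists_nu X
  have h : ∀ k, ∑ a, B.mu X Y ((B.idem a ≫ j k) ⊗ₜ[ℂ]
      (f ≫ (α_ B.G X Y).inv ≫ p k ▷ Y ≫ B.idem a ▷ Y)) =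
      f ≫ (α_ B.G X Y).inv ≫ (p k ≫ j k) ▷ Y ≫ (α_ B.G X Y).hom := by
    intro k
    have h2 : ∀ a, B.mu X Y ((B.idem a ≫ j k) ⊗ₜ[ℂ]
        (f ≫ (α_ B.G X Y).inv ≫ p k ▷ Y ≫ B.idem a ▷ Y)) =
        (f ≫ (α_ B.G X Y).inv ≫ p k ▷ Y) ≫ B.idem a ▷ Y ≫ (j k ▷ Y ≫ (α_ B.G X Y).hom) := by
      intro a
      have := congrArg (· ▷ Y) (idem_idem (B := B) a)
      simp only [comp_whiskerRight] at this
      simp only [mu_tmul, comp_whiskerRight, Category.assoc]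
      rw [← Category.assoc (B.idem a ▷ Y) (B.idem a ▷ Y), this]
    simp_rw [h2]
    rw [← Preadditive.comp_sum, ← Preadditive.sum_comp, ← sum_whiskerRight, sum_idem]
    simp
  rw [hnu]
  simp only [map_sum]
  simp_rw [h]
  rw [← Preadditive.comp_sum, ← Preadditive.comp_sum, ← Preadditive.sum_comp, ← sum_whiskerRight,
    hpj]
  simp

/-- The product `mu` is an isomorphism from the balanced tensors to `W (X ⊗ Y)`, with inverse
`nu`. -/
@[simp] lemma nu_mu {X Y : C} (t : B.W X ⊗[ℂ] B.W Y) :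
    B.nu X Y (B.mu X Y t) = B.balance X Y t := by
  induction t with
  | zero => simp
  | add s t hs ht => simp only [map_add, hs, ht]
  | tmul f g =>
    obtain ⟨n, p, j, hpj, hnu⟩ := B.exists_nu X
    have h1 : ∀ k a, B.mu X Y (f ⊗ₜ g) ≫ (α_ B.G X Y).inv ≫ p k ▷ Y ≫ B.idem a ▷ Y =
        B.coef a (f ≫ p k) • (g ≫ B.idem a ▷ Y) := by
      intro k a
      rw [mu_tmul]
      simp only [Category.assoc, Iso.hom_inv_id_assoc]
      rw [← comp_whiskerRight, ← comp_whiskerRight, ← Category.assoc f, comp_idem,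
        MonoidalLinear.smul_whiskerRight, Linear.comp_smul]
    have h2 : ∀ a, ∑ k, B.coef a (f ≫ p k) • (B.idem a ≫ j k) = B.idem a ≫ f := by
      intro a
      conv_rhs => rw [← Category.comp_id f, ← hpj, Preadditive.comp_sum, Preadditive.comp_sum]
      refine Finset.sum_congr rfl fun k _ => ?_
      rw [← Category.assoc f, ← Category.assoc (B.idem a), idem_comp, Linear.smul_comp]
    rw [hnu, Finset.sum_comm, balance_tmul]
    refine Finset.sum_congr rfl fun a _ => ?_
    simp_rw [h1]
    rw [← h2 a, TensorProduct.sum_tmul]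
    exact Finset.sum_congr rfl fun k _ => (TensorProduct.smul_tmul _ _ _).symm

lemma mu_balance {X Y : C} (t : B.W X ⊗[ℂ] B.W Y) :
    B.mu X Y (B.balance X Y t) = B.mu X Y t := by
  rw [← nu_mu, mu_nu]

lemma balance_nu {X Y : C} (f : B.W (X ⊗ Y)) : B.balance X Y (B.nu X Y f) = B.nu X Y f := by
  rw [← nu_mu, mu_nu]

lemma mu_surjective (X Y : C) : Function.Surjective (B.mu X Y) := fun f => ⟨_, mu_nu f⟩

lemma mu_natural {X Y X' Y' : C} (f : X ⟶ X') (g : Y ⟶ Y') (t : B.W X ⊗[ℂ] B.W Y) :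
    B.Wmap (f ⊗ₘ g) (B.mu X Y t) =
      B.mu X' Y' (TensorProduct.map (B.Wmap f) (B.Wmap g) t) := by
  induction t with
  | zero => simp
  | add s t hs ht => simp only [map_add, hs, ht]
  | tmul x y =>
    simp [Wmap_apply, MonoidalCategory.tensorHom_def', whisker_exchange_assoc]

lemma balance_natural {X Y X' Y' : C} (f : X ⟶ X') (g : Y ⟶ Y') (t : B.W X ⊗[ℂ] B.W Y) :
    B.balance X' Y' (TensorProduct.map (B.Wmap f) (B.Wmap g) t) =
      TensorProduct.map (B.Wmap f) (B.Wmap g) (B.balance X Y t) := by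
  induction t with
  | zero => simp
  | add s t hs ht => simp only [map_add, hs, ht]
  | tmul x y => simp [balance_tmul, Wmap_apply, whisker_exchange]

lemma nu_natural {X Y X' Y' : C} (f : X ⟶ X') (g : Y ⟶ Y') (t : B.W (X ⊗ Y)) :
    B.nu X' Y' (B.Wmap (f ⊗ₘ g) t) =
      TensorProduct.map (B.Wmap f) (B.Wmap g) (B.nu X Y t) := by
  obtain ⟨s, rfl⟩ := B.mu_surjective X Y t
  rw [mu_natural, nu_mu, nu_mu, balance_natural]

/-- The associativity of `mu`. -/
lemma mu_assoc {X Y Z : C} (t : (B.W X ⊗[ℂ] B.W Y) ⊗[ℂ] B.W Z) :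
    B.Wmap (α_ X Y Z).hom (B.mu (X ⊗ Y) Z ((B.mu X Y).rTensor _ t)) =
      B.mu X (Y ⊗ Z) ((B.mu Y Z).lTensor _ (TensorProduct.assoc ℂ _ _ _ t)) := by
  induction t with
  | zero => simp
  | add s t hs ht => simp only [map_add, hs, ht]
  | tmul t z =>
    induction t with
    | zero => simp
    | add s t hs ht => simp only [TensorProduct.add_tmul, map_add, hs, ht]
    | tmul x y => simp [Wmap_apply, pentagon]

variable (B) in
/-- The unit vector of the fibre functor, the inverse of `G ⊗ 𝟙 ≅ G`. -/
def unitVec : B.W (𝟙_ C) := (ρ_ B.G).inv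

lemma mu_unit_left {X : C} (x : B.W X) :
    B.mu (𝟙_ C) X (B.unitVec ⊗ₜ x) = B.Wmap (λ_ X).inv x := by
  simp [unitVec, Wmap_apply]

lemma mu_unit_right {X : C} (x : B.W X) :
    B.mu X (𝟙_ C) (x ⊗ₜ B.unitVec) = B.Wmap (ρ_ X).inv x := by
  rw [mu_tmul, unitVec, ← Category.assoc, ← rightUnitor_inv_naturality, Wmap_apply]
  simp

variable (B) in
/-- The functional on `Hom(G, G ⊗ 1) ≅ End(G)` given by the sum of the coordinates. -/
def lam : B.W (𝟙_ C) →ₗ[ℂ] ℂ := B.tr ∘ₗ Linear.rightComp ℂ _ (ρ_ B.G).hom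

lemma lam_apply (f : B.W (𝟙_ C)) : B.lam f = B.tr (f ≫ (ρ_ B.G).hom) := rfl

lemma lam_idem_comp (a : ι) (f : B.W (𝟙_ C)) :
    B.lam (B.idem a ≫ f) = B.coef a (f ≫ (ρ_ B.G).hom) := by
  rw [lam_apply, Category.assoc, tr_idem_comp]

lemma lam_idem_unitVec (a : ι) : B.lam (B.idem a ≫ B.unitVec) = 1 := by
  rw [lam_idem_comp, unitVec, Iso.inv_hom_id, coef_id]

lemma unit_eq_sum (f : B.W (𝟙_ C)) :
    f = ∑ a, B.coef a (f ≫ (ρ_ B.G).hom) • (B.idem a ≫ B.unitVec) := by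
  have h := eq_sum_idem (f ≫ (ρ_ B.G).hom)
  have h2 := congrArg (· ≫ (ρ_ B.G).inv) h
  simp only [Category.assoc, Iso.hom_inv_id, Category.comp_id, Preadditive.sum_comp,
    Linear.smul_comp] at h2
  exact h2

lemma unit_comp_idem (a : ι) (f : B.W (𝟙_ C)) : f ≫ B.idem a ▷ 𝟙_ C = B.idem a ≫ f := by
  have h := congrArg (· ≫ (ρ_ B.G).inv)
    ((comp_idem a (f ≫ (ρ_ B.G).hom)).trans (idem_comp a (f ≫ (ρ_ B.G).hom)).symm)
  simpa using h

end

section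

variable {C : Type u} [Category.{v} C] [Abelian C] [Linear ℂ C] [MonoidalCategory C]
  [MonoidalPreadditive C] [MonoidalLinear ℂ C] [RigidCategory C] [UnitaryFusionCategory C]
  {ι : Type w} [Fintype ι] [DecidableEq ι] (B : FusionBasis C ι)

/-! ### The action of `H_𝒞` on the fibre functor -/

section Action

lemma comp_linSum {κ M N L : Type*} [AddCommGroup M] [Module ℂ M] [AddCommGroup N] [Module ℂ N]
    [AddCommGroup L] [Module ℂ L] (s : Finset κ) (f : κ → (M →ₗ[ℂ] N)) (g : N →ₗ[ℂ] L) :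
    g ∘ₗ (∑ k ∈ s, f k) = ∑ k ∈ s, g ∘ₗ f k := by
  ext x; simp

lemma linSum_comp {κ M N L : Type*} [AddCommGroup M] [Module ℂ M] [AddCommGroup N] [Module ℂ N]
    [AddCommGroup L] [Module ℂ L] (s : Finset κ) (f : κ → (N →ₗ[ℂ] L)) (g : M →ₗ[ℂ] N) :
    (∑ k ∈ s, f k) ∘ₗ g = ∑ k ∈ s, f k ∘ₗ g := by
  ext x; simp

variable {B}

/-- The vector of `Hom(G, G ⊗ i)` given by the dual of a vertex. -/
def wv {i : ι} (x : B.Idx i) : B.W (B.X i) :=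
  B.prj x.2.1 ≫ B.dv x.1 i x.2.1 x.2.2 ≫ B.inc x.1 ▷ B.X i

/-- A vertex as a morphism `G ⊗ i ⟶ G`. -/
def vv {i : ι} (x : B.Idx i) : B.G ⊗ B.X i ⟶ B.G :=
  B.prj x.1 ▷ B.X i ≫ B.vertex x.1 i x.2.1 x.2.2 ≫ B.inc x.2.1

lemma sum_vv_wv (i : ι) : ∑ x : B.Idx i, vv x ≫ wv x = 𝟙 (B.G ⊗ B.X i) := by
  have h1 : ∀ x : B.Idx i, vv x ≫ wv x = B.prj x.1 ▷ B.X i ≫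
      (B.vertex x.1 i x.2.1 x.2.2 ≫ B.dv x.1 i x.2.1 x.2.2) ≫ B.inc x.1 ▷ B.X i := by
    intro x
    simp only [vv, wv, Category.assoc]
    rw [← Category.assoc (B.inc x.2.1), inc_prj, Category.id_comp]
  simp_rw [h1]
  rw [Fintype.sum_sigma]
  simp_rw [Fintype.sum_sigma, ← Preadditive.comp_sum, ← Preadditive.sum_comp, sum_vertex_dv,
    Category.id_comp, ← comp_whiskerRight]
  rw [← sum_whiskerRight]
  exact (congrArg (· ▷ B.X i) B.sum_idem).trans (id_whiskerRight _ _)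

lemma idem_wv {i : ι} (x : B.Idx i) : B.idem x.2.1 ≫ wv x = wv x := by
  rw [wv, ← Category.assoc, idem_prj]

lemma vv_idem {i : ι} (x : B.Idx i) : vv x ≫ B.idem x.2.1 = vv x := by
  rw [vv, Category.assoc, Category.assoc, inc_idem]

variable (B) in
/-- The coordinates of a vector of `Hom(G, G ⊗ i)`. -/
def cw {i : ι} (x : B.Idx i) : B.W (B.X i) →ₗ[ℂ] ℂ := B.coef x.2.1 ∘ₗ Linear.rightComp ℂ _ (vv x)

lemma cw_apply {i : ι} (x : B.Idx i) (f : B.W (B.X i)) :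
    B.cw x f = B.coef x.2.1 (f ≫ vv x) := rfl

lemma comp_vv {i : ι} (x : B.Idx i) (f : B.W (B.X i)) : f ≫ vv x = B.cw x f • B.idem x.2.1 := by
  rw [cw_apply, ← comp_idem, Category.assoc, vv_idem]

lemma sum_cw_wv {i : ι} (f : B.W (B.X i)) : ∑ x, B.cw x f • wv x = f := by
  conv_rhs => rw [← Category.comp_id f, ← sum_vv_wv, Preadditive.comp_sum]
  refine Finset.sum_congr rfl fun x _ => ?_
  rw [← Category.assoc, comp_vv, Linear.smul_comp, idem_wv]

lemma cw_wv_self {i : ι} (x : B.Idx i) : B.cw x (wv x) = 1 := by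
  rw [cw_apply, coef_apply]
  simp only [vv, wv, Category.assoc, inc_prj, Category.comp_id]
  rw [← comp_whiskerRight_assoc, inc_prj, id_whiskerRight, Category.id_comp, dv_vertex_self,
    Category.comp_id, inc_prj, scal_id]

lemma cw_wv_of_ne {i : ι} {x y : B.Idx i} (h : x ≠ y) : B.cw x (wv y) = 0 := by
  obtain ⟨a, b, α⟩ := x
  obtain ⟨a', b', β⟩ := y
  rw [cw_apply]
  simp only [vv, wv, Category.assoc]
  rw [← comp_whiskerRight_assoc]
  by_cases ha : a' = a
  · subst ha
    rw [inc_prj, id_whiskerRight, Category.id_comp]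
    by_cases hb : b' = b
    · subst hb
      have hα : β ≠ α := by rintro rfl; exact h rfl
      rw [← Category.assoc (B.dv _ _ _ _), dv_vertex_of_ne hα]
      simp
    · rw [← Category.assoc (B.dv _ _ _ _), hom_eq_zero hb (_ ≫ _)]
      simp
  · rw [inc_prj_of_ne ha]
    simp

lemma cw_wv {i : ι} (x y : B.Idx i) : B.cw x (wv y) = if x = y then 1 else 0 := by
  split_ifs with h
  · subst h; exact cw_wv_self x
  · exact cw_wv_of_ne h

variable (B) in
/-- The basis of `Hom(G, G ⊗ i)` dual to the vertices. -/
def wB (i : ι) : Module.Basis (B.Idx i) ℂ (B.W (B.X i)) :=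
  Module.Basis.ofEquivFun
    { toFun := fun f x => B.cw x f
      map_add' := fun f g => by funext x; simp
      map_smul' := fun c f => by funext x; simp
      invFun := fun c => ∑ x, c x • wv x
      left_inv := fun f => sum_cw_wv f
      right_inv := fun c => by
        funext x
        simp [cw_wv] }

lemma wB_equivFun {i : ι} (f : B.W (B.X i)) (x : B.Idx i) : (B.wB i).equivFun f x = B.cw x f := by
  rw [wB, Module.Basis.equivFun_ofEquivFun]
  rfl

lemma wB_repr {i : ι} (f : B.W (B.X i)) (x : B.Idx i) : (B.wB i).repr f x = B.cw x f :=
  wB_equivFun f x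

lemma wB_apply {i : ι} (x : B.Idx i) : B.wB i x = wv x := by
  refine (B.wB i).repr.injective ?_
  rw [Module.Basis.repr_self]
  ext y
  rw [wB_repr, cw_wv, Finsupp.single_apply]
  simp [eq_comm]

variable (B) in
/-- The action of `H_𝒞` on `Hom(G, G ⊗ i)`. -/
def simpleAct (i : ι) : B.H →ₐ[ℂ] Module.End ℂ (B.W (B.X i)) :=
  AlgHom.ofLinearMap
    { toFun := fun h => (B.rtd i : ℂ)⁻¹ • Matrix.toLin (B.wB i) (B.wB i) (h i)
      map_add' := fun g h => by rw [add_apply, map_add, smul_add]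
      map_smul' := fun c h => by rw [smul_apply, map_smul, RingHom.id_apply, smul_comm] }
    (by
      change (B.rtd i : ℂ)⁻¹ • Matrix.toLin (B.wB i) (B.wB i) ((1 : B.H) i) = 1
      rw [one_apply, map_smul, smul_smul, inv_mul_cancel₀ (B.rtd_ne i), one_smul,
        Matrix.toLin_one]
      rfl)
    (fun g h => by
      change (B.rtd i : ℂ)⁻¹ • Matrix.toLin (B.wB i) (B.wB i) ((g * h) i) =
        ((B.rtd i : ℂ)⁻¹ • Matrix.toLin (B.wB i) (B.wB i) (g i)) *
          ((B.rtd i : ℂ)⁻¹ • Matrix.toLin (B.wB i) (B.wB i) (h i))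
      rw [mul_apply, map_smul, Matrix.toLin_mul _ (B.wB i), smul_mul_smul_comm, smul_smul]
      rfl)

lemma simpleAct_apply (i : ι) (h : B.H) (f : B.W (B.X i)) : B.simpleAct i h f =
    ∑ x, ∑ y, ((B.rtd i : ℂ)⁻¹ * h i x y * B.cw y f) • wv x := by
  change (B.rtd i : ℂ)⁻¹ • Matrix.toLin (B.wB i) (B.wB i) (h i) f = _
  rw [Matrix.toLin_apply, Finset.smul_sum]
  refine Finset.sum_congr rfl fun x _ => ?_
  rw [wB_apply, smul_smul, ← Finset.sum_smul]
  congr 1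
  simp only [Matrix.mulVec, dotProduct, Finset.mul_sum]
  exact Finset.sum_congr rfl fun y _ => by rw [wB_repr, mul_assoc]

lemma cw_simpleAct (i : ι) (h : B.H) (x y : B.Idx i) :
    B.cw x (B.simpleAct i h (wv y)) = (B.rtd i : ℂ)⁻¹ * h i x y := by
  rw [simpleAct_apply, map_sum, Finset.sum_eq_single x, map_sum, Finset.sum_eq_single y]
  · simp [cw_wv_self]
  · intro z _ hz; simp [cw_wv_of_ne hz]
  · simp
  · intro z _ hz; simp [cw_wv_of_ne hz.symm]
  · simp

/-- Morphisms between simple objects commute with the action. -/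
lemma Wmap_simpleAct {i j : ι} (f : B.X i ⟶ B.X j) (h : B.H) :
    B.Wmap f ∘ₗ B.simpleAct i h = B.simpleAct j h ∘ₗ B.Wmap f := by
  by_cases hij : i = j
  · subst hij
    rw [← scal_smul_id i f, Wmap_smul, Wmap_id, LinearMap.smul_comp, LinearMap.comp_smul,
      LinearMap.id_comp, LinearMap.comp_id]
  · rw [hom_eq_zero hij f, Wmap_zero]; simp

variable (B) in
/-- The linear map underlying `rep`, through a decomposition of `X` into simple objects. By
`Wmap_repLin` it does not depend on the choice of the decomposition. -/
def repLin (X : C) (h : B.H) : Module.End ℂ (B.W X) :=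
  let s := (B.exists_complete X).choose_spec.choose_spec.choose_spec
  ∑ k, B.Wmap (s.choose k) ∘ₗ B.simpleAct _ h ∘ₗ
    B.Wmap ((B.exists_complete X).choose_spec.choose_spec.choose k)

variable (B) in
lemma exists_repLin (X : C) : ∃ (n : ℕ) (c : Fin n → ι) (p : ∀ k, X ⟶ B.X (c k))
    (j : ∀ k, B.X (c k) ⟶ X), ∑ k, p k ≫ j k = 𝟙 X ∧
      ∀ h, B.repLin X h = ∑ k, B.Wmap (j k) ∘ₗ B.simpleAct (c k) h ∘ₗ B.Wmap (p k) :=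
  ⟨_, _, (B.exists_complete X).choose_spec.choose_spec.choose,
    (B.exists_complete X).choose_spec.choose_spec.choose_spec.choose,
    (B.exists_complete X).choose_spec.choose_spec.choose_spec.choose_spec, fun _ => rfl⟩

lemma Wmap_repLin_simple {X : C} {i : ι} (g : X ⟶ B.X i) (h : B.H) :
    B.Wmap g ∘ₗ B.repLin X h = B.simpleAct i h ∘ₗ B.Wmap g := by
  obtain ⟨n, c, p, j, hpj, hr⟩ := B.exists_repLin X
  have h1 : ∀ k, B.Wmap g ∘ₗ B.Wmap (j k) ∘ₗ B.simpleAct (c k) h ∘ₗ B.Wmap (p k) =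
      B.simpleAct i h ∘ₗ B.Wmap (p k ≫ j k ≫ g) := by
    intro k
    rw [← LinearMap.comp_assoc, ← LinearMap.comp_assoc, ← Wmap_comp, Wmap_simpleAct,
      LinearMap.comp_assoc, ← Wmap_comp]
  rw [hr, comp_linSum]
  simp_rw [h1]
  rw [← comp_linSum, ← Wmap_sum]
  simp_rw [← Category.assoc]
  rw [← Preadditive.sum_comp, hpj, Category.id_comp]

lemma Wmap_repLin {X Y : C} (f : X ⟶ Y) (h : B.H) :
    B.Wmap f ∘ₗ B.repLin X h = B.repLin Y h ∘ₗ B.Wmap f := by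
  obtain ⟨n, c, p, j, hpj, hr⟩ := B.exists_repLin Y
  have h1 : B.Wmap f = ∑ k, B.Wmap (j k) ∘ₗ B.Wmap (f ≫ p k) := by
    simp_rw [← Wmap_comp]
    rw [← Wmap_sum]
    simp_rw [Category.assoc]
    rw [← Preadditive.comp_sum, hpj, Category.comp_id]
  calc B.Wmap f ∘ₗ B.repLin X h = ∑ k, B.Wmap (j k) ∘ₗ B.Wmap (f ≫ p k) ∘ₗ B.repLin X h := by
        rw [h1, linSum_comp]; rfl
    _ = _ := by
      rw [hr, linSum_comp]
      refine Finset.sum_congr rfl fun k _ => ?_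
      rw [Wmap_repLin_simple, Wmap_comp]; rfl

lemma repLin_mul (X : C) (g h : B.H) : B.repLin X (g * h) = B.repLin X g ∘ₗ B.repLin X h := by
  obtain ⟨n, c, p, j, hpj, hr⟩ := B.exists_repLin X
  rw [hr, hr g, linSum_comp]
  refine Finset.sum_congr rfl fun k _ => ?_
  rw [LinearMap.comp_assoc, LinearMap.comp_assoc, Wmap_repLin_simple, map_mul]; rfl

lemma repLin_one (X : C) : B.repLin X 1 = LinearMap.id := by
  obtain ⟨n, c, p, j, hpj, hr⟩ := B.exists_repLin X
  rw [hr, ← Wmap_id, ← hpj, Wmap_sum]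
  refine Finset.sum_congr rfl fun k _ => ?_
  rw [map_one, Wmap_comp]; rfl

variable (B) in
/-- The action of `H_𝒞` on `W X`: the endomorphisms of the fibre functor, determined by their
values at the simple objects. -/
def rep (X : C) : B.H →ₐ[ℂ] Module.End ℂ (B.W X) :=
  AlgHom.ofLinearMap
    { toFun := B.repLin X
      map_add' := fun g h => by
        obtain ⟨n, c, p, j, hpj, hr⟩ := B.exists_repLin X
        simp only [hr, map_add, LinearMap.comp_add, LinearMap.add_comp, Finset.sum_add_distrib]
      map_smul' := fun a h => by
        obtain ⟨n, c, p, j, hpj, hr⟩ := B.exists_repLin X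
        simp only [hr, map_smul, LinearMap.comp_smul, LinearMap.smul_comp, Finset.smul_sum,
          RingHom.id_apply] }
    (repLin_one X) (repLin_mul X)

/-- `H_𝒞` acts by natural endomorphisms of the fibre functor. -/
lemma Wmap_rep {X Y : C} (f : X ⟶ Y) (h : B.H) (x : B.W X) :
    B.Wmap f (B.rep X h x) = B.rep Y h (B.Wmap f x) := LinearMap.congr_fun (Wmap_repLin f h) x

lemma rep_simple (i : ι) : B.rep (B.X i) = B.simpleAct i := by
  ext h x
  have := LinearMap.congr_fun (Wmap_repLin_simple (𝟙 (B.X i)) h) x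
  rw [Wmap_id] at this
  exact this

/-- The matrix units of `H_𝒞`: the product of the basis vectors `e_{i;x,y}` involves `1 / √d_i`,
which the factor `√d_i` compensates. -/
def E {i : ι} (x y : B.Idx i) : B.H := (B.rtd i : ℂ) • B.e i x y

variable (B) in
/-- The basis of `H_𝒞` of matrix units. -/
def eB : Module.Basis ((i : ι) × B.Idx i × B.Idx i) ℂ B.H :=
  Module.Basis.ofEquivFun
    { toFun := fun h k => (B.rtd k.1 : ℂ)⁻¹ * h k.1 k.2.1 k.2.2
      map_add' := fun f g => by funext k; simp [add_apply, mul_add]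
      map_smul' := fun c f => by funext k; simp [smul_apply, mul_left_comm]
      invFun := fun c i => Matrix.of fun x y => B.rtd i * c ⟨i, x, y⟩
      left_inv := fun f => by
        funext i; ext x y
        simp [mul_inv_cancel_left₀ (B.rtd_ne i)]
      right_inv := fun c => by
        funext k
        simp [inv_mul_cancel_left₀ (B.rtd_ne _)] }

lemma eB_repr (h : B.H) {i : ι} (x y : B.Idx i) :
    B.eB.repr h ⟨i, x, y⟩ = B.cw x (B.rep (B.X i) h (wv y)) := by
  rw [rep_simple, cw_simpleAct]
  change B.eB.equivFun h ⟨i, x, y⟩ = _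
  rw [eB, Module.Basis.equivFun_ofEquivFun]
  rfl

/-- The action on the fibre functor is faithful. -/
lemma rep_ext {g h : B.H} (H : ∀ i (f : B.W (B.X i)), B.rep (B.X i) g f = B.rep (B.X i) h f) :
    g = h := by
  refine B.eB.ext_elem ?_
  rintro ⟨i, x, y⟩
  rw [eB_repr, eB_repr, H]

variable (B) in
/-- The action of `H_𝒞 ⊗ H_𝒞` on `W X ⊗ W Y`. -/
def act2 (X Y : C) : B.H ⊗[ℂ] B.H →ₗ[ℂ] Module.End ℂ (B.W X ⊗[ℂ] B.W Y) :=
  TensorProduct.homTensorHomMap (RingHom.id ℂ) _ _ _ _ ∘ₗ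
    TensorProduct.map (B.rep X).toLinearMap (B.rep Y).toLinearMap

@[simp] lemma act2_tmul (X Y : C) (g h : B.H) :
    B.act2 X Y (g ⊗ₜ h) = TensorProduct.map (B.rep X g) (B.rep Y h) := by
  simp [act2]

lemma act2_mul (X Y : C) (s t : B.H ⊗[ℂ] B.H) (z : B.W X ⊗[ℂ] B.W Y) :
    B.act2 X Y (s * t) z = B.act2 X Y s (B.act2 X Y t z) := by
  induction s with
  | zero => simp
  | add s s' hs hs' => simp only [add_mul, map_add, LinearMap.add_apply, hs, hs']
  | tmul a b =>
    induction t with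
    | zero => simp
    | add t t' ht ht' => simp only [mul_add, map_add, LinearMap.add_apply, ht, ht']
    | tmul c d =>
      rw [Algebra.TensorProduct.tmul_mul_tmul, act2_tmul, act2_tmul, act2_tmul, map_mul, map_mul,
        ← LinearMap.comp_apply, ← TensorProduct.map_comp]
      rfl

lemma act2_natural {X Y X' Y' : C} (f : X ⟶ X') (g : Y ⟶ Y') (t : B.H ⊗[ℂ] B.H)
    (z : B.W X ⊗[ℂ] B.W Y) :
    TensorProduct.map (B.Wmap f) (B.Wmap g) (B.act2 X Y t z) =
      B.act2 X' Y' t (TensorProduct.map (B.Wmap f) (B.Wmap g) z) := by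
  induction t with
  | zero => simp
  | add s t hs ht => simp only [map_add, LinearMap.add_apply, hs, ht]
  | tmul a b =>
    induction z with
    | zero => simp
    | add s t hs ht => simp only [map_add, hs, ht]
    | tmul x y => simp [Wmap_rep]

variable (B) in
/-- The action of `H_𝒞 ⊗ (H_𝒞 ⊗ H_𝒞)` on `W X ⊗ (W Y ⊗ W Z)`. -/
def act3 (X Y Z : C) : B.H ⊗[ℂ] (B.H ⊗[ℂ] B.H) →ₗ[ℂ]
    Module.End ℂ (B.W X ⊗[ℂ] (B.W Y ⊗[ℂ] B.W Z)) :=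
  TensorProduct.homTensorHomMap (RingHom.id ℂ) _ _ _ _ ∘ₗ
    TensorProduct.map (B.rep X).toLinearMap (B.act2 Y Z)

@[simp] lemma act3_tmul (X Y Z : C) (g : B.H) (t : B.H ⊗[ℂ] B.H) :
    B.act3 X Y Z (g ⊗ₜ t) = TensorProduct.map (B.rep X g) (B.act2 Y Z t) := by
  simp [act3]

/-- The action of `H_𝒞 ⊗ H_𝒞` on the products of fibres is faithful. -/
lemma act2_ext {s t : B.H ⊗[ℂ] B.H}
    (H : ∀ i j (x : B.W (B.X i)) (y : B.W (B.X j)),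
      B.act2 (B.X i) (B.X j) s (x ⊗ₜ y) = B.act2 (B.X i) (B.X j) t (x ⊗ₜ y)) : s = t := by
  refine (B.eB.tensorProduct B.eB).ext_elem ?_
  rintro ⟨⟨i, x, y⟩, ⟨j, x', y'⟩⟩
  have key : ∀ t : B.H ⊗[ℂ] B.H, (B.eB.tensorProduct B.eB).repr t (⟨i, x, y⟩, ⟨j, x', y'⟩) =
      TensorProduct.lid ℂ ℂ (TensorProduct.map (B.cw x) (B.cw x')
        (B.act2 (B.X i) (B.X j) t (wv y ⊗ₜ wv y'))) := by
    intro t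
    induction t with
    | zero => simp
    | add s t hs ht => simp only [map_add, LinearMap.add_apply, Finsupp.add_apply, hs, ht]
    | tmul g h => simp [eB_repr, mul_comm]
  rw [key, key, H]

/-- The action of `H_𝒞 ⊗ (H_𝒞 ⊗ H_𝒞)` on the products of fibres is faithful. -/
lemma act3_ext {s t : B.H ⊗[ℂ] (B.H ⊗[ℂ] B.H)}
    (H : ∀ i j k (x : B.W (B.X i)) (y : B.W (B.X j)) (z : B.W (B.X k)),
      B.act3 (B.X i) (B.X j) (B.X k) s (x ⊗ₜ (y ⊗ₜ z)) =
        B.act3 (B.X i) (B.X j) (B.X k) t (x ⊗ₜ (y ⊗ₜ z))) : s = t := by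
  refine (B.eB.tensorProduct (B.eB.tensorProduct B.eB)).ext_elem ?_
  rintro ⟨⟨i, x, y⟩, ⟨⟨j, x', y'⟩, ⟨k, x'', y''⟩⟩⟩
  have key : ∀ t : B.H ⊗[ℂ] (B.H ⊗[ℂ] B.H),
      (B.eB.tensorProduct (B.eB.tensorProduct B.eB)).repr t
        (⟨i, x, y⟩, (⟨j, x', y'⟩, ⟨k, x'', y''⟩)) =
      TensorProduct.lid ℂ ℂ (TensorProduct.map (B.cw x)
        (TensorProduct.lid ℂ ℂ ∘ₗ TensorProduct.map (B.cw x') (B.cw x''))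
        (B.act3 (B.X i) (B.X j) (B.X k) t (wv y ⊗ₜ (wv y' ⊗ₜ wv y'')))) := by
    intro t
    induction t with
    | zero => simp
    | add s t hs ht => simp only [map_add, LinearMap.add_apply, Finsupp.add_apply, hs, ht]
    | tmul g t =>
      induction t with
      | zero => simp
      | add s t hs ht =>
        simp only [TensorProduct.tmul_add, map_add, LinearMap.add_apply, Finsupp.add_apply, hs, ht]
      | tmul h h' =>
        simp [eB_repr, mul_comm]
  rw [key, key, H]

end Action

/-! ### The comultiplication through the fibre functor -/

section Comul

variable {B}

/-- The inverse of the change of basis between trees, for unitary `F`. -/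
lemma tree_eq_sum (hU : B.IsUnitary) (a j k b i : ι) (μ : Fin (B.N j k i)) (α : Fin (B.N a i b)) :
    B.X a ◁ B.vertex j k i μ ≫ B.vertex a i b α =
      ∑ t, star (B.F a j k b ⟨i, μ, α⟩ t) • ((α_ (B.X a) (B.X j) (B.X k)).inv ≫
        B.vertex a j t.1 t.2.1 ▷ B.X k ≫ B.vertex t.1 k b t.2.2) := by
  have h := (hU a j k b).1
  set S : (n : ι) × Fin (B.N j k n) × Fin (B.N a n b) := ⟨i, μ, α⟩
  change B.X a ◁ B.vertex j k S.1 S.2.1 ≫ B.vertex a S.1 b S.2.2 = _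
  simp_rw [B.F_spec, Finset.smul_sum, smul_smul]
  rw [Finset.sum_comm]
  simp_rw [← Finset.sum_smul]
  have h2 : ∀ s, ∑ t, star (B.F a j k b S t) * B.F a j k b s t =
      (1 : Matrix _ _ ℂ) s S := by
    intro s
    rw [← h, Matrix.mul_apply]
    exact Finset.sum_congr rfl fun t _ => mul_comm _ _
  simp_rw [h2, Matrix.one_apply, ite_smul, one_smul, zero_smul]
  simp

/-- The pairing of a tree with a dual tree of the other shape is an entry of `F`. -/
lemma dualTree_comp_tree (a j k b i : ι) (μ : Fin (B.N j k i)) (α : Fin (B.N a i b))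
    (t : (m : ι) × Fin (B.N a j m) × Fin (B.N m k b)) :
    (B.dv a i b α ≫ B.X a ◁ B.dv j k i μ) ≫ (α_ (B.X a) (B.X j) (B.X k)).inv ≫
      B.vertex a j t.1 t.2.1 ▷ B.X k ≫ B.vertex t.1 k b t.2.2 =
    B.F a j k b ⟨i, μ, α⟩ t • 𝟙 _ := by
  rw [B.F_spec, Preadditive.comp_sum, Finset.sum_eq_single ⟨i, μ, α⟩]
  · rw [Linear.comp_smul, Category.assoc, ← whiskerLeft_comp_assoc, dv_vertex_self,
      MonoidalCategory.whiskerLeft_id, Category.id_comp, dv_vertex_self]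
  · rintro ⟨i', μ', α'⟩ _ hne
    rw [Linear.comp_smul, Category.assoc, ← whiskerLeft_comp_assoc]
    by_cases hi : i = i'
    · subst hi
      by_cases hμ : μ = μ'
      · subst hμ
        have hα : α ≠ α' := by rintro rfl; exact hne rfl
        rw [dv_vertex_self, MonoidalCategory.whiskerLeft_id, Category.id_comp, dv_vertex_of_ne hα,
          smul_zero]
      · rw [dv_vertex_of_ne hμ]; simp
    · rw [hom_eq_zero hi (B.dv j k i μ ≫ _)]; simp
  · simp

/-- The dual trees decompose `(a ⊗ b) ⊗ c` into simple objects. -/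
lemma sum_tree_dualTree (a j k : ι) :
    ∑ b, ∑ t : (m : ι) × Fin (B.N a j m) × Fin (B.N m k b),
      (B.vertex a j t.1 t.2.1 ▷ B.X k ≫ B.vertex t.1 k b t.2.2) ≫
        (B.dv t.1 k b t.2.2 ≫ B.dv a j t.1 t.2.1 ▷ B.X k) =
      𝟙 ((B.X a ⊗ B.X j) ⊗ B.X k) := by
  simp_rw [Fintype.sum_sigma, Fintype.sum_prod_type]
  rw [Finset.sum_comm]
  have h1 : ∀ m, ∑ b, ∑ σ, ∑ τ, (B.vertex a j m σ ▷ B.X k ≫ B.vertex m k b τ) ≫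
      (B.dv m k b τ ≫ B.dv a j m σ ▷ B.X k) =
      ∑ σ, (B.vertex a j m σ ≫ B.dv a j m σ) ▷ B.X k := by
    intro m
    rw [Finset.sum_comm]
    refine Finset.sum_congr rfl fun σ _ => ?_
    have h2 : ∀ b τ, (B.vertex a j m σ ▷ B.X k ≫ B.vertex m k b τ) ≫
        (B.dv m k b τ ≫ B.dv a j m σ ▷ B.X k) = B.vertex a j m σ ▷ B.X k ≫
          (B.vertex m k b τ ≫ B.dv m k b τ) ≫ B.dv a j m σ ▷ B.X k := by
      intro b τ; simp
    simp_rw [h2, ← Preadditive.comp_sum, ← Preadditive.sum_comp, sum_vertex_dv]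
    simp
  simp_rw [h1, ← sum_whiskerRight]
  rw [sum_vertex_dv, id_whiskerRight]

/-- The expansion of a dual tree in the dual trees of the other shape. -/
lemma dualTree_eq_sum (a j k b i : ι) (μ : Fin (B.N j k i)) (α : Fin (B.N a i b)) :
    B.dv a i b α ≫ B.X a ◁ B.dv j k i μ =
      ∑ t, B.F a j k b ⟨i, μ, α⟩ t • (B.dv t.1 k b t.2.2 ≫ B.dv a j t.1 t.2.1 ▷ B.X k ≫
        (α_ (B.X a) (B.X j) (B.X k)).hom) := by
  rw [← cancel_mono (α_ (B.X a) (B.X j) (B.X k)).inv]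
  conv_lhs => rw [← Category.comp_id ((_ ≫ _) ≫ _), ← sum_tree_dualTree]
  rw [Preadditive.comp_sum, Finset.sum_eq_single b]
  · rw [Preadditive.comp_sum, Preadditive.sum_comp]
    refine Finset.sum_congr rfl fun t _ => ?_
    have h := dualTree_comp_tree (B := B) a j k b i μ α t
    have h2 := congrArg (· ≫ (B.dv t.1 k b t.2.2 ≫ B.dv a j t.1 t.2.1 ▷ B.X k)) h
    simp only [Category.assoc, Linear.smul_comp, Category.id_comp, Iso.hom_inv_id,
      Category.comp_id] at h2 ⊢
    exact h2
  · intro b' _ hb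
    rw [Preadditive.comp_sum]
    refine Finset.sum_eq_zero fun t _ => ?_
    rw [← Category.assoc, hom_eq_zero (Ne.symm hb) (_ ≫ _ ≫ _), Limits.zero_comp]
  · simp

lemma balance_wv {j k : ι} (a p b : ι) (σ : Fin (B.N a j p)) (τ : Fin (B.N p k b)) :
    B.balance (B.X j) (B.X k) (wv ⟨a, p, σ⟩ ⊗ₜ wv ⟨p, b, τ⟩) =
      wv ⟨a, p, σ⟩ ⊗ₜ wv ⟨p, b, τ⟩ := by
  have h1 : (wv ⟨p, b, τ⟩ : B.W (B.X k)) ≫ B.idem p ▷ B.X k = wv ⟨p, b, τ⟩ := by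
    rw [wv, Category.assoc, Category.assoc, ← comp_whiskerRight, inc_idem]
  rw [balance_tmul, Finset.sum_eq_single p]
  · rw [h1]
    exact congrArg (· ⊗ₜ[ℂ] _) (idem_wv (B := B) (⟨a, p, σ⟩ : B.Idx j))
  · intro c _ hc
    rw [wv, idem, Category.assoc, ← Category.assoc (B.inc c), inc_prj_of_ne hc]
    simp
  · simp

/-- The maps `Hom(G, G ⊗ i) → Hom(G, G ⊗ j) ⊗ Hom(G, G ⊗ k)` given by the duals of the vertices
have the entries of `F` as coefficients. -/
lemma nu_Wmap_dv (j k i a b : ι) (μ : Fin (B.N j k i)) (α : Fin (B.N a i b)) :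
    B.nu (B.X j) (B.X k) (B.Wmap (B.dv j k i μ) (wv ⟨a, b, α⟩)) =
      ∑ t, B.F a j k b ⟨i, μ, α⟩ t •
        ((wv ⟨a, t.1, t.2.1⟩ : B.W (B.X j)) ⊗ₜ[ℂ] (wv ⟨t.1, b, t.2.2⟩ : B.W (B.X k))) := by
  have h : B.Wmap (B.dv j k i μ) (wv ⟨a, b, α⟩) = B.mu (B.X j) (B.X k)
      (∑ t, B.F a j k b ⟨i, μ, α⟩ t •
        ((wv ⟨a, t.1, t.2.1⟩ : B.W (B.X j)) ⊗ₜ[ℂ] (wv ⟨t.1, b, t.2.2⟩ : B.W (B.X k)))) := by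
    have h1 : ∀ t : (m : ι) × Fin (B.N a j m) × Fin (B.N m k b),
        (wv ⟨t.1, b, t.2.2⟩ : B.W (B.X k)) ≫
          (wv ⟨a, t.1, t.2.1⟩ : B.W (B.X j)) ▷ B.X k ≫ (α_ B.G (B.X j) (B.X k)).hom =
        B.prj b ≫ (B.dv t.1 k b t.2.2 ≫ B.dv a j t.1 t.2.1 ▷ B.X k ≫
          (α_ (B.X a) (B.X j) (B.X k)).hom) ≫ B.inc a ▷ (B.X j ⊗ B.X k) := by
      intro t
      simp only [wv, Category.assoc]
      rw [← comp_whiskerRight_assoc, ← Category.assoc (B.inc t.1), inc_prj, Category.id_comp]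
      simp
    have h2 : B.Wmap (B.dv j k i μ) (wv ⟨a, b, α⟩) =
        B.prj b ≫ (B.dv a i b α ≫ B.X a ◁ B.dv j k i μ) ≫ B.inc a ▷ (B.X j ⊗ B.X k) := by
      rw [Wmap_apply, wv, Category.assoc, Category.assoc, Category.assoc, whisker_exchange]
    rw [h2, dualTree_eq_sum]
    simp only [map_sum, map_smul, mu_tmul, h1, Preadditive.sum_comp, Preadditive.comp_sum,
      Linear.smul_comp, Linear.comp_smul]
  rw [h, nu_mu, map_sum]
  exact Finset.sum_congr rfl fun t _ => by rw [map_smul, balance_wv]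

/-- The maps `Hom(G, G ⊗ j) ⊗ Hom(G, G ⊗ k) → Hom(G, G ⊗ i)` given by the vertices have the complex
conjugates of the entries of `F` as coefficients. -/
lemma cw_Wmap_vertex_mu (hU : B.IsUnitary) (j k i c d : ι) (μ : Fin (B.N j k i))
    (β : Fin (B.N c i d)) (f : B.W (B.X j)) (g : B.W (B.X k)) :
    B.cw ⟨c, d, β⟩ (B.Wmap (B.vertex j k i μ) (B.mu _ _ (f ⊗ₜ g))) =
      ∑ t, star (B.F c j k d ⟨i, μ, β⟩ t) * (B.cw ⟨c, t.1, t.2.1⟩ f * B.cw ⟨t.1, d, t.2.2⟩ g) := by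
  have h2 : ∀ t : (m : ι) × Fin (B.N c j m) × Fin (B.N m k d),
      B.coef d (g ≫ f ▷ B.X k ≫ (α_ B.G (B.X j) (B.X k)).hom ≫ B.prj c ▷ (B.X j ⊗ B.X k) ≫
        ((α_ (B.X c) (B.X j) (B.X k)).inv ≫
        B.vertex c j t.1 t.2.1 ▷ B.X k ≫ B.vertex t.1 k d t.2.2) ≫ B.inc d) =
      B.cw ⟨c, t.1, t.2.1⟩ f * B.cw ⟨t.1, d, t.2.2⟩ g := by
    intro t
    have h3 : f ≫ B.prj c ▷ B.X j ≫ B.vertex c j t.1 t.2.1 =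
        B.cw ⟨c, t.1, t.2.1⟩ f • B.prj t.1 := by
      have := congrArg (· ≫ B.prj t.1) (comp_vv (⟨c, t.1, t.2.1⟩ : B.Idx j) f)
      simpa [vv] using this
    have h4 : g ≫ f ▷ B.X k ≫ (α_ B.G (B.X j) (B.X k)).hom ≫ B.prj c ▷ (B.X j ⊗ B.X k) ≫
        ((α_ (B.X c) (B.X j) (B.X k)).inv ≫
        B.vertex c j t.1 t.2.1 ▷ B.X k ≫ B.vertex t.1 k d t.2.2) ≫ B.inc d =
        g ≫ (f ≫ B.prj c ▷ B.X j ≫ B.vertex c j t.1 t.2.1) ▷ B.X k ≫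
          B.vertex t.1 k d t.2.2 ≫ B.inc d := by
      simp
    rw [h4, h3, MonoidalLinear.smul_whiskerRight, Linear.smul_comp, Linear.comp_smul, map_smul,
      smul_eq_mul]
    rfl
  have h1 : B.Wmap (B.vertex j k i μ) (B.mu _ _ (f ⊗ₜ g)) ≫ vv ⟨c, d, β⟩ =
      ∑ t, star (B.F c j k d ⟨i, μ, β⟩ t) • (g ≫ f ▷ B.X k ≫ (α_ B.G (B.X j) (B.X k)).hom ≫
        B.prj c ▷ (B.X j ⊗ B.X k) ≫ ((α_ (B.X c) (B.X j) (B.X k)).inv ≫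
        B.vertex c j t.1 t.2.1 ▷ B.X k ≫ B.vertex t.1 k d t.2.2) ≫ B.inc d) := by
    have h5 : B.Wmap (B.vertex j k i μ) (B.mu _ _ (f ⊗ₜ g)) ≫ vv ⟨c, d, β⟩ =
        g ≫ f ▷ B.X k ≫ (α_ B.G (B.X j) (B.X k)).hom ≫ B.prj c ▷ (B.X j ⊗ B.X k) ≫
          (B.X c ◁ B.vertex j k i μ ≫ B.vertex c i d β) ≫ B.inc d := by
      simp only [Wmap_apply, mu_tmul, vv, Category.assoc]
      rw [whisker_exchange_assoc]
    rw [h5, tree_eq_sum hU]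
    simp only [Preadditive.sum_comp, Preadditive.comp_sum, Linear.smul_comp, Linear.comp_smul]
  rw [cw_apply, h1, map_sum]
  exact Finset.sum_congr rfl fun t _ => by rw [map_smul, h2, smul_eq_mul]

lemma rep_e_self (j : ι) (x y : B.Idx j) (f : B.W (B.X j)) :
    B.rep (B.X j) (B.e j x y) f = ((B.rtd j : ℂ)⁻¹ * B.cw y f) • wv x := by
  rw [rep_simple, simpleAct_apply, Finset.sum_eq_single x, Finset.sum_eq_single y]
  · simp [e]
  · intro z _ hz; simp [e, hz.symm]
  · simp
  · intro z _ hz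
    exact Finset.sum_eq_zero fun y' _ => by simp [e, hz.symm]
  · simp

lemma rep_e_of_ne {i j : ι} (h : i ≠ j) (x y : B.Idx i) (f : B.W (B.X j)) :
    B.rep (B.X j) (B.e i x y) f = 0 := by
  rw [rep_simple, simpleAct_apply]
  refine Finset.sum_eq_zero fun x' _ => Finset.sum_eq_zero fun y' _ => ?_
  simp [e, Pi.single_eq_of_ne h.symm]

lemma rep_tensor (j k : ι) (h : B.H) (z : B.W (B.X j ⊗ B.X k)) :
    B.rep (B.X j ⊗ B.X k) h z = ∑ i, ∑ μ, B.Wmap (B.dv j k i μ)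
      (B.rep (B.X i) h (B.Wmap (B.vertex j k i μ) z)) := by
  have h1 : ∀ i μ, B.Wmap (B.dv j k i μ) (B.rep (B.X i) h (B.Wmap (B.vertex j k i μ) z)) =
      B.Wmap (B.vertex j k i μ ≫ B.dv j k i μ) (B.rep (B.X j ⊗ B.X k) h z) := by
    intro i μ
    rw [Wmap_rep, Wmap_comp, LinearMap.comp_apply, Wmap_rep, Wmap_rep]
  simp_rw [h1, ← LinearMap.sum_apply, ← Wmap_sum]
  rw [sum_vertex_dv, Wmap_id]
  rfl

/-- On the tensor product of two simple objects, the comultiplication is the natural action. -/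
lemma act2_comul_simple (hU : B.IsUnitary) (j k : ι) (h : B.H) (f : B.W (B.X j))
    (g : B.W (B.X k)) : B.act2 (B.X j) (B.X k) (B.comul h) (f ⊗ₜ g) =
      B.nu _ _ (B.rep (B.X j ⊗ B.X k) h (B.mu _ _ (f ⊗ₜ g))) := by
  have hb : ∀ (i : ι) (x y : B.Idx i), B.act2 (B.X j) (B.X k) (B.comulBasis i x y) (f ⊗ₜ g) =
      ∑ μ, ((B.rtd i : ℂ)⁻¹ * B.cw y (B.Wmap (B.vertex j k i μ) (B.mu _ _ (f ⊗ₜ g)))) •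
        B.nu (B.X j) (B.X k) (B.Wmap (B.dv j k i μ) (wv x)) := by
    rintro i ⟨a, b, α⟩ ⟨c, d, β⟩
    simp only [comulBasis, map_sum, LinearMap.sum_apply, map_smul, LinearMap.smul_apply, act2_tmul,
      TensorProduct.map_tmul]
    rw [Finset.sum_eq_single j, Finset.sum_eq_single k]
    · refine Finset.sum_congr rfl fun μ _ => ?_
      rw [cw_Wmap_vertex_mu hU, nu_Wmap_dv, Finset.smul_sum]
      refine Finset.sum_congr rfl fun s _ => ?_
      rw [Finset.mul_sum, Finset.sum_smul]
      refine Finset.sum_congr rfl fun t _ => ?_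
      rw [rep_e_self, rep_e_self, TensorProduct.smul_tmul_smul, smul_smul, smul_smul]
      congr 1
      have hj := B.rtd_ne j
      have hk := B.rtd_ne k
      push_cast
      field_simp
    · intro k' _ hk'
      refine Finset.sum_eq_zero fun μ _ => Finset.sum_eq_zero fun s _ =>
        Finset.sum_eq_zero fun t _ => ?_
      rw [rep_e_of_ne hk', TensorProduct.tmul_zero, smul_zero]
    · simp
    · intro j' _ hj'
      refine Finset.sum_eq_zero fun k' _ => Finset.sum_eq_zero fun μ _ =>
        Finset.sum_eq_zero fun s _ => Finset.sum_eq_zero fun t _ => ?_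
      rw [rep_e_of_ne hj', TensorProduct.zero_tmul, smul_zero]
    · simp
  have hc : B.comul h = ∑ i, ∑ x, ∑ y, h i x y • B.comulBasis i x y := rfl
  rw [hc, rep_tensor]
  simp only [map_sum, LinearMap.sum_apply, map_smul, LinearMap.smul_apply, hb, rep_simple,
    simpleAct_apply]
  refine Finset.sum_congr rfl fun i _ => ?_
  simp only [Finset.smul_sum, smul_smul]
  rw [Finset.sum_comm]
  conv_lhs =>
    enter [2, y]
    rw [Finset.sum_comm]
  rw [Finset.sum_comm]
  refine Finset.sum_congr rfl fun μ _ => ?_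
  rw [Finset.sum_comm]
  refine Finset.sum_congr rfl fun x _ => Finset.sum_congr rfl fun y _ => ?_
  congr 1
  ring

/-- The comultiplication is the natural action on tensor products: `Δ(h)` acts on `W X ⊗ W Y` as
`h` on `W (X ⊗ Y)`, through `mu` and `nu`. By naturality it is enough to consider simple objects,
for which the two factors `F` and `F̄` in the definition of `Δ` are the coefficients of `nu` and
`mu`. -/
lemma act2_comul (hU : B.IsUnitary) (X Y : C) (h : B.H) (z : B.W X ⊗[ℂ] B.W Y) :
    B.act2 X Y (B.comul h) z = B.nu _ _ (B.rep (X ⊗ Y) h (B.mu _ _ z)) := by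
  obtain ⟨n, c, p, j, hpj⟩ := B.exists_complete X
  obtain ⟨n', c', p', j', hpj'⟩ := B.exists_complete Y
  have hz : z = ∑ k, ∑ l, TensorProduct.map (B.Wmap (j k)) (B.Wmap (j' l))
      (TensorProduct.map (B.Wmap (p k)) (B.Wmap (p' l)) z) := by
    have h1 : ∀ k l, TensorProduct.map (B.Wmap (j k)) (B.Wmap (j' l))
        (TensorProduct.map (B.Wmap (p k)) (B.Wmap (p' l)) z) =
        TensorProduct.map (B.Wmap (p k ≫ j k)) (B.Wmap (p' l ≫ j' l)) z := by
      intro k l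
      rw [← LinearMap.comp_apply, ← TensorProduct.map_comp, ← Wmap_comp, ← Wmap_comp]
    simp_rw [h1]
    induction z with
    | zero => simp
    | add s t hs ht =>
      simp only [map_add, Finset.sum_add_distrib]
      rw [← hs, ← ht] <;> intros <;>
        rw [← LinearMap.comp_apply, ← TensorProduct.map_comp, ← Wmap_comp, ← Wmap_comp]
    | tmul x y =>
      simp only [TensorProduct.map_tmul, ← TensorProduct.tmul_sum, ← TensorProduct.sum_tmul,
        ← LinearMap.sum_apply, ← Wmap_sum, hpj, hpj', Wmap_id, LinearMap.id_apply]
  rw [hz]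
  simp only [map_sum]
  refine Finset.sum_congr rfl fun k _ => Finset.sum_congr rfl fun l _ => ?_
  rw [← act2_natural, ← mu_natural, ← Wmap_rep, nu_natural]
  congr 1
  generalize TensorProduct.map (B.Wmap (p k)) (B.Wmap (p' l)) z = y
  induction y with
  | zero => simp
  | add s t hs ht => simp only [map_add, hs, ht]
  | tmul x y => exact act2_comul_simple hU _ _ h x y

end Comul

/-! ### Coassociativity and multiplicativity of the comultiplication -/

section Bialgebra

/-- Two multiplicative actions on `M` and `N` give a multiplicative action on `M ⊗ N`. -/
lemma homTensorHomMap_map_mul {A A' M N : Type*} [Ring A] [Algebra ℂ A] [Ring A'] [Algebra ℂ A']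
    [AddCommGroup M] [Module ℂ M] [AddCommGroup N] [Module ℂ N]
    (φ : A →ₗ[ℂ] Module.End ℂ M) (hφ : ∀ a b, φ (a * b) = φ a ∘ₗ φ b)
    (ψ : A' →ₗ[ℂ] Module.End ℂ N) (hψ : ∀ a b, ψ (a * b) = ψ a ∘ₗ ψ b) (s t : A ⊗[ℂ] A') :
    TensorProduct.homTensorHomMap (RingHom.id ℂ) M N M N (TensorProduct.map φ ψ (s * t)) =
      TensorProduct.homTensorHomMap (RingHom.id ℂ) M N M N (TensorProduct.map φ ψ s) ∘ₗ
        TensorProduct.homTensorHomMap (RingHom.id ℂ) M N M N (TensorProduct.map φ ψ t) := by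
  induction s with
  | zero => simp
  | add s s' hs hs' => simp only [add_mul, map_add, hs, hs', LinearMap.add_comp]
  | tmul a b =>
    induction t with
    | zero => simp
    | add t t' ht ht' => simp only [mul_add, map_add, ht, ht', LinearMap.comp_add]
    | tmul c d =>
      simp only [Algebra.TensorProduct.tmul_mul_tmul, TensorProduct.map_tmul,
        TensorProduct.homTensorHomMap_apply, hφ, hψ, TensorProduct.map_comp]

variable {B}

lemma mu_act2_comul (hU : B.IsUnitary) {X Y : C} (h : B.H) (z : B.W X ⊗[ℂ] B.W Y) :
    B.mu X Y (B.act2 X Y (B.comul h) z) = B.rep (X ⊗ Y) h (B.mu X Y z) := by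
  rw [act2_comul hU, mu_nu]

lemma act2_comul_balance (hU : B.IsUnitary) {X Y : C} (h : B.H) (z : B.W X ⊗[ℂ] B.W Y) :
    B.act2 X Y (B.comul h) (B.balance X Y z) = B.act2 X Y (B.comul h) z := by
  rw [act2_comul hU, act2_comul hU, mu_balance]

lemma act2_comul_one (hU : B.IsUnitary) {X Y : C} (z : B.W X ⊗[ℂ] B.W Y) :
    B.act2 X Y (B.comul 1) z = B.balance X Y z := by
  rw [act2_comul hU, map_one, Module.End.one_apply, nu_mu]

/-- Both sides act on `W X ⊗ W Y` as `a b` on `W (X ⊗ Y)`, because `mu ∘ nu = id`. -/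
lemma comul_mul (hU : B.IsUnitary) (a b : B.H) : B.comul (a * b) = B.comul a * B.comul b := by
  refine act2_ext fun i j x y => ?_
  rw [act2_mul, act2_comul hU, act2_comul hU, act2_comul hU, mu_nu, map_mul]
  rfl

variable (B) in
/-- The action of `(H_𝒞 ⊗ H_𝒞) ⊗ H_𝒞` on `(W X ⊗ W Y) ⊗ W Z`. -/
def act3L (X Y Z : C) : (B.H ⊗[ℂ] B.H) ⊗[ℂ] B.H →ₗ[ℂ]
    Module.End ℂ ((B.W X ⊗[ℂ] B.W Y) ⊗[ℂ] B.W Z) :=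
  TensorProduct.homTensorHomMap (RingHom.id ℂ) _ _ _ _ ∘ₗ
    TensorProduct.map (B.act2 X Y) (B.rep Z).toLinearMap

@[simp] lemma act3L_tmul (X Y Z : C) (t : B.H ⊗[ℂ] B.H) (h : B.H) :
    B.act3L X Y Z (t ⊗ₜ h) = TensorProduct.map (B.act2 X Y t) (B.rep Z h) := by
  simp [act3L]

lemma act3_assoc (X Y Z : C) (t : (B.H ⊗[ℂ] B.H) ⊗[ℂ] B.H) (x : B.W X) (y : B.W Y) (z : B.W Z) :
    B.act3 X Y Z (TensorProduct.assoc ℂ _ _ _ t) (x ⊗ₜ (y ⊗ₜ z)) =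
      TensorProduct.assoc ℂ _ _ _ (B.act3L X Y Z t ((x ⊗ₜ y) ⊗ₜ z)) := by
  induction t with
  | zero => simp
  | add s t hs ht => simp only [map_add, LinearMap.add_apply, hs, ht]
  | tmul s h =>
    induction s with
    | zero => simp
    | add s t hs ht => simp only [TensorProduct.add_tmul, map_add, LinearMap.add_apply, hs, ht]
    | tmul a b => simp

lemma act3L_ext {s t : (B.H ⊗[ℂ] B.H) ⊗[ℂ] B.H}
    (H : ∀ i j k (x : B.W (B.X i)) (y : B.W (B.X j)) (z : B.W (B.X k)),
      B.act3L (B.X i) (B.X j) (B.X k) s ((x ⊗ₜ y) ⊗ₜ z) =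
        B.act3L (B.X i) (B.X j) (B.X k) t ((x ⊗ₜ y) ⊗ₜ z)) : s = t := by
  refine (TensorProduct.assoc ℂ B.H B.H B.H).injective (act3_ext fun i j k x y z => ?_)
  rw [act3_assoc, act3_assoc, H]

lemma act3L_mul (X Y Z : C) (s t : (B.H ⊗[ℂ] B.H) ⊗[ℂ] B.H)
    (w : (B.W X ⊗[ℂ] B.W Y) ⊗[ℂ] B.W Z) :
    B.act3L X Y Z (s * t) w = B.act3L X Y Z s (B.act3L X Y Z t w) :=
  LinearMap.congr_fun (homTensorHomMap_map_mul (B.act2 X Y)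
    (fun a b => LinearMap.ext fun z => act2_mul X Y a b z) (B.rep Z).toLinearMap
    (fun a b => map_mul (B.rep Z) a b) s t) w

lemma act3L_comul_left (hU : B.IsUnitary) (X Y Z : C) (t : B.H ⊗[ℂ] B.H)
    (w : (B.W X ⊗[ℂ] B.W Y) ⊗[ℂ] B.W Z) :
    B.act3L X Y Z (B.comul.rTensor _ t) w =
      (B.nu X Y).rTensor _ (B.act2 (X ⊗ Y) Z t ((B.mu X Y).rTensor _ w)) := by
  induction t with
  | zero => simp
  | add s t hs ht => simp only [map_add, LinearMap.add_apply, hs, ht]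
  | tmul a b =>
    induction w with
    | zero => simp
    | add s t hs ht => simp only [map_add, hs, ht]
    | tmul w z => simp [act2_comul hU]

lemma act3_comul_right (hU : B.IsUnitary) (X Y Z : C) (t : B.H ⊗[ℂ] B.H)
    (w : B.W X ⊗[ℂ] (B.W Y ⊗[ℂ] B.W Z)) :
    B.act3 X Y Z (B.comul.lTensor _ t) w =
      (B.nu Y Z).lTensor _ (B.act2 X (Y ⊗ Z) t ((B.mu Y Z).lTensor _ w)) := by
  induction t with
  | zero => simp
  | add s t hs ht => simp only [map_add, LinearMap.add_apply, hs, ht]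
  | tmul a b =>
    induction w with
    | zero => simp
    | add s t hs ht => simp only [map_add, hs, ht]
    | tmul w z => simp [act2_comul hU]

lemma nu_balance_left {X Y Z : C} (x : B.W X) (y : B.W Y) (z : B.W Z) :
    (B.nu X Y).rTensor _ (B.balance (X ⊗ Y) Z (B.mu X Y (x ⊗ₜ y) ⊗ₜ z)) =
      ∑ b, ∑ a, ((B.idem a ≫ x) ⊗ₜ[ℂ] ((B.idem b ≫ y) ≫ B.idem a ▷ Y)) ⊗ₜ[ℂ]
        (z ≫ B.idem b ▷ Z) := by
  rw [balance_tmul, map_sum]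
  refine Finset.sum_congr rfl fun b _ => ?_
  have h : B.idem b ≫ B.mu X Y (x ⊗ₜ y) = B.mu X Y (x ⊗ₜ (B.idem b ≫ y)) := by simp
  rw [LinearMap.rTensor_tmul, h, nu_mu, balance_tmul, TensorProduct.sum_tmul]

lemma nu_balance_right {X Y Z : C} (x : B.W X) (y : B.W Y) (z : B.W Z) :
    (B.nu Y Z).lTensor _ (B.balance X (Y ⊗ Z) (x ⊗ₜ B.mu Y Z (y ⊗ₜ z))) =
      ∑ a, ∑ b, (B.idem a ≫ x) ⊗ₜ[ℂ] ((B.idem b ≫ (y ≫ B.idem a ▷ Y)) ⊗ₜ[ℂ]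
        (z ≫ B.idem b ▷ Z)) := by
  rw [balance_tmul, map_sum]
  refine Finset.sum_congr rfl fun a _ => ?_
  have h : B.mu Y Z (y ⊗ₜ z) ≫ B.idem a ▷ (Y ⊗ Z) =
      B.mu Y Z ((y ≫ B.idem a ▷ Y) ⊗ₜ z) := by simp
  rw [LinearMap.lTensor_tmul, h, nu_mu, balance_tmul, TensorProduct.tmul_sum]

/-- The coassociativity of `nu`. -/
lemma nu_assoc {X Y Z : C} (f : B.W ((X ⊗ Y) ⊗ Z)) :
    (B.nu Y Z).lTensor _ (B.nu X (Y ⊗ Z) (B.Wmap (α_ X Y Z).hom f)) =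
      TensorProduct.assoc ℂ _ _ _ ((B.nu X Y).rTensor _ (B.nu (X ⊗ Y) Z f)) := by
  obtain ⟨s, rfl⟩ := B.mu_surjective (X ⊗ Y) Z f
  obtain ⟨t, rfl⟩ := LinearMap.rTensor_surjective (B.W Z) (B.mu_surjective X Y) s
  rw [mu_assoc, nu_mu, nu_mu]
  induction t with
  | zero => simp
  | add s t hs ht => simp only [map_add, hs, ht]
  | tmul t z =>
    induction t with
    | zero => simp
    | add s t hs ht => simp only [TensorProduct.add_tmul, map_add, hs, ht]
    | tmul x y =>
      rw [TensorProduct.assoc_tmul, LinearMap.lTensor_tmul, LinearMap.rTensor_tmul,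
        nu_balance_left, nu_balance_right, Finset.sum_comm]
      simp

lemma comul_coassoc (hU : B.IsUnitary) (h : B.H) :
    TensorProduct.assoc ℂ B.H B.H B.H (B.comul.rTensor _ (B.comul h)) =
      B.comul.lTensor _ (B.comul h) := by
  refine act3_ext fun i j k x y z => ?_
  rw [act3_assoc, act3L_comul_left hU, act3_comul_right hU, act2_comul hU, act2_comul hU,
    ← nu_assoc, Wmap_rep, mu_assoc]
  simp

lemma act3L_comul_one (hU : B.IsUnitary) {X Y Z : C} (x : B.W X) (y : B.W Y) (z : B.W Z) :
    B.act3L X Y Z (B.comul.rTensor _ (B.comul 1)) ((x ⊗ₜ y) ⊗ₜ z) =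
      ∑ b, ∑ a, ((B.idem a ≫ x) ⊗ₜ[ℂ] ((B.idem b ≫ y) ≫ B.idem a ▷ Y)) ⊗ₜ[ℂ]
        (z ≫ B.idem b ▷ Z) := by
  rw [act3L_comul_left hU, act2_comul_one hU, LinearMap.rTensor_tmul, nu_balance_left]

lemma act3L_assoc_symm {X Y Z : C} (t : B.H ⊗[ℂ] B.H) (x : B.W X) (y : B.W Y) (z : B.W Z) :
    B.act3L X Y Z ((TensorProduct.assoc ℂ _ _ _).symm (1 ⊗ₜ t)) ((x ⊗ₜ y) ⊗ₜ z) =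
      (TensorProduct.assoc ℂ _ _ _).symm (x ⊗ₜ B.act2 Y Z t (y ⊗ₜ z)) := by
  induction t with
  | zero => simp
  | add s t hs ht => simp only [TensorProduct.tmul_add, map_add, LinearMap.add_apply, hs, ht]
  | tmul a b => simp

lemma comul_one_left' (hU : B.IsUnitary) : B.comul.rTensor B.H (B.comul 1) =
    (B.comul 1 ⊗ₜ[ℂ] (1 : B.H)) * (TensorProduct.assoc ℂ _ _ _).symm
      ((1 : B.H) ⊗ₜ[ℂ] B.comul 1) := by
  refine act3L_ext fun i j k x y z => ?_
  rw [act3L_comul_one hU, act3L_mul, act3L_assoc_symm, act2_comul_one hU, balance_tmul]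
  simp only [TensorProduct.tmul_sum, map_sum, TensorProduct.assoc_symm_tmul, act3L_tmul,
    TensorProduct.map_tmul, act2_comul_one hU, map_one, Module.End.one_apply, balance_tmul,
    TensorProduct.sum_tmul]

lemma comul_one_right' (hU : B.IsUnitary) : B.comul.rTensor B.H (B.comul 1) =
    (TensorProduct.assoc ℂ _ _ _).symm ((1 : B.H) ⊗ₜ[ℂ] B.comul 1) *
      (B.comul 1 ⊗ₜ[ℂ] (1 : B.H)) := by
  refine act3L_ext fun i j k x y z => ?_
  rw [act3L_comul_one hU, act3L_mul, act3L_tmul, TensorProduct.map_tmul, act2_comul_one hU,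
    balance_tmul, Finset.sum_comm]
  simp only [map_one, Module.End.one_apply, TensorProduct.sum_tmul, map_sum, act3L_assoc_symm,
    act2_comul_one hU, balance_tmul, TensorProduct.tmul_sum, TensorProduct.assoc_symm_tmul,
    Category.assoc]

end Bialgebra

/-! ### The counit -/

section QuantumDimension

lemma dagger_id (X : C) : UnitaryFusionCategory.dagger (𝟙 X) = 𝟙 X := by
  have h := UnitaryFusionCategory.dagger_comp (𝟙 X) (UnitaryFusionCategory.dagger (𝟙 X))
  rw [Category.id_comp, UnitaryFusionCategory.dagger_dagger, Category.id_comp] at h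
  exact h.symm

lemma unitScalar_smul_id (c : ℂ) : unitScalar (c • 𝟙 (𝟙_ C)) = c :=
  smul_id_injective (unitScalar_smul _)

lemma unitScalar_comp (f g : 𝟙_ C ⟶ 𝟙_ C) :
    unitScalar (f ≫ g) = unitScalar f * unitScalar g := by
  refine smul_id_injective (X := 𝟙_ C) ?_
  rw [unitScalar_smul, mul_smul, unitScalar_smul]
  conv_lhs => rw [← unitScalar_smul f, Linear.smul_comp, Category.id_comp]

lemma unitScalar_id : unitScalar (𝟙 (𝟙_ C)) = 1 := by
  have := unitScalar_smul_id (C := C) 1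
  rwa [one_smul] at this

/-- For an isomorphism `f` to the unit, `f⁻¹ f⁻¹†` and `f† f` are inverse to each other. -/
lemma unitScalar_dagger_iso {X : C} (f : X ≅ 𝟙_ C) :
    unitScalar (f.inv ≫ UnitaryFusionCategory.dagger f.inv) *
      unitScalar (UnitaryFusionCategory.dagger f.hom ≫ f.hom) = 1 := by
  have h : UnitaryFusionCategory.dagger f.inv ≫ UnitaryFusionCategory.dagger f.hom = 𝟙 X := by
    rw [← UnitaryFusionCategory.dagger_comp, f.hom_inv_id, dagger_id]
  rw [← unitScalar_comp, Category.assoc, ← Category.assoc (UnitaryFusionCategory.dagger f.inv), h]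
  simp [unitScalar_id]

lemma smul_tensor_smul_unit (a b : ℂ) : (a • 𝟙 (𝟙_ C)) ⊗ₘ (b • 𝟙 (𝟙_ C)) =
    (a * b) • 𝟙 (𝟙_ C ⊗ 𝟙_ C) := by
  rw [MonoidalCategory.tensorHom_def]
  simp [smul_smul, mul_comm]

/-- The quantum dimension of the unit is `1`, whether or not the unit constraints are unitary. -/
lemma qdim_unit {X : C} [Simple X] (φ : X ≅ 𝟙_ C) : qdim X = 1 := by
  let ψ : Xᘁ ≅ 𝟙_ C := rightDualIso (X := X) inferInstance (exactPairingCongrLeft φ)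
  let l : 𝟙_ C ⊗ 𝟙_ C ≅ 𝟙_ C := λ_ (𝟙_ C)
  have e1 : ∀ f : 𝟙_ C ⟶ 𝟙_ C, unitScalar f • 𝟙 _ = f := unitScalar_smul
  -- the duality of `X` is, up to two scalars, the one transported from the unit
  obtain ⟨c, hc⟩ : ∃ c : ℂ, η_ X Xᘁ = c • (l.inv ≫ (φ.inv ⊗ₘ ψ.inv)) := by
    refine ⟨unitScalar (η_ X Xᘁ ≫ (φ.hom ⊗ₘ ψ.hom) ≫ l.hom), ?_⟩
    have h := congrArg (· ≫ l.inv ≫ (φ.inv ⊗ₘ ψ.inv)) (e1 (η_ X Xᘁ ≫ (φ.hom ⊗ₘ ψ.hom) ≫ l.hom))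
    simpa using h.symm
  obtain ⟨c', hc'⟩ : ∃ c' : ℂ, ε_ X Xᘁ = c' • ((ψ.hom ⊗ₘ φ.hom) ≫ l.hom) := by
    refine ⟨unitScalar (l.inv ≫ (ψ.inv ⊗ₘ φ.inv) ≫ ε_ X Xᘁ), ?_⟩
    have h := congrArg (((ψ.hom ⊗ₘ φ.hom) ≫ l.hom) ≫ ·) (e1 (l.inv ≫ (ψ.inv ⊗ₘ φ.inv) ≫ ε_ X Xᘁ))
    simpa using h.symm
  -- the scalars are inverse to each other by the zigzag identity
  have hcc : c * c' = 1 := by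
    have h := ExactPairing.evaluation_coevaluation X Xᘁ
    rw [hc, hc'] at h
    have h2 : (l.inv ≫ (φ.inv ⊗ₘ ψ.inv)) ▷ X ≫ (α_ X Xᘁ X).hom ≫ X ◁ ((ψ.hom ⊗ₘ φ.hom) ≫ l.hom) =
        (λ_ X).hom ≫ (ρ_ X).inv := by
      have h3 : ψ.inv ▷ X ≫ (ψ.hom ⊗ₘ φ.hom) = 𝟙_ C ◁ φ.hom := by
        rw [← tensorHom_id, tensorHom_comp_tensorHom]; simp
      have h4 : (φ.inv ⊗ₘ ψ.inv) ▷ X ≫ (α_ X Xᘁ X).hom ≫ X ◁ (ψ.hom ⊗ₘ φ.hom) =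
          (α_ _ _ _).hom ≫ 𝟙_ C ◁ 𝟙_ C ◁ φ.hom ≫ φ.inv ▷ (𝟙_ C ⊗ 𝟙_ C) := by
        rw [MonoidalCategory.tensorHom_def' φ.inv, comp_whiskerRight, Category.assoc,
          associator_naturality_left_assoc, associator_naturality_middle_assoc, ← whisker_exchange,
          ← MonoidalCategory.whiskerLeft_comp_assoc, h3]
      have h5 : φ.inv ▷ (𝟙_ C) = (ρ_ _).hom ≫ φ.inv ≫ (ρ_ X).inv := by
        rw [← cancel_mono (ρ_ X).hom]; simp
      calc _ = l.inv ▷ X ≫ ((φ.inv ⊗ₘ ψ.inv) ▷ X ≫ (α_ X Xᘁ X).hom ≫ X ◁ (ψ.hom ⊗ₘ φ.hom)) ≫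
            X ◁ l.hom := by simp
        _ = (λ_ (𝟙_ C)).inv ▷ X ≫ (α_ _ _ _).hom ≫ 𝟙_ C ◁ (𝟙_ C ◁ φ.hom ≫ (λ_ _).hom) ≫
            φ.inv ▷ 𝟙_ C := by
          rw [h4]
          simp only [l, Category.assoc, MonoidalCategory.whiskerLeft_comp]
          rw [← whisker_exchange]
        _ = (λ_ X).hom ≫ (φ.hom ≫ φ.inv) ≫ (ρ_ X).inv := by
          have h6 : (λ_ (𝟙_ C)).inv ≫ (ρ_ (𝟙_ C)).hom = 𝟙 _ := by rw [← unitors_equal]; simp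
          rw [h5, leftUnitor_naturality]
          simp only [MonoidalCategory.whiskerLeft_comp, Category.assoc, id_whiskerLeft,
            leftUnitor_inv_whiskerRight, Iso.inv_hom_id_assoc, Iso.hom_inv_id_assoc]
          rw [← Category.assoc (λ_ (𝟙_ C)).inv, h6, Category.id_comp, Iso.hom_inv_id_assoc]
        _ = _ := by simp
    simp only [MonoidalLinear.smul_whiskerRight, MonoidalLinear.whiskerLeft_smul, Linear.smul_comp,
      Linear.comp_smul, smul_smul, h2] at h
    have h4 := congrArg (fun k => (λ_ X).inv ≫ k ≫ (ρ_ X).hom) h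
    simp only [Linear.smul_comp, Linear.comp_smul, Category.assoc, Iso.inv_hom_id_assoc,
      Iso.inv_hom_id] at h4
    rw [mul_comm]
    refine smul_id_injective (X := X) ?_
    rw [h4, one_smul]
  have h1 : unitScalar (η_ X Xᘁ ≫ UnitaryFusionCategory.dagger (η_ X Xᘁ)) =
      (c * star c) * (unitScalar (φ.inv ≫ UnitaryFusionCategory.dagger φ.inv) *
        unitScalar (ψ.inv ≫ UnitaryFusionCategory.dagger ψ.inv) *
        unitScalar (l.inv ≫ UnitaryFusionCategory.dagger l.inv)) := by
    refine smul_id_injective (X := 𝟙_ C) ?_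
    rw [unitScalar_smul, hc, UnitaryFusionCategory.dagger_smul, UnitaryFusionCategory.dagger_comp,
      UnitaryFusionCategory.dagger_tensor]
    have h2 : (l.inv ≫ (φ.inv ⊗ₘ ψ.inv)) ≫ (UnitaryFusionCategory.dagger φ.inv ⊗ₘ
        UnitaryFusionCategory.dagger ψ.inv) ≫ UnitaryFusionCategory.dagger l.inv =
        l.inv ≫ ((φ.inv ≫ UnitaryFusionCategory.dagger φ.inv) ⊗ₘ
          (ψ.inv ≫ UnitaryFusionCategory.dagger ψ.inv)) ≫ UnitaryFusionCategory.dagger l.inv := by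
      simp
    rw [Linear.smul_comp, Linear.comp_smul, h2, ← e1 (φ.inv ≫ _), ← e1 (ψ.inv ≫ _),
      smul_tensor_smul_unit, Linear.smul_comp, Linear.comp_smul, Category.id_comp]
    conv_lhs => rw [← e1 (l.inv ≫ _)]
    simp only [smul_smul, unitScalar_smul_id]
    congr 1; ring
  have h2 : unitScalar (UnitaryFusionCategory.dagger (ε_ X Xᘁ) ≫ ε_ X Xᘁ) =
      (c' * star c') * (unitScalar (UnitaryFusionCategory.dagger φ.hom ≫ φ.hom) *
        unitScalar (UnitaryFusionCategory.dagger ψ.hom ≫ ψ.hom) *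
        unitScalar (UnitaryFusionCategory.dagger l.hom ≫ l.hom)) := by
    refine smul_id_injective (X := 𝟙_ C) ?_
    rw [unitScalar_smul, hc', UnitaryFusionCategory.dagger_smul, UnitaryFusionCategory.dagger_comp,
      UnitaryFusionCategory.dagger_tensor]
    have h2 : (UnitaryFusionCategory.dagger l.hom ≫ (UnitaryFusionCategory.dagger ψ.hom ⊗ₘ
        UnitaryFusionCategory.dagger φ.hom)) ≫ (ψ.hom ⊗ₘ φ.hom) ≫ l.hom =
        UnitaryFusionCategory.dagger l.hom ≫ ((UnitaryFusionCategory.dagger ψ.hom ≫ ψ.hom) ⊗ₘ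
          (UnitaryFusionCategory.dagger φ.hom ≫ φ.hom)) ≫ l.hom := by
      simp
    rw [Linear.smul_comp, Linear.comp_smul, h2, ← e1 (_ ≫ φ.hom), ← e1 (_ ≫ ψ.hom),
      smul_tensor_smul_unit, Linear.smul_comp, Linear.comp_smul, Category.id_comp]
    conv_lhs => rw [← e1 (_ ≫ l.hom)]
    simp only [smul_smul, unitScalar_smul_id]
    congr 1; ring
  have h3 : unitScalar (η_ X Xᘁ ≫ UnitaryFusionCategory.dagger (η_ X Xᘁ)) *
      unitScalar (UnitaryFusionCategory.dagger (ε_ X Xᘁ) ≫ ε_ X Xᘁ) = 1 := by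
    have hφ := unitScalar_dagger_iso φ
    have hψ := unitScalar_dagger_iso ψ
    have hl := unitScalar_dagger_iso l
    have hs : star c * star c' = 1 := by rw [← star_mul', hcc, star_one]
    rw [h1, h2]
    linear_combination (unitScalar (φ.inv ≫ UnitaryFusionCategory.dagger φ.inv) *
      unitScalar (UnitaryFusionCategory.dagger φ.hom ≫ φ.hom) *
      (unitScalar (ψ.inv ≫ UnitaryFusionCategory.dagger ψ.inv) *
      unitScalar (UnitaryFusionCategory.dagger ψ.hom ≫ ψ.hom)) *
      (unitScalar (l.inv ≫ UnitaryFusionCategory.dagger l.inv) *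
      unitScalar (UnitaryFusionCategory.dagger l.hom ≫ l.hom))) * (c * c' * hs + hcc) +
      unitScalar (ψ.inv ≫ UnitaryFusionCategory.dagger ψ.inv) *
      unitScalar (UnitaryFusionCategory.dagger ψ.hom ≫ ψ.hom) *
      (unitScalar (l.inv ≫ UnitaryFusionCategory.dagger l.inv) *
      unitScalar (UnitaryFusionCategory.dagger l.hom ≫ l.hom)) * hφ +
      (unitScalar (l.inv ≫ UnitaryFusionCategory.dagger l.inv) *
      unitScalar (UnitaryFusionCategory.dagger l.hom ≫ l.hom)) * hψ + hl
  rw [qdim, ← norm_mul, h3]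
  simp

/-- This is what makes the unnormalised counit of `H_𝒞` a matrix coefficient. -/
lemma rtd_one : B.rtd B.one = 1 := by
  rw [rtd, qdim_unit B.oneIso, Real.sqrt_one]

end QuantumDimension

section Counit

variable {B}

lemma cw_unitVec (x : B.Idx B.one) : B.cw x (B.Wmap B.oneIso.inv B.unitVec) =
    if x.1 = x.2.1 then 1 else 0 := by
  obtain ⟨a, b, α⟩ := x
  have h : B.Wmap B.oneIso.inv B.unitVec ≫ vv (⟨a, b, α⟩ : B.Idx B.one) =
      B.prj a ≫ ((ρ_ (B.X a)).inv ≫ B.X a ◁ B.oneIso.inv ≫ B.vertex a B.one b α) ≫ B.inc b := by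
    simp only [Wmap_apply, unitVec, vv, Category.assoc]
    rw [whisker_exchange_assoc, ← rightUnitor_inv_naturality_assoc]
  rw [cw_apply, h]
  split_ifs with hab
  · change a = b at hab
    subst hab
    rw [B.vertex_one]
    simp only [← MonoidalCategory.whiskerLeft_comp_assoc, Iso.inv_hom_id,
      MonoidalCategory.whiskerLeft_id, Category.id_comp]
    exact coef_idem a
  · rw [prj_comp_inc _ _ _ hab, map_zero]

lemma lam_wv (x : B.Idx B.one) : B.lam (B.Wmap B.oneIso.hom (wv x)) =
    if x.1 = x.2.1 then 1 else 0 := by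
  obtain ⟨a, b, α⟩ := x
  have h : B.Wmap B.oneIso.hom (wv (⟨a, b, α⟩ : B.Idx B.one)) ≫ (ρ_ B.G).hom =
      B.prj b ≫ (B.dv a B.one b α ≫ B.X a ◁ B.oneIso.hom ≫ (ρ_ (B.X a)).hom) ≫ B.inc a := by
    simp only [Wmap_apply, wv, Category.assoc]
    rw [← whisker_exchange_assoc, rightUnitor_naturality]
  rw [lam_apply, h]
  split_ifs with hab
  · change a = b at hab
    subst hab
    rw [← B.vertex_one a α, dv_vertex_self, Category.id_comp]
    exact tr_idem a
  · rw [prj_comp_inc _ _ _ (Ne.symm hab), map_zero]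

/-- The counit is the matrix coefficient of the unit vector. -/
lemma counit_eq (h : B.H) : B.counit h = B.lam (B.rep (𝟙_ C) h B.unitVec) := by
  have h1 : B.rep (𝟙_ C) h B.unitVec =
      B.Wmap B.oneIso.hom (B.simpleAct B.one h (B.Wmap B.oneIso.inv B.unitVec)) := by
    rw [← rep_simple, Wmap_rep, ← LinearMap.comp_apply (B.Wmap B.oneIso.hom), ← Wmap_comp,
      Iso.inv_hom_id, Wmap_id, LinearMap.id_apply]
  rw [h1, simpleAct_apply]
  simp only [map_sum, map_smul, lam_wv, cw_unitVec, rtd_one]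
  change ∑ i, ∑ x : B.Idx i, ∑ y : B.Idx i, _ = _
  rw [Finset.sum_eq_single B.one]
  · refine Finset.sum_congr rfl fun x _ => Finset.sum_congr rfl fun y _ => ?_
    by_cases hx : x.1 = x.2.1 <;> by_cases hy : y.1 = y.2.1 <;> simp [hx, hy]
  · intro i _ hi
    simp [hi]
  · simp

lemma rep_counit_left {X : C} (t : B.H ⊗[ℂ] B.H) (x : B.W X) :
    B.rep X (TensorProduct.lid ℂ _ (B.counit.rTensor _ t)) x =
      TensorProduct.lid ℂ _ (B.lam.rTensor _ (B.act2 (𝟙_ C) X t (B.unitVec ⊗ₜ x))) := by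
  induction t with
  | zero => simp
  | add s t hs ht => simp only [map_add, LinearMap.add_apply, hs, ht]
  | tmul a b => simp [counit_eq]

lemma rep_counit_right {X : C} (t : B.H ⊗[ℂ] B.H) (x : B.W X) :
    B.rep X (TensorProduct.rid ℂ _ (B.counit.lTensor _ t)) x =
      TensorProduct.rid ℂ _ (B.lam.lTensor _ (B.act2 X (𝟙_ C) t (x ⊗ₜ B.unitVec))) := by
  induction t with
  | zero => simp
  | add s t hs ht => simp only [map_add, LinearMap.add_apply, hs, ht]
  | tmul a b => simp [counit_eq]

lemma act2_comul_unit_left (hU : B.IsUnitary) {X : C} (h : B.H) (x : B.W X) :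
    B.act2 (𝟙_ C) X (B.comul h) (B.unitVec ⊗ₜ x) =
      B.balance _ _ (B.unitVec ⊗ₜ B.rep X h x) := by
  rw [act2_comul hU, mu_unit_left, ← Wmap_rep, ← mu_unit_left, nu_mu]

lemma act2_comul_unit_right (hU : B.IsUnitary) {X : C} (h : B.H) (x : B.W X) :
    B.act2 X (𝟙_ C) (B.comul h) (x ⊗ₜ B.unitVec) =
      B.balance _ _ (B.rep X h x ⊗ₜ B.unitVec) := by
  rw [act2_comul hU, mu_unit_right, ← Wmap_rep, ← mu_unit_right, nu_mu]

lemma lam_balance_left {X : C} (f : B.W (𝟙_ C)) (x : B.W X) :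
    TensorProduct.lid ℂ _ (B.lam.rTensor _ (B.balance _ _ (f ⊗ₜ x))) =
      ∑ a, B.coef a (f ≫ (ρ_ B.G).hom) • (x ≫ B.idem a ▷ X) := by
  simp [balance_tmul, lam_idem_comp]

lemma lam_balance_unit_left {X : C} (x : B.W X) :
    TensorProduct.lid ℂ _ (B.lam.rTensor _ (B.balance _ _ (B.unitVec ⊗ₜ x))) = x := by
  simp only [lam_balance_left, unitVec, Iso.inv_hom_id, coef_id, one_smul]
  exact sum_rE x

lemma lam_balance_unit_right {X : C} (x : B.W X) :
    TensorProduct.rid ℂ _ (B.lam.lTensor _ (B.balance _ _ (x ⊗ₜ B.unitVec))) = x := by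
  simp only [balance_tmul, map_sum, LinearMap.lTensor_tmul, TensorProduct.rid_tmul, unit_comp_idem,
    lam_idem_unitVec, one_smul]
  exact sum_lE x

lemma counit_comul_left (hU : B.IsUnitary) (h : B.H) :
    TensorProduct.lid ℂ _ (B.counit.rTensor _ (B.comul h)) = h := by
  refine rep_ext fun i x => ?_
  rw [rep_counit_left, act2_comul_unit_left hU, lam_balance_unit_left]

lemma counit_comul_right (hU : B.IsUnitary) (h : B.H) :
    TensorProduct.rid ℂ _ (B.counit.lTensor _ (B.comul h)) = h := by
  refine rep_ext fun i x => ?_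
  rw [rep_counit_right, act2_comul_unit_right hU, lam_balance_unit_right]

lemma sum_lam_rep (a : B.H) (f : B.W (𝟙_ C)) :
    ∑ p, B.lam (B.rep _ a (B.idem p ≫ B.unitVec)) * B.lam (B.idem p ≫ f) =
      B.lam (B.rep _ a f) := by
  conv_rhs => rw [unit_eq_sum f]
  rw [map_sum, map_sum]
  refine Finset.sum_congr rfl fun p _ => ?_
  rw [map_smul, map_smul, lam_idem_comp, smul_eq_mul, mul_comm]

lemma counit_mul_left' (hU : B.IsUnitary) (a b c : B.H) : B.counit (a * b * c) =
    LinearMap.mul' ℂ ℂ (TensorProduct.map (B.counit ∘ₗ LinearMap.mulLeft ℂ a)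
      (B.counit ∘ₗ LinearMap.mulRight ℂ c) (B.comul b)) := by
  have h1 : ∀ t : B.H ⊗[ℂ] B.H, LinearMap.mul' ℂ ℂ (TensorProduct.map
      (B.counit ∘ₗ LinearMap.mulLeft ℂ a) (B.counit ∘ₗ LinearMap.mulRight ℂ c) t) =
      LinearMap.mul' ℂ ℂ (TensorProduct.map (B.lam ∘ₗ B.rep _ a) B.lam
        (B.act2 _ _ t (B.unitVec ⊗ₜ B.rep _ c B.unitVec))) := by
    intro t
    induction t with
    | zero => simp
    | add s t hs ht => simp only [map_add, LinearMap.add_apply, hs, ht]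
    | tmul p q => simp [counit_eq]
  rw [h1, act2_comul_unit_left hU, balance_tmul, map_sum, map_sum, counit_eq, map_mul, map_mul,
    Module.End.mul_apply, Module.End.mul_apply, ← Module.End.mul_apply, ← map_mul,
    map_mul, Module.End.mul_apply, ← sum_lam_rep]
  refine Finset.sum_congr rfl fun p _ => ?_
  rw [unit_comp_idem]
  simp

lemma counit_mul_right' (hU : B.IsUnitary) (a b c : B.H) : B.counit (a * b * c) =
    LinearMap.mul' ℂ ℂ (TensorProduct.map (B.counit ∘ₗ LinearMap.mulRight ℂ c)
      (B.counit ∘ₗ LinearMap.mulLeft ℂ a) (B.comul b)) := by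
  have h1 : ∀ t : B.H ⊗[ℂ] B.H, LinearMap.mul' ℂ ℂ (TensorProduct.map
      (B.counit ∘ₗ LinearMap.mulRight ℂ c) (B.counit ∘ₗ LinearMap.mulLeft ℂ a) t) =
      LinearMap.mul' ℂ ℂ (TensorProduct.map B.lam (B.lam ∘ₗ B.rep _ a)
        (B.act2 _ _ t (B.rep _ c B.unitVec ⊗ₜ B.unitVec))) := by
    intro t
    induction t with
    | zero => simp
    | add s t hs ht => simp only [map_add, LinearMap.add_apply, hs, ht]
    | tmul p q => simp [counit_eq]
  rw [h1, act2_comul_unit_right hU, balance_tmul, map_sum, map_sum, counit_eq, mul_assoc, map_mul,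
    Module.End.mul_apply, map_mul, Module.End.mul_apply, ← sum_lam_rep]
  refine Finset.sum_congr rfl fun p _ => ?_
  rw [unit_comp_idem]
  simp [mul_comm]

/-- The action of `ε(η₍₁₎ h) η₍₂₎`. -/
lemma rep_target (hU : B.IsUnitary) {X : C} (h : B.H) (x : B.W X) :
    B.rep X (TensorProduct.lid ℂ _ (B.counit.rTensor _ (B.comul 1 * (h ⊗ₜ[ℂ] 1)))) x =
      ∑ a, B.coef a (B.rep (𝟙_ C) h B.unitVec ≫ (ρ_ B.G).hom) • (x ≫ B.idem a ▷ X) := by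
  rw [rep_counit_left, act2_mul, act2_comul_one hU, act2_tmul, TensorProduct.map_tmul,
    lam_balance_left, map_one, Module.End.one_apply]

/-- The action of `η₍₁₎ ε(h η₍₂₎)`. -/
lemma rep_source (hU : B.IsUnitary) {X : C} (h : B.H) (x : B.W X) :
    B.rep X (TensorProduct.rid ℂ _ (B.counit.lTensor _ ((1 ⊗ₜ[ℂ] h) * B.comul 1))) x =
      ∑ a, B.lam (B.rep (𝟙_ C) h (B.idem a ≫ B.unitVec)) • (B.idem a ≫ x) := by
  rw [rep_counit_right, act2_mul, act2_comul_one hU, balance_tmul]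
  simp only [unit_comp_idem, map_sum, act2_tmul, TensorProduct.map_tmul, map_one,
    Module.End.one_apply, LinearMap.lTensor_tmul, TensorProduct.rid_tmul]

end Counit

/-! ### The antipode -/

section Antipode

variable {B}

/-- The evaluation of `W Xᘁ` against `W X`, with values in `End(G)`. -/
def evalEnd {X : C} (f : B.W Xᘁ) (g : B.W X) : B.G ⟶ B.G :=
  g ≫ f ▷ X ≫ (α_ B.G Xᘁ X).hom ≫ B.G ◁ ε_ X Xᘁ ≫ (ρ_ B.G).hom

variable (B) in
/-- The pairing of `W Xᘁ` with `W X`. -/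
def pairing (X : C) : B.W Xᘁ ⊗[ℂ] B.W X →ₗ[ℂ] ℂ :=
  B.lam ∘ₗ B.Wmap (ε_ X Xᘁ) ∘ₗ B.mu Xᘁ X

lemma pairing_tmul {X : C} (f : B.W Xᘁ) (g : B.W X) :
    B.pairing X (f ⊗ₜ g) = B.tr (evalEnd f g) := by
  simp [pairing, lam_apply, evalEnd, Wmap_apply]

variable (B) in
/-- The canonical element of `W X ⊗ W Xᘁ`, the image of the unit vector under the coevaluation. -/
def canon (X : C) : B.W X ⊗[ℂ] B.W Xᘁ := B.nu _ _ (B.Wmap (η_ X Xᘁ) B.unitVec)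

lemma balance_canon (X : C) : B.balance _ _ (B.canon X) = B.canon X := balance_nu _

variable (B) in
/-- Contraction of an element of `W X ⊗ W Xᘁ` with a functional on `W Xᘁ`. -/
def contr (X : C) (φ : B.W Xᘁ →ₗ[ℂ] ℂ) : B.W X ⊗[ℂ] B.W Xᘁ →ₗ[ℂ] B.W X :=
  (TensorProduct.rid ℂ _).toLinearMap ∘ₗ φ.lTensor _

@[simp] lemma contr_tmul {X : C} (φ : B.W Xᘁ →ₗ[ℂ] ℂ) (k : B.W X) (f : B.W Xᘁ) :
    B.contr X φ (k ⊗ₜ f) = φ f • k := by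
  simp [contr]

lemma contr_add {X : C} (φ ψ : B.W Xᘁ →ₗ[ℂ] ℂ) :
    B.contr X (φ + ψ) = B.contr X φ + B.contr X ψ := by
  simp [contr, LinearMap.lTensor_add, LinearMap.comp_add]

lemma contr_smul {X : C} (c : ℂ) (φ : B.W Xᘁ →ₗ[ℂ] ℂ) :
    B.contr X (c • φ) = c • B.contr X φ := by
  simp [contr, LinearMap.lTensor_smul, LinearMap.comp_smul]

lemma contr_sum {X : C} {κ : Type*} (s : Finset κ) (φ : κ → (B.W Xᘁ →ₗ[ℂ] ℂ))
    (t : B.W X ⊗[ℂ] B.W Xᘁ) :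
    B.contr X (∑ k ∈ s, φ k) t = ∑ k ∈ s, B.contr X (φ k) t := by
  induction t with
  | zero => simp
  | add s t hs ht => simp only [map_add, hs, ht, Finset.sum_add_distrib]
  | tmul x y => simp [Finset.sum_smul]

variable (B) in
/-- The functional `f ↦ ⟨f, g⟩`. -/
def pairL (X : C) (g : B.W X) : B.W Xᘁ →ₗ[ℂ] ℂ :=
  B.pairing X ∘ₗ (TensorProduct.mk ℂ _ _).flip g

lemma pairL_apply {X : C} (g : B.W X) (f : B.W Xᘁ) : B.pairL X g f = B.pairing X (f ⊗ₜ g) := rfl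

/-- The zigzag identity for the canonical element, which is therefore inverse to the pairing. -/
lemma contr_canon {X : C} (g : B.W X) : B.contr X (B.pairL X g) (B.canon X) = g := by
  -- contraction with values in the bimodule `W X`, without the trace
  let Φ : B.W X ⊗[ℂ] B.W Xᘁ →ₗ[ℂ] B.W X :=
    Linear.leftComp ℂ _ g ∘ₗ Linear.rightComp ℂ _ ((α_ B.G X Xᘁ).inv ▷ X ≫
      (α_ (B.G ⊗ X) Xᘁ X).hom ≫ (B.G ⊗ X) ◁ ε_ X Xᘁ ≫ (ρ_ (B.G ⊗ X)).hom) ∘ₗ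
      { toFun := fun f => f ▷ X
        map_add' := by simp
        map_smul' := by simp } ∘ₗ B.mu X Xᘁ
  have hΦ : ∀ k f, Φ (k ⊗ₜ f) = evalEnd f g ≫ k := by
    intro k f
    have h1 : k ▷ Xᘁ ▷ X ≫ (α_ (B.G ⊗ X) Xᘁ X).hom ≫ (B.G ⊗ X) ◁ ε_ X Xᘁ ≫ (ρ_ (B.G ⊗ X)).hom =
        (α_ B.G Xᘁ X).hom ≫ B.G ◁ ε_ X Xᘁ ≫ (ρ_ B.G).hom ≫ k := by
      rw [associator_naturality_left_assoc, ← whisker_exchange_assoc, rightUnitor_naturality]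
    simp only [Φ, LinearMap.comp_apply, Linear.leftComp_apply, Linear.rightComp_apply,
      LinearMap.coe_mk, AddHom.coe_mk, mu_tmul, comp_whiskerRight, Category.assoc, evalEnd]
    rw [← comp_whiskerRight_assoc (α_ B.G X Xᘁ).hom, Iso.hom_inv_id, id_whiskerRight,
      Category.id_comp, h1]
  have h1 : ∀ t, B.contr X (B.pairL X g) (B.balance _ _ t) = Φ t := by
    intro t
    induction t with
    | zero => simp
    | add s t hs ht => simp only [map_add, hs, ht]
    | tmul k f =>
      have h2 : ∀ a, evalEnd (f ≫ B.idem a ▷ Xᘁ) g = evalEnd f g ≫ B.idem a := by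
        intro a
        simp only [evalEnd, comp_whiskerRight, Category.assoc]
        rw [associator_naturality_left_assoc, ← whisker_exchange_assoc, rightUnitor_naturality]
      rw [balance_tmul, map_sum, hΦ]
      simp only [contr_tmul, pairL_apply, pairing_tmul, h2, tr_comp_idem]
      simp_rw [← Linear.smul_comp]
      rw [← Preadditive.sum_comp, ← eq_sum_idem]
  rw [← balance_canon, h1]
  have h3 : B.mu _ _ (B.canon X) = B.Wmap (η_ X Xᘁ) B.unitVec := mu_nu _
  have h4 : (B.Wmap (η_ X Xᘁ) B.unitVec) ▷ X ≫ (α_ B.G X Xᘁ).inv ▷ X ≫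
      (α_ (B.G ⊗ X) Xᘁ X).hom ≫ (B.G ⊗ X) ◁ ε_ X Xᘁ ≫ (ρ_ (B.G ⊗ X)).hom = 𝟙 _ := by
    have h : B.G ◁ ((λ_ X).inv ≫ (η_ X Xᘁ ▷ X ≫ (α_ X Xᘁ X).hom ≫ X ◁ ε_ X Xᘁ) ≫ (ρ_ X).hom) =
        𝟙 _ := by
      rw [ExactPairing.evaluation_coevaluation]; simp
    simp only [MonoidalCategory.whiskerLeft_comp, Category.assoc] at h
    rw [← h, ← Iso.inv_hom_id_assoc (α_ B.G X (𝟙_ C)) (B.G ◁ (ρ_ X).hom), ← rightUnitor_tensor_hom]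
    simp [Wmap_apply, unitVec, -whiskerLeft_rightUnitor]
  simp only [Φ, LinearMap.comp_apply, h3, Linear.leftComp_apply, Linear.rightComp_apply,
      LinearMap.coe_mk, AddHom.coe_mk]
  rw [h4, Category.comp_id]

variable (B) in
/-- The transpose, for the pairing of `W Xᘁ` with `W X`, of the action of `H_𝒞` on `W Xᘁ`: it
sends `g` to the vector of `W X` that represents the functional `f ↦ ⟨h f, g⟩`. -/
def antiRep (X : C) (h : B.H) : Module.End ℂ (B.W X) where
  toFun g := B.contr X (B.pairL X g ∘ₗ B.rep Xᘁ h) (B.canon X)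
  map_add' g g' := by
    have : B.pairL X (g + g') = B.pairL X g + B.pairL X g' := by
      ext f; simp [pairL_apply, TensorProduct.tmul_add]
    rw [this, LinearMap.add_comp, contr_add]; rfl
  map_smul' c g := by
    have : B.pairL X (c • g) = c • B.pairL X g := by
      ext f; simp [pairL_apply, TensorProduct.tmul_smul]
    rw [this, LinearMap.smul_comp, contr_smul]; rfl

lemma antiRep_apply (X : C) (h : B.H) (g : B.W X) :
    B.antiRep X h g = B.contr X (B.pairL X g ∘ₗ B.rep Xᘁ h) (B.canon X) := rfl

lemma antiRep_add (X : C) (h h' : B.H) : B.antiRep X (h + h') = B.antiRep X h + B.antiRep X h' := by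
  ext1 g
  rw [LinearMap.add_apply, antiRep_apply, antiRep_apply, antiRep_apply, map_add, LinearMap.comp_add,
    contr_add]; rfl

lemma antiRep_smul (X : C) (c : ℂ) (h : B.H) : B.antiRep X (c • h) = c • B.antiRep X h := by
  ext1 g
  rw [LinearMap.smul_apply, antiRep_apply, antiRep_apply, map_smul, LinearMap.comp_smul,
    contr_smul]; rfl

variable (B) in
/-- The antipode of `H_𝒞`, determined by its action on the fibres at the simple objects. -/
def antipode : B.H →ₗ[ℂ] B.H where
  toFun h i := (B.rtd i : ℂ) • LinearMap.toMatrix (B.wB i) (B.wB i) (B.antiRep (B.X i) h)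
  map_add' g h := by
    funext i; rw [antiRep_add, map_add, smul_add]; rfl
  map_smul' c h := by
    funext i; rw [antiRep_smul, map_smul, smul_comm]; rfl

lemma rep_antipode (i : ι) (h : B.H) (g : B.W (B.X i)) :
    B.rep (B.X i) (B.antipode h) g = B.antiRep (B.X i) h g := by
  rw [rep_simple]
  change ((B.rtd i : ℂ)⁻¹ • Matrix.toLin (B.wB i) (B.wB i) ((B.rtd i : ℂ) •
    LinearMap.toMatrix (B.wB i) (B.wB i) (B.antiRep (B.X i) h))) g = _
  rw [map_smul, smul_smul, inv_mul_cancel₀ (B.rtd_ne i), one_smul, Matrix.toLin_toMatrix]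

/-- `S(h₍₁₎) h₍₂₎ = η₍₁₎ ε(h η₍₂₎)` -/
lemma antipode_mul' (hU : B.IsUnitary) (h : B.H) :
    LinearMap.mul' ℂ B.H (B.antipode.rTensor B.H (B.comul h)) =
      TensorProduct.rid ℂ B.H (B.counit.lTensor B.H ((1 ⊗ₜ[ℂ] h) * B.comul 1)) := by
  refine rep_ext fun i g => ?_
  have h1 : ∀ t : B.H ⊗[ℂ] B.H, B.rep (B.X i) (LinearMap.mul' ℂ B.H (B.antipode.rTensor B.H t)) g =
      B.contr _ (B.pairing _ ∘ₗ B.act2 _ _ t ∘ₗ (TensorProduct.mk ℂ _ _).flip g)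
        (B.canon (B.X i)) := by
    intro t
    induction t with
    | zero => simp [contr]
    | add s t hs ht =>
      simp only [map_add, LinearMap.add_apply, hs, ht, LinearMap.add_comp, LinearMap.comp_add,
        contr_add]
    | tmul p q =>
      rw [LinearMap.rTensor_tmul, LinearMap.mul'_apply, map_mul, Module.End.mul_apply, rep_antipode,
        antiRep_apply]
      congr 2
  have h2 : B.pairing _ ∘ₗ B.act2 _ _ (B.comul h) ∘ₗ (TensorProduct.mk ℂ _ _).flip g =
      ∑ a, B.lam (B.rep (𝟙_ C) h (B.idem a ≫ B.unitVec)) •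
        B.pairL (B.X i) (B.idem a ≫ g) := by
    ext f
    have h3 : ∀ a, B.pairL (B.X i) (B.idem a ≫ g) f = B.coef a (evalEnd f g) := by
      intro a
      rw [pairL_apply, pairing_tmul, ← tr_idem_comp]
      simp [evalEnd]
    have h4 : B.Wmap (ε_ (B.X i) (B.X i)ᘁ) (B.mu _ _ (f ⊗ₜ g)) ≫ (ρ_ B.G).hom = evalEnd f g := by
      simp [evalEnd, Wmap_apply]
    simp only [LinearMap.comp_apply, LinearMap.flip_apply, TensorProduct.mk_apply, pairing,
      mu_act2_comul hU, Wmap_rep]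
    rw [unit_eq_sum (B.Wmap (ε_ (B.X i) (B.X i)ᘁ) (B.mu _ _ (f ⊗ₜ g))), h4]
    simp only [map_sum, map_smul, LinearMap.sum_apply, LinearMap.smul_apply, h3, smul_eq_mul]
    exact Finset.sum_congr rfl fun a _ => mul_comm _ _
  rw [h1, rep_source hU, h2, contr_sum]
  refine Finset.sum_congr rfl fun a _ => ?_
  rw [contr_smul, LinearMap.smul_apply, contr_canon]

lemma nu_idem_comp {X Y : C} (a : ι) (f : B.W (X ⊗ Y)) :
    B.nu X Y (B.idem a ≫ f) = (B.lE a Y).lTensor _ (B.nu X Y f) := by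
  obtain ⟨n, p, j, -, hnu⟩ := B.exists_nu X
  rw [hnu, hnu]
  simp

/-- `h₍₁₎ S(h₍₂₎) = ε(η₍₁₎ h) η₍₂₎` -/
lemma mul_antipode' (hU : B.IsUnitary) (h : B.H) :
    LinearMap.mul' ℂ B.H (B.antipode.lTensor B.H (B.comul h)) =
      TensorProduct.lid ℂ B.H (B.counit.rTensor B.H (B.comul 1 * (h ⊗ₜ[ℂ] 1))) := by
  refine rep_ext fun i g => ?_
  have h1 : ∀ t : B.H ⊗[ℂ] B.H, B.rep (B.X i) (LinearMap.mul' ℂ B.H (B.antipode.lTensor B.H t)) g =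
      B.contr _ (B.pairL _ g) (B.act2 _ _ t (B.canon (B.X i))) := by
    intro t
    induction t with
    | zero => simp
    | add s t hs ht => simp only [map_add, LinearMap.add_apply, hs, ht]
    | tmul p q =>
      rw [LinearMap.lTensor_tmul, LinearMap.mul'_apply, map_mul, Module.End.mul_apply, rep_antipode,
        antiRep_apply]
      generalize B.canon (B.X i) = t
      induction t with
      | zero => simp
      | add s t hs ht => simp only [map_add, hs, ht]
      | tmul k f => simp
  have h2 : ∀ a, B.contr _ (B.pairL _ g) ((B.lE a _).lTensor _ (B.canon (B.X i))) =
      g ≫ B.idem a ▷ B.X i := by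
    intro a
    rw [← contr_canon (g ≫ B.idem a ▷ B.X i)]
    generalize B.canon (B.X i) = t
    induction t with
    | zero => simp
    | add s t hs ht => simp only [map_add, hs, ht]
    | tmul k f => simp [pairL_apply, pairing]
  have h3 : B.act2 _ _ (B.comul h) (B.canon (B.X i)) = ∑ a,
      B.coef a (B.rep (𝟙_ C) h B.unitVec ≫ (ρ_ B.G).hom) •
        (B.lE a _).lTensor _ (B.canon (B.X i)) := by
    have h4 : ∀ a, B.Wmap (η_ (B.X i) (B.X i)ᘁ) (B.idem a ≫ B.unitVec) =
        B.idem a ≫ B.Wmap (η_ (B.X i) (B.X i)ᘁ) B.unitVec := by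
      intro a; simp [Wmap_apply]
    rw [act2_comul hU, canon, mu_nu, ← Wmap_rep, unit_eq_sum (B.rep (𝟙_ C) h B.unitVec)]
    simp only [map_sum, map_smul, h4, nu_idem_comp]
    rw [← unit_eq_sum]
  rw [h1, h3, rep_target hU, map_sum]
  refine Finset.sum_congr rfl fun a _ => ?_
  rw [map_smul, h2]

/-- The canonical element is balanced over `End(G)`. -/
lemma rTensor_lE_canon (a : ι) (X : C) :
    (B.lE a X).rTensor _ (B.canon X) = (B.rE a Xᘁ).lTensor _ (B.canon X) := by
  rw [← balance_canon]
  generalize B.canon X = t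
  induction t with
  | zero => simp
  | add s t hs ht => simp only [map_add, hs, ht]
  | tmul k f =>
    simp only [balance_tmul, map_sum, LinearMap.rTensor_tmul, LinearMap.lTensor_tmul, lE_apply,
      rE_apply]
    refine Finset.sum_congr rfl fun b _ => ?_
    by_cases h : a = b
    · subst h
      rw [← Category.assoc, idem_idem, Category.assoc, ← comp_whiskerRight, idem_idem]
    · rw [← Category.assoc, idem_idem_of_ne h, Category.assoc, ← comp_whiskerRight,
        idem_idem_of_ne (Ne.symm h)]
      simp

/-- `S(h₍₁₎) h₍₂₎ S(h₍₃₎) = S(h)` -/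
lemma antipode_mul_antipode' (hU : B.IsUnitary) (h : B.H) :
    LinearMap.mul' ℂ B.H (TensorProduct.map (LinearMap.mul' ℂ B.H ∘ₗ B.antipode.rTensor B.H)
      B.antipode (B.comul.rTensor B.H (B.comul h))) = B.antipode h := by
  refine rep_ext fun i g => ?_
  let Θ : B.W (B.X i)ᘁ →ₗ[ℂ] B.W (𝟙_ C) ⊗[ℂ] B.W (B.X i)ᘁ :=
    B.balance _ _ ∘ₗ TensorProduct.mk ℂ _ _ B.unitVec
  let Λ : B.W (𝟙_ C) ⊗[ℂ] B.W (B.X i)ᘁ →ₗ[ℂ] B.W (B.X i)ᘁ :=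
    (TensorProduct.lid ℂ _).toLinearMap ∘ₗ B.lam.rTensor _
  have h1 : ∀ t : B.H ⊗[ℂ] B.H, B.rep (B.X i) (LinearMap.mul' ℂ B.H (TensorProduct.map
      (LinearMap.mul' ℂ B.H ∘ₗ B.antipode.rTensor B.H) B.antipode
        (B.comul.rTensor B.H t))) g =
      B.contr _ (B.pairL _ g ∘ₗ Λ ∘ₗ B.act2 _ _ t ∘ₗ Θ) (B.canon (B.X i)) := by
    intro t
    induction t with
    | zero => simp [contr]
    | add s t hs ht =>
      simp only [map_add, LinearMap.add_apply, hs, ht, LinearMap.add_comp, LinearMap.comp_add,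
        contr_add]
    | tmul p q =>
      have h2 : B.pairL _ g ∘ₗ Λ ∘ₗ B.act2 _ _ (p ⊗ₜ q) ∘ₗ Θ =
          ∑ a, B.lam (B.rep (𝟙_ C) p (B.idem a ≫ B.unitVec)) •
            (B.pairL _ g ∘ₗ B.rep _ q ∘ₗ B.rE a _) := by
        ext f
        simp [Θ, Λ, balance_tmul]
      rw [h2, contr_sum, LinearMap.rTensor_tmul, TensorProduct.map_tmul, LinearMap.mul'_apply,
        map_mul, Module.End.mul_apply, LinearMap.comp_apply, antipode_mul' hU, rep_source hU,
        rep_antipode, antiRep_apply]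
      refine Finset.sum_congr rfl fun a _ => ?_
      rw [contr_smul, LinearMap.smul_apply]
      congr 1
      have h3 : ∀ (φ : B.W (B.X i)ᘁ →ₗ[ℂ] ℂ) t, B.idem a ≫ B.contr _ φ t =
          B.contr _ φ ((B.lE a _).rTensor _ t) := by
        intro φ t
        induction t with
        | zero => simp
        | add s t hs ht => simp only [map_add, Preadditive.comp_add, hs, ht]
        | tmul k f => simp
      have h4 : ∀ (φ : B.W (B.X i)ᘁ →ₗ[ℂ] ℂ) t, B.contr _ φ ((B.rE a _).lTensor _ t) =
          B.contr _ (φ ∘ₗ B.rE a _) t := by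
        intro φ t
        induction t with
        | zero => simp
        | add s t hs ht => simp only [map_add, hs, ht]
        | tmul k f => simp
      rw [h3, rTensor_lE_canon, h4]
      rfl
  have h5 : Λ ∘ₗ B.act2 _ _ (B.comul h) ∘ₗ Θ = (B.rep _ h : Module.End ℂ (B.W (B.X i)ᘁ)) := by
    ext f
    simp only [Θ, Λ, LinearMap.comp_apply, TensorProduct.mk_apply, act2_comul_balance hU,
      act2_comul_unit_left hU]
    exact lam_balance_unit_left _
  rw [h1, h5, rep_antipode, antiRep_apply]

end Antipode

/-! ### The `C*`-quantum groupoid -/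

section Groupoid

variable {B}

open scoped Matrix.Norms.L2Operator in
/-- The `C*`-norm of `h` is the largest of the operator norms of `h` in the representations `V_i`,
which are given by the matrices `h i / √d_i`. -/
lemma exists_cstar_norm :
    ∃ ν : AlgebraNorm ℂ B.H, ∀ x : B.H, ν (star x * x) = ν x * ν x := by
  let m : B.H →ₗ[ℂ] ((i : ι) → Matrix (B.Idx i) (B.Idx i) ℂ) :=
    { toFun := fun h i => (B.rtd i : ℂ)⁻¹ • h i
      map_add' := fun g h => by funext i; rw [add_apply, smul_add]; rfl
      map_smul' := fun c h => by
        funext i; rw [smul_apply, smul_comm]; rfl }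
  have m_mul : ∀ g h, m (g * h) = m g * m h := by
    intro g h
    funext i
    change (B.rtd i : ℂ)⁻¹ • (g * h) i = ((B.rtd i : ℂ)⁻¹ • g i) * ((B.rtd i : ℂ)⁻¹ • h i)
    rw [mul_apply, smul_mul_smul_comm, smul_smul]
  have m_star : ∀ h, m (star h) = star (m h) := by
    intro h
    funext i
    change (B.rtd i : ℂ)⁻¹ • (h i).conjTranspose = ((B.rtd i : ℂ)⁻¹ • h i).conjTranspose
    rw [Matrix.conjTranspose_smul]
    simp
  have m_inj : ∀ h, m h = 0 → h = 0 := by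
    intro h h0
    funext i
    exact (smul_eq_zero.1 (congrFun h0 i)).resolve_left (inv_ne_zero (B.rtd_ne i))
  refine ⟨{ toFun := fun h => ‖m h‖
            map_zero' := by rw [map_zero, norm_zero]
            add_le' := fun g h => by rw [map_add]; exact norm_add_le _ _
            neg' := fun h => by rw [map_neg, norm_neg]
            mul_le' := fun g h => by rw [m_mul]; exact norm_mul_le _ _
            eq_zero_of_map_eq_zero' := fun h h0 => m_inj h (norm_eq_zero.1 h0)
            smul' := fun c h => by rw [map_smul, norm_smul] }, fun x => ?_⟩
  change ‖m (star x * x)‖ = ‖m x‖ * ‖m x‖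
  rw [m_mul, m_star, CStarRing.norm_star_mul_self]

lemma star_e (i : ι) (x y : B.Idx i) : star (B.e i x y) = B.e i y x := by
  funext j
  change Matrix.conjTranspose ((Pi.single i (Matrix.single x y (1 : ℂ)) :
    (i : ι) → Matrix (B.Idx i) (B.Idx i) ℂ) j) =
    (Pi.single i (Matrix.single y x (1 : ℂ)) : (i : ι) → Matrix (B.Idx i) (B.Idx i) ℂ) j
  by_cases h : j = i
  · subst h
    simp
  · simp [h]

lemma star_comulBasis (i : ι) (x y : B.Idx i) :
    star (B.comulBasis i x y) = B.comulBasis i y x := by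
  obtain ⟨a, b, α⟩ := x
  obtain ⟨c, d, β⟩ := y
  simp only [comulBasis, star_sum]
  refine Finset.sum_congr rfl fun j _ => Finset.sum_congr rfl fun k _ =>
    Finset.sum_congr rfl fun μ _ => ?_
  rw [Finset.sum_comm]
  refine Finset.sum_congr rfl fun t _ => Finset.sum_congr rfl fun s _ => ?_
  rw [star_smul, TensorProduct.star_tmul, star_e, star_e]
  congr 1
  simp only [star_mul', star_star]
  simp only [RCLike.star_def, Complex.conj_ofReal]
  ring

lemma comul_star' (h : B.H) : B.comul (star h) = star (B.comul h) := by
  change ∑ i, ∑ x, ∑ y, star (h i y x) • B.comulBasis i x y =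
    star (∑ i, ∑ x, ∑ y, h i x y • B.comulBasis i x y)
  simp only [star_sum, star_smul, star_comulBasis]
  exact Finset.sum_congr rfl fun i _ => Finset.sum_comm

variable (B) in
/-- `H_𝒞` as a `C*`-quantum groupoid. -/
def groupoid (hU : B.IsUnitary) : CStarQuantumGroupoid B.H where
  comul := B.comul
  counit := B.counit
  coassoc := LinearMap.ext fun h => comul_coassoc hU h
  rTensor_counit_comp_comul := LinearMap.ext fun h =>
    (TensorProduct.lid ℂ B.H).injective (by
      simp only [LinearMap.comp_apply, TensorProduct.mk_apply, TensorProduct.lid_tmul, one_smul]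
      exact counit_comul_left hU h)
  lTensor_counit_comp_comul := LinearMap.ext fun h =>
    (TensorProduct.rid ℂ B.H).injective (by
      simp only [LinearMap.comp_apply, LinearMap.flip_apply, TensorProduct.mk_apply,
        TensorProduct.rid_tmul, one_smul]
      exact counit_comul_right hU h)
  finite := inferInstanceAs (Module.Finite ℂ ((i : ι) → Matrix (B.Idx i) (B.Idx i) ℂ))
  comul_mul := comul_mul hU
  comul_one_left := comul_one_left' hU
  comul_one_right := comul_one_right' hU
  counit_mul_left := counit_mul_left' hU
  counit_mul_right := counit_mul_right' hU
  antipode := B.antipode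
  mul_antipode := mul_antipode' hU
  antipode_mul := antipode_mul' hU
  antipode_mul_antipode := antipode_mul_antipode' hU
  cstar_norm := exists_cstar_norm
  comul_star := comul_star'

end Groupoid

/-! ### The fibre functor with values in the representations of `H_𝒞` -/

section Fibre

open QuantumGroupoid QuantumGroupoid.Rep

variable {B}

variable (B) in
/-- The quantum groupoid underlying `H_𝒞`. -/
abbrev QG (hU : B.IsUnitary) : QuantumGroupoid B.H := (B.groupoid hU).toQuantumGroupoid

variable (hU : B.IsUnitary)

/-- The representation of `H_𝒞` on `W X`, transported to a vector space in the universe of `H_𝒞`. -/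
def fobj (X : C) : (B.QG hU).Rep where
  V := ULift.{w} (Fin (Module.finrank ℂ (B.W X)) → ℂ)
  ρ := (((Module.finBasis ℂ (B.W X)).equivFun.trans
    ULift.moduleEquiv.symm).conjAlgEquiv ℂ).toAlgHom.comp (B.rep X)

/-- The identification of the underlying space of `fobj hU X` with `W X`. -/
def toW (X : C) : (fobj hU X).V ≃ₗ[ℂ] B.W X :=
  ((Module.finBasis ℂ (B.W X)).equivFun.trans ULift.moduleEquiv.symm).symm

lemma toW_ρ {X : C} (h : B.H) (v : (fobj hU X).V) :
    toW hU X ((fobj hU X).ρ h v) = B.rep X h (toW hU X v) :=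
  (toW hU X).apply_symm_apply _

lemma toW_symm_rep {X : C} (h : B.H) (x : B.W X) :
    (toW hU X).symm (B.rep X h x) = (fobj hU X).ρ h ((toW hU X).symm x) := by
  rw [LinearEquiv.symm_apply_eq, toW_ρ, LinearEquiv.apply_symm_apply]

/-- A morphism of representations out of an `H_𝒞`-linear map of the spaces `W X`. -/
def ofW {X Y : C} (f : B.W X →ₗ[ℂ] B.W Y) (hf : ∀ h x, f (B.rep X h x) = B.rep Y h (f x)) :
    fobj hU X ⟶ fobj hU Y :=
  ⟨(toW hU Y).symm.toLinearMap ∘ₗ f ∘ₗ (toW hU X).toLinearMap, fun h => LinearMap.ext fun v => by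
    simp only [LinearMap.comp_apply, LinearEquiv.coe_coe, toW_ρ, hf, toW_symm_rep]⟩

lemma toW_ofW {X Y : C} (f : B.W X →ₗ[ℂ] B.W Y) (hf : ∀ h x, f (B.rep X h x) = B.rep Y h (f x))
    (v : (fobj hU X).V) : toW hU Y (Hom.toLin (ofW hU f hf) v) = f (toW hU X v) :=
  (toW hU Y).apply_symm_apply _

lemma hom_fobj_ext {U : (B.QG hU).Rep} {X : C} {f g : U ⟶ fobj hU X}
    (h : ∀ v, toW hU X (Hom.toLin f v) = toW hU X (Hom.toLin g v)) : f = g :=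
  QuantumGroupoid.Rep.hom_ext (LinearMap.ext fun v => (toW hU X).injective (h v))

/-- The morphism of representations induced by a morphism of `C`. -/
def wmap {X Y : C} (f : X ⟶ Y) : fobj hU X ⟶ fobj hU Y := ofW hU (B.Wmap f) (Wmap_rep f)

lemma toW_wmap {X Y : C} (f : X ⟶ Y) (v : (fobj hU X).V) :
    toW hU Y (Hom.toLin (wmap hU f) v) = B.Wmap f (toW hU X v) := toW_ofW hU _ (Wmap_rep f) v

lemma wmap_id (X : C) : wmap hU (𝟙 X) = 𝟙 (fobj hU X) := hom_fobj_ext hU fun v => by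
  rw [toW_wmap, Wmap_id]; rfl

lemma wmap_comp {X Y Z : C} (f : X ⟶ Y) (g : Y ⟶ Z) : wmap hU (f ≫ g) = wmap hU f ≫ wmap hU g :=
  hom_fobj_ext hU fun v => by
    rw [toW_wmap, Wmap_comp, LinearMap.comp_apply, comp_toLin, LinearMap.comp_apply,
      toW_wmap, toW_wmap]

lemma wmap_add {X Y : C} (f g : X ⟶ Y) : wmap hU (f + g) = wmap hU f + wmap hU g :=
  hom_fobj_ext hU fun v => by
    rw [add_toLin, LinearMap.add_apply, map_add, toW_wmap, toW_wmap, toW_wmap, Wmap_add]; rfl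

lemma wmap_smul {X Y : C} (c : ℂ) (f : X ⟶ Y) : wmap hU (c • f) = c • wmap hU f :=
  hom_fobj_ext hU fun v => by
    rw [smul_toLin, LinearMap.smul_apply, map_smul, toW_wmap, toW_wmap, Wmap_smul]; rfl

/-- The functor `X ↦ W X` with values in the representations of `H_𝒞`. -/
def fib : C ⥤ (B.QG hU).Rep where
  obj := fobj hU
  map f := wmap hU f
  map_id X := wmap_id hU X
  map_comp f g := wmap_comp hU f g

lemma fib_additive : (fib hU).Additive where
  map_add {_ _ f g} := wmap_add hU f g

lemma fib_linear : (fib hU).Linear ℂ where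
  map_smul f c := wmap_smul hU c f

lemma toW_act {X Y : C} (t : B.H ⊗[ℂ] B.H) (z : (fobj hU X).V ⊗[ℂ] (fobj hU Y).V) :
    TensorProduct.map (toW hU X).toLinearMap (toW hU Y).toLinearMap
      (act (fobj hU X).ρ.toLinearMap (fobj hU Y).ρ.toLinearMap t z) =
      B.act2 X Y t (TensorProduct.map (toW hU X).toLinearMap (toW hU Y).toLinearMap z) := by
  induction t with
  | zero => simp
  | add s t hs ht => simp only [map_add, LinearMap.add_apply, hs, ht]
  | tmul a b =>
    induction z with
    | zero => simp
    | add s t hs ht => simp only [map_add, hs, ht]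
    | tmul x y => simp [toW_ρ]

/-- The identification with `W X ⊗ W Y` of the tensor product of the spaces of `fobj hU X` and
`fobj hU Y`. -/
def toW2 (X Y : C) : (fobj hU X).V ⊗[ℂ] (fobj hU Y).V ≃ₗ[ℂ] B.W X ⊗[ℂ] B.W Y :=
  TensorProduct.congr (toW hU X) (toW hU Y)

@[simp] lemma toW2_tmul {X Y : C} (x : (fobj hU X).V) (y : (fobj hU Y).V) :
    toW2 hU X Y (x ⊗ₜ y) = toW hU X x ⊗ₜ toW hU Y y := rfl

lemma toW2_act {X Y : C} (t : B.H ⊗[ℂ] B.H) (z : (fobj hU X).V ⊗[ℂ] (fobj hU Y).V) :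
    toW2 hU X Y (act (fobj hU X).ρ.toLinearMap (fobj hU Y).ρ.toLinearMap t z) =
      B.act2 X Y t (toW2 hU X Y z) := toW_act hU t z

lemma incl_ρ_apply {Q : QuantumGroupoid B.H} (U V : Q.Rep) (h : B.H) (y : (tens U V).V) :
    incl U V ((tens U V).ρ h y) = act U.ρ.toLinearMap V.ρ.toLinearMap (Q.comul h) (incl U V y) :=
  LinearMap.congr_fun (incl_comp_ρ U V h) y

lemma incl_proj_apply {Q : QuantumGroupoid B.H} (U V : Q.Rep) (z : U.V ⊗[ℂ] V.V) :
    incl U V (proj U V z) = act U.ρ.toLinearMap V.ρ.toLinearMap (Q.comul 1) z :=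
  LinearMap.congr_fun (incl_comp_proj U V) z

lemma toW2_incl_proj {X Y : C} (z : (fobj hU X).V ⊗[ℂ] (fobj hU Y).V) :
    toW2 hU X Y (incl _ _ (proj (fobj hU X) (fobj hU Y) z)) = B.balance X Y (toW2 hU X Y z) := by
  rw [incl_proj_apply, toW2_act]
  exact act2_comul_one hU _

lemma balance_toW2_incl {X Y : C} (y : (tens (fobj hU X) (fobj hU Y)).V) :
    B.balance X Y (toW2 hU X Y (incl _ _ y)) = toW2 hU X Y (incl _ _ y) := by
  conv_rhs => rw [← act_one_incl_apply, toW2_act]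
  exact (act2_comul_one hU _).symm

/-- The tensor structure of the fibre functor: on `W X ⊗ W Y` it is the map `mu`, whose restriction
to the balanced tensors is invertible with inverse `nu`. -/
def muIso (X Y : C) : tens (fobj hU X) (fobj hU Y) ≅ fobj hU (X ⊗ Y) :=
  isoOfInverse
    ⟨(toW hU (X ⊗ Y)).symm.toLinearMap ∘ₗ B.mu X Y ∘ₗ (toW2 hU X Y).toLinearMap ∘ₗ incl _ _,
      fun h => LinearMap.ext fun y => by
        simp only [LinearMap.comp_apply, LinearEquiv.coe_coe, incl_ρ_apply, toW2_act]
        rw [← toW_symm_rep]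
        exact congrArg _ (mu_act2_comul hU h _)⟩
    (proj _ _ ∘ₗ (toW2 hU X Y).symm.toLinearMap ∘ₗ B.nu X Y ∘ₗ (toW hU (X ⊗ Y)).toLinearMap)
    (LinearMap.ext fun y => incl_inj _ _ ((toW2 hU X Y).injective (by
      simp only [LinearMap.comp_apply, LinearEquiv.coe_coe, toW2_incl_proj,
        LinearEquiv.apply_symm_apply, nu_mu, LinearMap.id_apply, balance_toW2_incl])))
    (LinearMap.ext fun y => (toW hU _).injective (by
      simp only [LinearMap.comp_apply, LinearEquiv.coe_coe, toW2_incl_proj,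
        LinearEquiv.apply_symm_apply, mu_balance, mu_nu, LinearMap.id_apply]))

lemma toW_muIso_hom {X Y : C} (y : (tens (fobj hU X) (fobj hU Y)).V) :
    toW hU (X ⊗ Y) (Hom.toLin (muIso hU X Y).hom y) = B.mu X Y (toW2 hU X Y (incl _ _ y)) :=
  (toW hU _).apply_symm_apply _

lemma toW2_incl_muIso_inv {X Y : C} (v : (fobj hU (X ⊗ Y)).V) :
    toW2 hU X Y (incl _ _ (Hom.toLin (muIso hU X Y).inv v)) = B.nu X Y (toW hU (X ⊗ Y) v) := by
  change toW2 hU X Y (incl _ _ (proj _ _ ((toW2 hU X Y).symm (B.nu X Y (toW hU (X ⊗ Y) v))))) = _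
  rw [toW2_incl_proj, LinearEquiv.apply_symm_apply, balance_nu]

lemma toW2_incl_map {X Y X' Y' : C} (f : fobj hU X ⟶ fobj hU X') (g : fobj hU Y ⟶ fobj hU Y')
    (f' : B.W X →ₗ[ℂ] B.W X') (g' : B.W Y →ₗ[ℂ] B.W Y')
    (hf : ∀ v, toW hU X' (Hom.toLin f v) = f' (toW hU X v))
    (hg : ∀ v, toW hU Y' (Hom.toLin g v) = g' (toW hU Y v))
    (y : (tens (fobj hU X) (fobj hU Y)).V) :
    toW2 hU X' Y' (incl _ _ (Hom.toLin (tensMap f g) y)) =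
      TensorProduct.map f' g' (toW2 hU X Y (incl _ _ y)) := by
  rw [incl_tensMap_apply]
  generalize incl _ _ y = z
  induction z with
  | zero => simp
  | add s t hs ht => simp only [map_add, hs, ht]
  | tmul a b => simp [hf, hg]

lemma muIso_natural {X Y X' Y' : C} (f : X ⟶ X') (g : Y ⟶ Y') :
    tensMap (wmap hU f) (wmap hU g) ≫ (muIso hU X' Y').hom =
      (muIso hU X Y).hom ≫ wmap hU (f ⊗ₘ g) :=
  hom_fobj_ext hU fun y => by
    simp only [comp_toLin, LinearMap.comp_apply]
    rw [toW_wmap, toW_muIso_hom, toW_muIso_hom, mu_natural]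
    exact congrArg _ (toW2_incl_map hU _ _ _ _ (toW_wmap hU f) (toW_wmap hU g) y)

/-- The associativity of `mu`, transported along the inclusions of the products of
representations. -/
lemma muIso_associativity (X Y Z : C) :
    tensMap (muIso hU X Y).hom (𝟙 (fobj hU Z)) ≫ (muIso hU (X ⊗ Y) Z).hom ≫
      wmap hU (α_ X Y Z).hom =
    (assocIso (fobj hU X) (fobj hU Y) (fobj hU Z)).hom ≫
      tensMap (𝟙 (fobj hU X)) (muIso hU Y Z).hom ≫ (muIso hU X (Y ⊗ Z)).hom :=
  hom_fobj_ext hU fun y => by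
    simp only [comp_toLin, LinearMap.comp_apply]
    rw [toW_wmap, toW_muIso_hom, toW_muIso_hom, incl_tensMap_apply, incl_tensMap_apply]
    have h1 : ∀ w : (tens (fobj hU X) (fobj hU Y)).V ⊗[ℂ] (fobj hU Z).V,
        toW2 hU (X ⊗ Y) Z (TensorProduct.map (Hom.toLin (muIso hU X Y).hom)
          (Hom.toLin (𝟙 (fobj hU Z))) w) = (B.mu X Y).rTensor _
            (TensorProduct.map (toW2 hU X Y).toLinearMap (toW hU Z).toLinearMap
              ((incl _ _).rTensor _ w)) := by
      intro w
      induction w with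
      | zero => simp
      | add s t hs ht => simp only [map_add, hs, ht]
      | tmul a b => simp [toW_muIso_hom]
    have h2 : ∀ w : (fobj hU X).V ⊗[ℂ] (tens (fobj hU Y) (fobj hU Z)).V,
        toW2 hU X (Y ⊗ Z) (TensorProduct.map (Hom.toLin (𝟙 (fobj hU X)))
          (Hom.toLin (muIso hU Y Z).hom) w) = (B.mu Y Z).lTensor _
            (TensorProduct.map (toW hU X).toLinearMap (toW2 hU Y Z).toLinearMap
              ((incl _ _).lTensor _ w)) := by
      intro w
      induction w with
      | zero => simp
      | add s t hs ht => simp only [map_add, hs, ht]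
      | tmul a b => simp [toW_muIso_hom]
    have h3 : (incl (fobj hU Y) (fobj hU Z)).lTensor (fobj hU X).V
        (incl (fobj hU X) (tens (fobj hU Y) (fobj hU Z))
          (Hom.toLin (assocIso (fobj hU X) (fobj hU Y) (fobj hU Z)).hom y)) =
        TensorProduct.assoc ℂ _ _ _ (inclL _ _ _ y) := assocIso_hom_apply _ _ _ y
    have h4 : ∀ z : ((fobj hU X).V ⊗[ℂ] (fobj hU Y).V) ⊗[ℂ] (fobj hU Z).V,
        TensorProduct.map (toW hU X).toLinearMap (toW2 hU Y Z).toLinearMap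
          (TensorProduct.assoc ℂ _ _ _ z) = TensorProduct.assoc ℂ _ _ _
            (TensorProduct.map (toW2 hU X Y).toLinearMap (toW hU Z).toLinearMap z) := by
      intro z
      induction z with
      | zero => simp
      | add s t hs ht => simp only [map_add, hs, ht]
      | tmul a b =>
        induction a with
        | zero => simp
        | add s t hs ht => simp only [map_add, TensorProduct.add_tmul, hs, ht]
        | tmul p q => simp
    rw [h1, h2, h3, h4, mu_assoc]
    rfl

/-- Every nonzero vector of the fibre at a simple object is cyclic. -/
lemma exists_rep_apply {i : ι} (x y : B.W (B.X i)) (hx : x ≠ 0) :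
    ∃ h, B.rep (B.X i) h x = y := by
  have h1 : ∃ z, B.cw z x ≠ 0 := by
    by_contra! h
    exact hx (by rw [← sum_cw_wv x]; simp [h])
  obtain ⟨z, hz⟩ := h1
  refine ⟨∑ a, (B.cw a y * (B.cw z x)⁻¹ * B.rtd i) • B.e i a z, ?_⟩
  rw [map_sum, LinearMap.sum_apply]
  conv_rhs => rw [← sum_cw_wv y]
  refine Finset.sum_congr rfl fun a _ => ?_
  rw [map_smul, LinearMap.smul_apply, rep_e_self, smul_smul]
  congr 1
  field_simp [B.rtd_ne i]

lemma unitVec_ne_zero : B.unitVec ≠ 0 := by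
  intro h
  have := lam_idem_unitVec (B := B) B.one
  rw [h, Limits.comp_zero, map_zero] at this
  exact zero_ne_one this

lemma exists_rep_unitVec (f : B.W (𝟙_ C)) : ∃ h, B.rep (𝟙_ C) h B.unitVec = f := by
  have h1 : B.Wmap B.oneIso.inv B.unitVec ≠ 0 := by
    intro h
    apply unitVec_ne_zero (B := B)
    rw [← LinearMap.id_apply (R := ℂ) B.unitVec, ← Wmap_id, ← B.oneIso.inv_hom_id, Wmap_comp,
      LinearMap.comp_apply, h, map_zero]
  obtain ⟨h, hh⟩ := exists_rep_apply _ (B.Wmap B.oneIso.inv f) h1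
  refine ⟨h, ?_⟩
  have h2 : ∀ g : B.W (𝟙_ C), B.Wmap B.oneIso.hom (B.Wmap B.oneIso.inv g) = g := by
    intro g
    rw [← LinearMap.comp_apply, ← Wmap_comp, Iso.inv_hom_id, Wmap_id, LinearMap.id_apply]
  have := congrArg (B.Wmap B.oneIso.hom) hh
  rwa [Wmap_rep, h2, h2] at this

lemma rep_εt {X : C} (h : B.H) (x : B.W X) : B.rep X ((B.QG hU).εt h) x =
    ∑ a, B.coef a (B.rep (𝟙_ C) h B.unitVec ≫ (ρ_ B.G).hom) • (x ≫ B.idem a ▷ X) :=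
  rep_target hU h x

lemma rep_εt_unitVec (h : B.H) :
    B.rep (𝟙_ C) ((B.QG hU).εt h) B.unitVec = B.rep (𝟙_ C) h B.unitVec := by
  rw [rep_εt]
  simp only [unit_comp_idem]
  exact (unit_eq_sum _).symm

lemma rep_εbar {X : C} (h : B.H) (x : B.W X) : B.rep X ((B.QG hU).εbar h) x =
    ∑ a, B.lam (B.idem a ≫ B.rep (𝟙_ C) h B.unitVec) • (B.idem a ≫ x) := by
  have h1 : (B.QG hU).εbar h = TensorProduct.rid ℂ B.H (B.counit.lTensor B.H
    (B.comul 1 * ((1 : B.H) ⊗ₜ[ℂ] h))) := rfl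
  rw [h1, rep_counit_right, act2_mul, act2_comul_one hU, act2_tmul, TensorProduct.map_tmul, map_one,
    Module.End.one_apply, balance_tmul]
  simp only [map_sum, LinearMap.lTensor_tmul, TensorProduct.rid_tmul, unit_comp_idem]

/-- The linear map `z ↦ z u` from the target counital subalgebra, where `u` is the unit vector. -/
def unitLin : (unitObj (B.QG hU)).V →ₗ[ℂ] (fobj hU (𝟙_ C)).V :=
  (toW hU _).symm.toLinearMap ∘ₗ LinearMap.applyₗ B.unitVec ∘ₗ (B.rep (𝟙_ C)).toLinearMap ∘ₗ
    uincl (B.QG hU)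

lemma toW_unitLin (z : (unitObj (B.QG hU)).V) :
    toW hU _ (unitLin hU z) = B.rep (𝟙_ C) (uincl (B.QG hU) z) B.unitVec :=
  (toW hU _).apply_symm_apply _

lemma unitLin_bijective : Function.Bijective (unitLin hU) := by
  constructor
  · rw [injective_iff_map_eq_zero]
    intro z hz
    have h1 : B.rep (𝟙_ C) (uincl (B.QG hU) z) B.unitVec = 0 := by
      rw [← toW_unitLin, hz, map_zero]
    apply uincl_inj (B.QG hU)
    rw [map_zero, ← εt_uincl]
    refine rep_ext fun i f => ?_
    rw [rep_εt, h1]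
    simp
  · intro v
    obtain ⟨h, hh⟩ := exists_rep_unitVec (toW hU _ v)
    refine ⟨uproj (B.QG hU) h, (toW hU _).injective ?_⟩
    rw [toW_unitLin, uincl_uproj, rep_εt_unitVec, hh]

/-- The unit isomorphism of the fibre functor. -/
def unitIso : unitObj (B.QG hU) ≅ fobj hU (𝟙_ C) :=
  isoOfInverse ⟨unitLin hU, fun h => LinearMap.ext fun z => (toW hU _).injective (by
      have h1 : uincl (B.QG hU) ((unitObj (B.QG hU)).ρ h z) =
          (B.QG hU).εt (h * uincl (B.QG hU) z) := LinearMap.congr_fun (uincl_ρ _ h) z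
      simp only [LinearMap.comp_apply]
      rw [toW_unitLin, h1, rep_εt_unitVec, toW_ρ, toW_unitLin, map_mul, Module.End.mul_apply])⟩
    (LinearEquiv.ofBijective _ (unitLin_bijective hU)).symm.toLinearMap
    (LinearMap.ext fun z => (LinearEquiv.ofBijective _ (unitLin_bijective hU)).symm_apply_apply z)
    (LinearMap.ext fun v => (LinearEquiv.ofBijective _ (unitLin_bijective hU)).apply_symm_apply v)

lemma toW_unitIso_hom (z : (unitObj (B.QG hU)).V) :
    toW hU _ (Hom.toLin (unitIso hU).hom z) = B.rep (𝟙_ C) (uincl (B.QG hU) z) B.unitVec :=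
  toW_unitLin hU z

lemma fib_left_unitality (X : C) : (leftIso (fobj hU X)).hom =
    tensMap (unitIso hU).hom (𝟙 (fobj hU X)) ≫ (muIso hU (𝟙_ C) X).hom ≫
      wmap hU (λ_ X).hom :=
  hom_fobj_ext hU fun y => by
    simp only [comp_toLin, LinearMap.comp_apply]
    rw [toW_wmap, toW_muIso_hom, incl_tensMap_apply, leftIso_hom, lincl]
    simp only [LinearMap.comp_apply]
    generalize incl _ _ y = w
    induction w with
    | zero => simp
    | add s t hs ht => simp only [map_add, hs, ht]
    | tmul z v =>
      have h1 : ∀ (a : ι) (x : B.W X), B.Wmap (λ_ X).hom (B.mu (𝟙_ C) X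
          ((B.idem a ≫ B.unitVec) ⊗ₜ x)) = x ≫ B.idem a ▷ X := by
        intro a x
        have : B.mu (𝟙_ C) X ((B.idem a ≫ B.unitVec) ⊗ₜ x) =
            B.mu (𝟙_ C) X (B.unitVec ⊗ₜ (x ≫ B.idem a ▷ X)) := by simp
        rw [this, mu_unit_left, ← LinearMap.comp_apply, ← Wmap_comp, Iso.inv_hom_id, Wmap_id]
        rfl
      have h2 := rep_εt hU (uincl (B.QG hU) z) (toW hU X v)
      rw [εt_uincl] at h2
      rw [LinearMap.rTensor_tmul, lact_tmul, TensorProduct.map_tmul, toW2_tmul, toW_unitIso_hom,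
        toW_ρ, h2, unit_eq_sum (B.rep (𝟙_ C) _ _), TensorProduct.sum_tmul, map_sum, map_sum,
        ← unit_eq_sum]
      simp only [← TensorProduct.smul_tmul', map_smul, id_toLin, LinearMap.id_apply, h1]

lemma fib_right_unitality (X : C) : (rightIso (fobj hU X)).hom =
    tensMap (𝟙 (fobj hU X)) (unitIso hU).hom ≫ (muIso hU X (𝟙_ C)).hom ≫
      wmap hU (ρ_ X).hom :=
  hom_fobj_ext hU fun y => by
    simp only [comp_toLin, LinearMap.comp_apply]
    rw [toW_wmap, toW_muIso_hom, incl_tensMap_apply, rightIso_hom, rincl]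
    simp only [LinearMap.comp_apply]
    generalize incl _ _ y = w
    induction w with
    | zero => simp
    | add s t hs ht => simp only [map_add, hs, ht]
    | tmul v z =>
      have h1 : ∀ (a : ι) (x : B.W X), B.Wmap (ρ_ X).hom (B.mu X (𝟙_ C)
          (x ⊗ₜ (B.idem a ≫ B.unitVec))) = B.idem a ≫ x := by
        intro a x
        have : B.mu X (𝟙_ C) (x ⊗ₜ (B.idem a ≫ B.unitVec)) =
            B.idem a ≫ B.mu X (𝟙_ C) (x ⊗ₜ B.unitVec) := by simp
        rw [this, mu_unit_right]
        simp [Wmap_apply]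
      rw [LinearMap.lTensor_tmul, ract_tmul, TensorProduct.map_tmul, toW2_tmul, toW_unitIso_hom,
        toW_ρ, rep_εbar, unit_eq_sum (B.rep (𝟙_ C) _ _), TensorProduct.tmul_sum, map_sum, map_sum,
        ← unit_eq_sum]
      simp only [TensorProduct.tmul_smul, map_smul, h1, lam_idem_comp]
      rfl

/-- The monoidal structure of the fibre functor with values in `Rep(H_𝒞)`. It is strong: the tensor
product of representations is cut out by `Δ(η)`, which is the projection onto the balanced tensors,
and `mu` is invertible there. -/
def fibCore : (fib hU).CoreMonoidal where
  εIso := unitIso hU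
  μIso := muIso hU
  μIso_hom_natural_left {X Y} f X' := by
    have h := muIso_natural hU f (𝟙 X')
    rw [wmap_id, tensorHom_id] at h
    exact h
  μIso_hom_natural_right {X Y} X' f := by
    have h := muIso_natural hU (𝟙 X') f
    rw [wmap_id, id_tensorHom] at h
    exact h
  associativity X Y Z := muIso_associativity hU X Y Z
  left_unitality X := fib_left_unitality hU X
  right_unitality X := fib_right_unitality hU X

end Fibre

/-! ### The fibre functor is an equivalence -/

section Equivalence

open QuantumGroupoid QuantumGroupoid.Rep

variable {B}

/-- The fibre functor is faithful. -/
lemma Wmap_injective {X Y : C} {f g : X ⟶ Y} (h : B.Wmap f = B.Wmap g) : f = g := by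
  -- the fibres detect the morphism `G ◁ f`, of which `f` is a retract
  have h1 : B.G ◁ f = B.G ◁ g := by
    obtain ⟨n, p, j, hpj⟩ := B.exists_complete_G (B.G ⊗ X)
    rw [← Category.id_comp (B.G ◁ f), ← Category.id_comp (B.G ◁ g), ← hpj,
      Preadditive.sum_comp, Preadditive.sum_comp]
    refine Finset.sum_congr rfl fun k _ => ?_
    rw [Category.assoc, Category.assoc]
    congr 1
    exact LinearMap.congr_fun h (j k)
  have h2 : ∀ e : X ⟶ Y, (λ_ X).inv ≫ (B.oneIso.inv ≫ B.inc B.one) ▷ X ≫ B.G ◁ e ≫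
      (B.prj B.one ≫ B.oneIso.hom) ▷ Y ≫ (λ_ Y).hom = e := by
    intro e
    rw [← whisker_exchange_assoc, ← comp_whiskerRight_assoc]
    have : (B.oneIso.inv ≫ B.inc B.one) ≫ B.prj B.one ≫ B.oneIso.hom = 𝟙 _ := by
      rw [Category.assoc, ← Category.assoc (B.inc B.one), inc_prj, Category.id_comp,
        Iso.inv_hom_id]
    rw [this]
    simp
  rw [← h2 f, ← h2 g, h1]

lemma Wmap_comp_apply {X Y Z : C} (f : X ⟶ Y) (g : Y ⟶ Z) (x : B.W X) :
    B.Wmap (f ≫ g) x = B.Wmap g (B.Wmap f x) := by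
  rw [Wmap_comp, LinearMap.comp_apply]

/-- The fibres at the simple objects are nonzero, by faithfulness. -/
instance nonempty_idx (i : ι) : Nonempty (B.Idx i) := by
  by_contra h
  rw [not_nonempty_iff] at h
  have h1 : (𝟙 (B.G ⊗ B.X i)) = 0 := by
    rw [← sum_vv_wv]
    simp
  refine id_nonzero (B.X i) ?_
  apply Wmap_injective (B := B)
  refine LinearMap.ext fun x => ?_
  rw [Wmap_id, Wmap_zero, LinearMap.id_apply, ← Category.comp_id x, h1, Limits.comp_zero]
  rfl

lemma rep_E {i : ι} (x y : B.Idx i) (f : B.W (B.X i)) :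
    B.rep (B.X i) (E x y) f = B.cw y f • wv x := by
  rw [E, map_smul, LinearMap.smul_apply, rep_e_self, smul_smul, mul_inv_cancel_left₀ (B.rtd_ne i)]

lemma rep_E_of_ne {i j : ι} (h : i ≠ j) (x y : B.Idx i) (f : B.W (B.X j)) :
    B.rep (B.X j) (E x y) f = 0 := by
  rw [E, map_smul, LinearMap.smul_apply, rep_e_of_ne h, smul_zero]

/-- Schur's lemma for the fibres at the simple objects. -/
lemma exists_Wmap_simple {i j : ι} (t : B.W (B.X i) →ₗ[ℂ] B.W (B.X j))
    (ht : ∀ h x, t (B.rep _ h x) = B.rep _ h (t x)) : ∃ f : B.X i ⟶ B.X j, t = B.Wmap f := by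
  obtain ⟨y⟩ : Nonempty (B.Idx i) := inferInstance
  have h1 : ∀ x, t (wv x) = B.rep _ (E x y) (t (wv y)) := by
    intro x
    rw [← ht, rep_E, cw_wv_self, one_smul]
  by_cases hij : i = j
  · subst hij
    refine ⟨B.cw y (t (wv y)) • 𝟙 _, (B.wB i).ext fun x => ?_⟩
    rw [wB_apply, h1, Wmap_smul, Wmap_id, rep_E, LinearMap.smul_apply, LinearMap.id_apply]
  · refine ⟨0, (B.wB i).ext fun x => ?_⟩
    rw [wB_apply, h1, Wmap_zero, rep_E_of_ne hij, LinearMap.zero_apply]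

/-- The linear maps between fibres that commute with `H_𝒞` come from morphisms of `C`. -/
lemma exists_Wmap {X Y : C} (t : B.W X →ₗ[ℂ] B.W Y)
    (ht : ∀ h x, t (B.rep _ h x) = B.rep _ h (t x)) : ∃ f : X ⟶ Y, t = B.Wmap f := by
  obtain ⟨n, c, p, j, hX⟩ := B.exists_complete X
  obtain ⟨n', c', p', j', hY⟩ := B.exists_complete Y
  have h1 : ∀ k l, ∃ f : B.X (c k) ⟶ B.X (c' l), B.Wmap (p' l) ∘ₗ t ∘ₗ B.Wmap (j k) = B.Wmap f := by
    intro k l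
    refine exists_Wmap_simple _ fun h x => ?_
    simp only [LinearMap.comp_apply, Wmap_rep, ht]
  choose f hf using h1
  refine ⟨∑ k, ∑ l, p k ≫ f k l ≫ j' l, LinearMap.ext fun x => ?_⟩
  have h2 : ∑ k, B.Wmap (j k) (B.Wmap (p k) x) = x := by
    simp only [← Wmap_comp_apply]
    rw [← LinearMap.sum_apply, ← Wmap_sum, hX, Wmap_id, LinearMap.id_apply]
  have h3 : ∀ y, ∑ l, B.Wmap (j' l) (B.Wmap (p' l) y) = y := by
    intro y
    simp only [← Wmap_comp_apply]
    rw [← LinearMap.sum_apply, ← Wmap_sum, hY, Wmap_id, LinearMap.id_apply]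
  conv_lhs => rw [← h2]
  simp only [Wmap_sum, LinearMap.sum_apply, Wmap_comp_apply, map_sum, ← hf, LinearMap.comp_apply,
    h3]

variable (hU : B.IsUnitary)

lemma fib_faithful : (fib hU).Faithful where
  map_injective {X Y f g} h := Wmap_injective (LinearMap.ext fun x => by
    have h1 : wmap hU f = wmap hU g := h
    rw [← (toW hU X).apply_symm_apply x, ← toW_wmap, ← toW_wmap, h1])

lemma exists_wmap {X Y : C} (t : fobj hU X ⟶ fobj hU Y) : ∃ f : X ⟶ Y, wmap hU f = t := by
  obtain ⟨f, hf⟩ := exists_Wmap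
    ((toW hU Y).toLinearMap ∘ₗ Hom.toLin t ∘ₗ (toW hU X).symm.toLinearMap) (fun h x => by
      simp only [LinearMap.comp_apply, LinearEquiv.coe_coe, toW_symm_rep, Rep.comm_apply, toW_ρ])
  refine ⟨f, hom_fobj_ext hU fun v => ?_⟩
  rw [toW_wmap, ← hf]
  simp

lemma fib_full : (fib hU).Full where
  map_surjective t := exists_wmap hU t

/-- Left multiplication acts on the column of matrix units `e_{zx}`, for `x` fixed, as on `W(i)`. -/
lemma mul_E (h : B.H) {i : ι} (z x : B.Idx i) :
    h * E z x = ∑ y, B.cw y (B.rep (B.X i) h (wv z)) • E y x := by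
  refine rep_ext fun j f => ?_
  rw [map_mul, Module.End.mul_apply, map_sum, LinearMap.sum_apply]
  simp only [map_smul, LinearMap.smul_apply]
  by_cases hij : i = j
  · subst hij
    simp only [rep_E, map_smul]
    rw [← sum_cw_wv (B.rep (B.X i) h (wv z)), Finset.smul_sum, sum_cw_wv]
    exact Finset.sum_congr rfl fun y _ => smul_comm _ _ _
  · simp [rep_E_of_ne hij]

/-- Right multiplication acts on the row of matrix units `e_{xz}`, for `x` fixed, as the transpose
of the action on `W(i)`. -/
lemma E_mul (h : B.H) {i : ι} (x z : B.Idx i) :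
    E x z * h = ∑ y, B.cw z (B.rep (B.X i) h (wv y)) • E x y := by
  refine rep_ext fun j f => ?_
  rw [map_mul, Module.End.mul_apply, map_sum, LinearMap.sum_apply]
  simp only [map_smul, LinearMap.smul_apply]
  by_cases hij : i = j
  · subst hij
    simp only [rep_E, smul_smul]
    rw [← Finset.sum_smul]
    congr 1
    conv_lhs => rw [← sum_cw_wv f, map_sum, map_sum]
    refine Finset.sum_congr rfl fun y _ => ?_
    rw [map_smul, map_smul, smul_eq_mul, mul_comm]
  · simp [rep_E_of_ne hij]

lemma E_mul_E {i : ι} (x y z : B.Idx i) : (E x y : B.H) * E y z = E x z := by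
  refine rep_ext fun j f => ?_
  rw [map_mul, Module.End.mul_apply]
  by_cases hij : i = j
  · subst hij
    rw [rep_E, rep_E, rep_E, map_smul, cw_wv_self, smul_eq_mul, mul_one]
  · simp [rep_E_of_ne hij]

/-- The matrix units decompose the unit of `H_𝒞`. -/
lemma sum_E : ∑ i, ∑ x : B.Idx i, (E x x : B.H) = 1 := by
  refine rep_ext fun j f => ?_
  rw [map_sum, LinearMap.sum_apply, Finset.sum_eq_single j]
  · rw [map_sum, LinearMap.sum_apply, map_one, Module.End.one_apply]
    conv_rhs => rw [← sum_cw_wv f]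
    exact Finset.sum_congr rfl fun x _ => rep_E _ _ _
  · intro i _ hij
    simp [rep_E_of_ne hij]
  · simp

section Retract

variable {hU}
variable (U : (B.QG hU).Rep) {i : ι} (x : B.Idx i)

/-- The morphism `W(i) → U` that sends the basis vector `v^z` to `e_{zx} u`, for the matrix units
`e_{zx}` of `H_𝒞`. -/
def intoRep (u : U.V) : fobj hU (B.X i) ⟶ U :=
  ⟨(B.wB i).constr ℂ (fun z => U.ρ (E z x) u) ∘ₗ (toW hU (B.X i)).toLinearMap,
    fun h => LinearMap.ext fun v => by
      simp only [LinearMap.comp_apply, LinearEquiv.coe_coe, toW_ρ]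
      generalize toW hU (B.X i) v = f
      have : (B.wB i).constr ℂ (fun z => U.ρ (E z x) u) ∘ₗ B.rep _ h =
          U.ρ h ∘ₗ (B.wB i).constr ℂ (fun z => U.ρ (E z x) u) := by
        refine (B.wB i).ext fun z => ?_
        rw [LinearMap.comp_apply, LinearMap.comp_apply, Module.Basis.constr_basis,
          ← Module.End.mul_apply, ← map_mul, mul_E, wB_apply, ← sum_cw_wv (B.rep _ h (wv z)),
          map_sum, map_sum, LinearMap.sum_apply]
        refine Finset.sum_congr rfl fun y _ => ?_
        rw [map_smul, ← wB_apply y, Module.Basis.constr_basis, map_smul, LinearMap.smul_apply,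
          sum_cw_wv]
      exact LinearMap.congr_fun this f⟩

/-- The morphism `U → W(i)` whose coordinate at `v^z` is `u ↦ φ (e_{xz} u)`. -/
def ontoFib (φ : U.V →ₗ[ℂ] ℂ) : U ⟶ fobj hU (B.X i) :=
  ⟨(toW hU (B.X i)).symm.toLinearMap ∘ₗ
      ∑ z, (φ ∘ₗ U.ρ (E x z)).smulRight (wv z),
    fun h => LinearMap.ext fun u => (toW hU _).injective (by
      simp only [LinearMap.comp_apply, LinearEquiv.coe_coe, toW_ρ, LinearEquiv.apply_symm_apply,
        LinearMap.sum_apply, LinearMap.smulRight_apply]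
      simp only [← Module.End.mul_apply, ← map_mul, E_mul]
      simp only [map_sum, map_smul, LinearMap.sum_apply, LinearMap.smul_apply, Finset.sum_smul]
      rw [Finset.sum_comm]
      refine Finset.sum_congr rfl fun y _ => ?_
      rw [← sum_cw_wv (B.rep _ h (wv y)), Finset.smul_sum]
      refine Finset.sum_congr rfl fun z _ => ?_
      rw [sum_cw_wv, smul_smul, smul_eq_mul, mul_comm])⟩

lemma intoRep_ontoFib (u : U.V) (φ : U.V →ₗ[ℂ] ℂ) (v : U.V) :
    Hom.toLin (intoRep U x u) (Hom.toLin (ontoFib U x φ) v) =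
      ∑ z, φ (U.ρ (E x z) v) • U.ρ (E z x) u := by
  simp only [intoRep, ontoFib, LinearMap.comp_apply, LinearEquiv.coe_coe,
    LinearEquiv.apply_symm_apply, LinearMap.sum_apply, LinearMap.smulRight_apply, map_sum, map_smul]
  refine Finset.sum_congr rfl fun z _ => ?_
  rw [← wB_apply, Module.Basis.constr_basis]

end Retract

lemma comp_toLin_apply {U V W : (B.QG hU).Rep} (f : U ⟶ V) (g : V ⟶ W) (u : U.V) :
    Hom.toLin (f ≫ g) u = Hom.toLin g (Hom.toLin f u) := rfl

/-- Evaluation of morphisms of representations at a vector, as an additive map. -/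
def evalHom {U V : (B.QG hU).Rep} (u : U.V) : (U ⟶ V) →+ V.V where
  toFun f := Hom.toLin f u
  map_zero' := rfl
  map_add' _ _ := rfl

/-- Every representation is a retract of one in the image of the fibre functor. -/
lemma exists_retract (U : (B.QG hU).Rep) :
    ∃ (X : C) (s : U ⟶ fobj hU X) (r : fobj hU X ⟶ U), s ≫ r = 𝟙 U := by
  let n := Module.finrank ℂ U.V
  let b : Module.Basis (Fin n) ℂ U.V := Module.finBasis ℂ U.V
  let x : ∀ i, B.Idx i := fun i => Classical.arbitrary _
  let Y : ι × Fin n → C := fun k => B.X k.1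
  let into : ∀ k : ι × Fin n, fobj hU (Y k) ⟶ U := fun k => intoRep U (x k.1) (b k.2)
  let onto : ∀ k : ι × Fin n, U ⟶ fobj hU (Y k) := fun k => ontoFib U (x k.1) (b.coord k.2)
  have h1 : ∑ k, onto k ≫ into k = 𝟙 U := by
    refine QuantumGroupoid.Rep.hom_ext (LinearMap.ext fun v => ?_)
    change evalHom hU v _ = v
    rw [map_sum, Fintype.sum_prod_type]
    have h2 : ∀ i, ∑ l, evalHom hU v (onto (i, l) ≫ into (i, l)) =
        U.ρ (∑ z : B.Idx i, E z z) v := by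
      intro i
      have h3 : ∀ l, evalHom hU v (onto (i, l) ≫ into (i, l)) =
          ∑ z, b.coord l (U.ρ (E (x i) z) v) •
            U.ρ (E z (x i)) (b l) :=
        fun l => intoRep_ontoFib U (x i) (b l) (b.coord l) v
      simp only [h3]
      rw [Finset.sum_comm, map_sum, LinearMap.sum_apply]
      refine Finset.sum_congr rfl fun z _ => ?_
      simp only [← map_smul (U.ρ (E z (x i)))]
      rw [← map_sum]
      simp only [Module.Basis.coord_apply]
      rw [b.sum_repr, ← Module.End.mul_apply, ← map_mul, E_mul_E]
    simp only [h2]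
    rw [← LinearMap.sum_apply, ← map_sum, sum_E, map_one, Module.End.one_apply]
  refine ⟨⨁ Y, ∑ k, onto k ≫ wmap hU (Limits.biproduct.ι Y k),
    ∑ k, wmap hU (Limits.biproduct.π Y k) ≫ into k, ?_⟩
  rw [Preadditive.sum_comp, ← h1]
  refine Finset.sum_congr rfl fun k _ => ?_
  rw [Preadditive.comp_sum, Finset.sum_eq_single k]
  · rw [Category.assoc, ← Category.assoc (wmap hU _), ← wmap_comp, Limits.biproduct.ι_π_self,
      wmap_id, Category.id_comp]
  · intro l _ hl
    have h0 : wmap hU (0 : Y k ⟶ Y l) = 0 := by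
      have := (fib_additive hU)
      exact (fib hU).map_zero _ _
    rw [Category.assoc, ← Category.assoc (wmap hU _), ← wmap_comp,
      Limits.biproduct.ι_π_ne _ (Ne.symm hl), h0, Limits.zero_comp, Limits.comp_zero]
  · simp

/-- A representation is a retract of a fibre, and the corresponding idempotent of the fibre comes
from an idempotent of `C`, which splits. -/
lemma exists_iso_fobj (U : (B.QG hU).Rep) : ∃ Y : C, Nonempty (fobj hU Y ≅ U) := by
  obtain ⟨X, s, r, hsr⟩ := exists_retract hU U
  obtain ⟨e, he⟩ := exists_wmap hU (r ≫ s)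
  have hee : e ≫ e = e := by
    have := fib_faithful hU
    apply (fib hU).map_injective
    change wmap hU _ = wmap hU _
    rw [wmap_comp, he, Category.assoc, ← Category.assoc s, hsr, Category.id_comp]
  obtain ⟨Y, i, p, hip, hpi⟩ := IsIdempotentComplete.idempotents_split X e hee
  refine ⟨Y, ⟨⟨wmap hU i ≫ r, s ≫ wmap hU p, ?_, ?_⟩⟩⟩
  · rw [Category.assoc, ← Category.assoc r, ← he, ← wmap_comp, ← wmap_comp, ← hpi, Category.assoc,
      hip, Category.comp_id, hip, wmap_id]
  · rw [Category.assoc, ← Category.assoc (wmap hU p), ← wmap_comp, hpi, he, Category.assoc,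
      ← Category.assoc s, hsr, Category.id_comp]

lemma fib_isEquivalence : (fib hU).IsEquivalence :=
  haveI := fib_faithful hU
  haveI := fib_full hU
  haveI : (fib hU).EssSurj := ⟨fun U => exists_iso_fobj hU U⟩
  {}

end Equivalence

/-! ### Transport along equivalences and monoidal functors -/

section Transport

lemma simple_of_simple_obj {𝒞 𝒟 : Type*} [Category* 𝒞] [Category* 𝒟] [Limits.HasZeroMorphisms 𝒞]
    [Limits.HasZeroMorphisms 𝒟] (F : 𝒞 ⥤ 𝒟) [F.PreservesZeroMorphisms] [F.IsEquivalence] (Y : 𝒞)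
    [Simple (F.obj Y)] : Simple Y where
  mono_isIso_iff_nonzero {Z} f _ := by
    rw [← isIso_iff_of_reflects_iso f F, Simple.mono_isIso_iff_nonzero, Ne, Ne, F.map_eq_zero_iff]

/-- An equivalence sends simple objects to simple objects. -/
lemma simple_obj {𝒞 𝒟 : Type*} [Category* 𝒞] [Category* 𝒟] [Limits.HasZeroMorphisms 𝒞]
    [Limits.HasZeroMorphisms 𝒟] (F : 𝒞 ⥤ 𝒟) [F.PreservesZeroMorphisms] [F.IsEquivalence] (Y : 𝒞)
    [Simple Y] : Simple (F.obj Y) where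
  mono_isIso_iff_nonzero {Z} f _ := by
    obtain ⟨g, hg⟩ := F.map_surjective ((F.objObjPreimageIso Z).hom ≫ f)
    have h1 : Mono (F.map g) := by rw [hg]; infer_instance
    have h2 : Mono g := F.mono_of_mono_map h1
    have h3 : f = 0 ↔ g = 0 := by
      rw [← F.map_eq_zero_iff, hg, ← cancel_epi (F.objObjPreimageIso Z).hom, Limits.comp_zero]
    rw [Ne, h3, ← Ne, ← Simple.mono_isIso_iff_nonzero g, ← isIso_iff_of_reflects_iso g F, hg,
      isIso_comp_left_iff]

variable {𝒞 𝒟 : Type*} [Category* 𝒞] [Category* 𝒟] [MonoidalCategory 𝒞] [MonoidalCategory 𝒟]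
  {F : 𝒞 ⥤ 𝒟} (c : F.CoreMonoidal)

/-- The morphism `A' ⟶ X' ⊗ Y'` induced by `f : A ⟶ X ⊗ Y`, for objects `A'`, `X'`, `Y'` identified
with the images of `A`, `X`, `Y` under a monoidal functor. -/
def transport {A X Y : 𝒞} {A' X' Y' : 𝒟} (κA : F.obj A ≅ A') (κX : F.obj X ≅ X')
    (κY : F.obj Y ≅ Y') (f : A ⟶ X ⊗ Y) : A' ⟶ X' ⊗ Y' :=
  κA.inv ≫ F.map f ≫ (c.μIso X Y).inv ≫ (κX.hom ⊗ₘ κY.hom)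

/-- Both this composite and the one of `transport_comp_whiskerRight` are the image of a morphism
`A ⟶ X ⊗ (Y ⊗ Z)`, so relations between trees pass through a monoidal functor. -/
lemma transport_comp_whiskerLeft {A X Y Z M : 𝒞} {A' X' Y' Z' M' : 𝒟} (κA : F.obj A ≅ A')
    (κX : F.obj X ≅ X') (κY : F.obj Y ≅ Y') (κZ : F.obj Z ≅ Z') (κM : F.obj M ≅ M')
    (f : A ⟶ X ⊗ M) (g : M ⟶ Y ⊗ Z) :
    transport c κA κX κM f ≫ X' ◁ transport c κM κY κZ g =
      κA.inv ≫ F.map (f ≫ X ◁ g) ≫ (c.μIso X (Y ⊗ Z)).inv ≫ F.obj X ◁ (c.μIso Y Z).inv ≫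
        (κX.hom ⊗ₘ (κY.hom ⊗ₘ κZ.hom)) := by
  have h1 : F.map (X ◁ g) ≫ (c.μIso X (Y ⊗ Z)).inv = (c.μIso X M).inv ≫ F.obj X ◁ F.map g := by
    rw [Iso.comp_inv_eq, Category.assoc, c.μIso_hom_natural_right, Iso.inv_hom_id_assoc]
  have h2 : (κX.hom ⊗ₘ κM.hom) ≫ X' ◁ transport c κM κY κZ g =
      F.obj X ◁ F.map g ≫ F.obj X ◁ (c.μIso Y Z).inv ≫ (κX.hom ⊗ₘ (κY.hom ⊗ₘ κZ.hom)) := by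
    simp only [transport, ← id_tensorHom, tensorHom_comp_tensorHom, Category.id_comp,
      Category.comp_id, Iso.hom_inv_id_assoc]
  rw [transport, Category.assoc, Category.assoc, Category.assoc, h2, F.map_comp, Category.assoc,
    ← Category.assoc (F.map (X ◁ g)), h1, Category.assoc]

lemma transport_comp_whiskerRight {A X Y Z M : 𝒞} {A' X' Y' Z' M' : 𝒟} (κA : F.obj A ≅ A')
    (κX : F.obj X ≅ X') (κY : F.obj Y ≅ Y') (κZ : F.obj Z ≅ Z') (κM : F.obj M ≅ M')
    (f : A ⟶ M ⊗ Z) (g : M ⟶ X ⊗ Y) :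
    transport c κA κM κZ f ≫ transport c κM κX κY g ▷ Z' ≫ (α_ X' Y' Z').hom =
      κA.inv ≫ F.map (f ≫ g ▷ Z ≫ (α_ X Y Z).hom) ≫ (c.μIso X (Y ⊗ Z)).inv ≫
        F.obj X ◁ (c.μIso Y Z).inv ≫ (κX.hom ⊗ₘ (κY.hom ⊗ₘ κZ.hom)) := by
  have h1 : F.map (g ▷ Z) ≫ (c.μIso (X ⊗ Y) Z).inv = (c.μIso M Z).inv ≫ F.map g ▷ F.obj Z := by
    rw [Iso.comp_inv_eq, Category.assoc, c.μIso_hom_natural_left, Iso.inv_hom_id_assoc]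
  have h2 : (κM.hom ⊗ₘ κZ.hom) ≫ transport c κM κX κY g ▷ Z' =
      F.map g ▷ F.obj Z ≫ (c.μIso X Y).inv ▷ F.obj Z ≫ ((κX.hom ⊗ₘ κY.hom) ⊗ₘ κZ.hom) := by
    simp only [transport, ← tensorHom_id, tensorHom_comp_tensorHom, Category.id_comp,
      Category.comp_id, Iso.hom_inv_id_assoc]
  have h3 : F.map (α_ X Y Z).hom ≫ (c.μIso X (Y ⊗ Z)).inv ≫ F.obj X ◁ (c.μIso Y Z).inv =
      (c.μIso (X ⊗ Y) Z).inv ≫ (c.μIso X Y).inv ▷ F.obj Z ≫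
        (α_ (F.obj X) (F.obj Y) (F.obj Z)).hom := by
    have h := c.associativity X Y Z
    rw [← cancel_epi ((c.μIso (X ⊗ Y) Z).inv ≫ (c.μIso X Y).inv ▷ F.obj Z)] at h
    simp only [Category.assoc, inv_hom_whiskerRight_assoc, Iso.inv_hom_id_assoc] at h
    rw [h]
    simp
  have h4 : ((κX.hom ⊗ₘ κY.hom) ⊗ₘ κZ.hom) ≫ (α_ X' Y' Z').hom =
      (α_ (F.obj X) (F.obj Y) (F.obj Z)).hom ≫ (κX.hom ⊗ₘ (κY.hom ⊗ₘ κZ.hom)) :=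
    associator_naturality _ _ _
  calc _ = κA.inv ≫ F.map f ≫ (c.μIso M Z).inv ≫ ((κM.hom ⊗ₘ κZ.hom) ≫
        transport c κM κX κY g ▷ Z') ≫ (α_ X' Y' Z').hom := by
        conv_lhs => rw [transport]
        simp only [Category.assoc]
    _ = κA.inv ≫ F.map f ≫ ((c.μIso M Z).inv ≫ F.map g ▷ F.obj Z) ≫
        (c.μIso X Y).inv ▷ F.obj Z ≫ (α_ (F.obj X) (F.obj Y) (F.obj Z)).hom ≫
          (κX.hom ⊗ₘ (κY.hom ⊗ₘ κZ.hom)) := by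
        rw [h2]; simp only [Category.assoc, h4]
    _ = κA.inv ≫ F.map f ≫ F.map (g ▷ Z) ≫ ((c.μIso (X ⊗ Y) Z).inv ≫
        (c.μIso X Y).inv ▷ F.obj Z ≫ (α_ (F.obj X) (F.obj Y) (F.obj Z)).hom) ≫
          (κX.hom ⊗ₘ (κY.hom ⊗ₘ κZ.hom)) := by
        rw [← h1]; simp only [Category.assoc]
    _ = _ := by
        rw [← h3]; simp only [Category.assoc, F.map_comp]

end Transport

/-! ### The simple representations and their fusion -/

section SimpleReps

open QuantumGroupoid QuantumGroupoid.Rep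

variable {B}

/-- The inverse of `dualTree_eq_sum`, by unitarity of the `F`-matrices. -/
lemma dualTree_assoc (hU : B.IsUnitary) (a b c d : ι)
    (t : (m : ι) × Fin (B.N a b m) × Fin (B.N m c d)) :
    B.dv t.1 c d t.2.2 ≫ B.dv a b t.1 t.2.1 ▷ B.X c ≫ (α_ (B.X a) (B.X b) (B.X c)).hom =
      ∑ s : (n : ι) × Fin (B.N b c n) × Fin (B.N a n d), star (B.F a b c d s t) •
        (B.dv a s.1 d s.2.2 ≫ B.X a ◁ B.dv b c s.1 s.2.1) := by
  have h1 : ∀ s : (n : ι) × Fin (B.N b c n) × Fin (B.N a n d),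
      B.dv a s.1 d s.2.2 ≫ B.X a ◁ B.dv b c s.1 s.2.1 = _ :=
    fun s => dualTree_eq_sum a b c d s.1 s.2.1 s.2.2
  simp only [h1, Finset.smul_sum, smul_smul]
  rw [Finset.sum_comm]
  simp only [← Finset.sum_smul]
  have h2 : ∀ t', ∑ s, star (B.F a b c d s t) * B.F a b c d s t' = if t = t' then 1 else 0 := by
    intro t'
    have := congrFun (congrFun (hU a b c d).2 t) t'
    rwa [Matrix.mul_apply, Matrix.one_apply] at this
  rw [Finset.sum_eq_single t]
  · rw [h2 t, if_pos rfl, one_smul]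
  · intro t' _ ht
    rw [h2 t', if_neg (Ne.symm ht), zero_smul]
  · simp

variable (hU : B.IsUnitary)

variable (B) in
/-- The representation `V_i`. -/
abbrev S (i : ι) : (B.QG hU).Rep := B.simpleRep (B.QG hU) i

/-- The coordinates of `W(i)`, as an identification with the space of `V_i`. -/
def coords (i : ι) : B.W (B.X i) ≃ₗ[ℂ] (B.S hU i).V := (B.wB i).equivFun

lemma coords_rep (i : ι) (h : B.H) (f : B.W (B.X i)) :
    coords hU i (B.rep (B.X i) h f) = (B.S hU i).ρ h (coords hU i f) := by
  funext x
  have h1 : (B.S hU i).ρ h (coords hU i f) x =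
      (B.rtd i : ℂ)⁻¹ * ∑ y, h i x y * (B.wB i).equivFun f y := rfl
  have h2 : coords hU i (B.rep (B.X i) h f) x = B.cw x (B.rep (B.X i) h f) := wB_equivFun _ x
  rw [h1, h2]
  conv_lhs => rw [← sum_cw_wv f, map_sum, map_sum]
  rw [Finset.mul_sum]
  refine Finset.sum_congr rfl fun y _ => ?_
  rw [map_smul, map_smul, rep_simple, cw_simpleAct, wB_equivFun, smul_eq_mul]
  ring

lemma coords_wv (i : ι) (x : B.Idx i) : coords hU i (wv x) = B.basisVec (B.QG hU) i x := by
  funext y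
  change (B.wB i).equivFun (wv x) y = (Pi.single x 1 : B.Idx i → ℂ) y
  rw [wB_equivFun, cw_wv, Pi.single_apply]

/-- `V_i` is the fibre at the simple object `i`, in coordinates. -/
def simpleIso (i : ι) : fobj hU (B.X i) ≅ B.S hU i :=
  isoOfInverse ⟨(coords hU i).toLinearMap ∘ₗ (toW hU (B.X i)).toLinearMap, fun h =>
      LinearMap.ext fun v => by
        simp only [LinearMap.comp_apply, LinearEquiv.coe_coe, toW_ρ, coords_rep]⟩
    ((toW hU (B.X i)).symm.toLinearMap ∘ₗ (coords hU i).symm.toLinearMap)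
    (LinearMap.ext fun v => by simp) (LinearMap.ext fun v => by simp)

lemma simpleIso_hom_wv (i : ι) (x : B.Idx i) :
    Hom.toLin (simpleIso hU i).hom ((toW hU (B.X i)).symm (wv x)) = B.basisVec (B.QG hU) i x := by
  change coords hU i (toW hU (B.X i) ((toW hU (B.X i)).symm (wv x))) = _
  rw [LinearEquiv.apply_symm_apply, coords_wv]

lemma toW_simpleIso_inv_basisVec (i : ι) (x : B.Idx i) :
    toW hU (B.X i) (Hom.toLin (simpleIso hU i).inv (B.basisVec (B.QG hU) i x)) = wv x := by
  rw [← simpleIso_hom_wv, ← comp_toLin_apply, Iso.hom_inv_id, id_toLin, LinearMap.id_apply,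
    LinearEquiv.apply_symm_apply]

instance simple_S (i : ι) : Simple (B.S hU i) :=
  haveI := fib_additive hU
  haveI := fib_isEquivalence hU
  haveI : Simple (fobj hU (B.X i)) := simple_obj (fib hU) (B.X i)
  Simple.of_iso (simpleIso hU i).symm

lemma eq_of_iso_S {i j : ι} (f : B.S hU i ≅ B.S hU j) : i = j :=
  haveI := fib_faithful hU
  haveI := fib_full hU
  B.eq_of_iso i j ⟨(fib hU).preimageIso (simpleIso hU i ≪≫ f ≪≫ (simpleIso hU j).symm)⟩

lemma exists_iso_S (U : (B.QG hU).Rep) [Simple U] : ∃ i, Nonempty (U ≅ B.S hU i) := by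
  have := fib_additive hU
  have := fib_isEquivalence hU
  obtain ⟨Y, ⟨f⟩⟩ := exists_iso_fobj hU U
  have : Simple ((fib hU).obj Y) := Simple.of_iso f
  obtain ⟨i, ⟨g⟩⟩ := B.exists_iso Y (simple_of_simple_obj (fib hU) Y)
  exact ⟨i, ⟨f.symm ≪≫ (fib hU).mapIso g ≪≫ simpleIso hU i⟩⟩

/-- `simpleIso` as an isomorphism of values of the functor `fib`. -/
def fibSimpleIso (i : ι) : (fib hU).obj (B.X i) ≅ B.S hU i := simpleIso hU i

/-- The morphism `t_i^{jk,μ} : V_i → V_j ⊗ V_k`, the image of a dual vertex under the fibre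
functor. -/
def T (i j k : ι) (μ : Fin (B.N j k i)) : B.S hU i ⟶ B.S hU j ⊗ B.S hU k :=
  transport (fibCore hU) (fibSimpleIso hU i) (fibSimpleIso hU j) (fibSimpleIso hU k) (B.dv j k i μ)

lemma T_eq (i j k : ι) (μ : Fin (B.N j k i)) : T hU i j k μ = (simpleIso hU i).inv ≫
    wmap hU (B.dv j k i μ) ≫ (muIso hU _ _).inv ≫
      tensMap (simpleIso hU j).hom (simpleIso hU k).hom := rfl

/-- The coordinates of `t_i^{jk,μ}`, by `nu_Wmap_dv`. -/
lemma incl_T (i j k : ι) (μ : Fin (B.N j k i)) (a b : ι) (α : Fin (B.N a i b)) :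
    incl (B.S hU j) (B.S hU k) (Hom.toLin (T hU i j k μ) (B.basisVec (B.QG hU) i ⟨a, b, α⟩)) =
      ∑ s : (p : ι) × Fin (B.N a j p) × Fin (B.N p k b), B.F a j k b ⟨i, μ, α⟩ s •
        (B.basisVec (B.QG hU) j ⟨a, s.1, s.2.1⟩ ⊗ₜ[ℂ]
          B.basisVec (B.QG hU) k ⟨s.1, b, s.2.2⟩) := by
  rw [T_eq, comp_toLin_apply, comp_toLin_apply, comp_toLin_apply, incl_tensMap_apply]
  have h1 : incl _ _ (Hom.toLin (muIso hU (B.X j) (B.X k)).inv (Hom.toLin (wmap hU (B.dv j k i μ))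
      (Hom.toLin (simpleIso hU i).inv (B.basisVec (B.QG hU) i ⟨a, b, α⟩)))) =
      (toW2 hU _ _).symm (∑ t, B.F a j k b ⟨i, μ, α⟩ t •
        ((wv ⟨a, t.1, t.2.1⟩ : B.W (B.X j)) ⊗ₜ[ℂ] (wv ⟨t.1, b, t.2.2⟩ : B.W (B.X k)))) := by
    rw [LinearEquiv.eq_symm_apply, toW2_incl_muIso_inv, toW_wmap,
      toW_simpleIso_inv_basisVec, nu_Wmap_dv]
  rw [h1, map_sum, map_sum]
  refine Finset.sum_congr rfl fun s _ => ?_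
  rw [map_smul, map_smul]
  congr 1
  change TensorProduct.map _ _ ((toW hU _).symm _ ⊗ₜ (toW hU _).symm _) = _
  rw [TensorProduct.map_tmul, simpleIso_hom_wv, simpleIso_hom_wv]

/-- The identification of `V_j ⊗ V_k` with the fibre at `j ⊗ k`. -/
def tensorIso (j k : ι) : fobj hU (B.X j ⊗ B.X k) ≅ B.S hU j ⊗ B.S hU k :=
  (muIso hU _ _).symm ≪≫ ((simpleIso hU j) ⊗ᵢ (simpleIso hU k))

lemma T_eq_tensorIso (i j k : ι) (μ : Fin (B.N j k i)) :
    T hU i j k μ = (simpleIso hU i).inv ≫ wmap hU (B.dv j k i μ) ≫ (tensorIso hU j k).hom := rfl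

/-- The morphism `V_j ⊗ V_k → V_i` given by a basis vector of `Hom(j ⊗ k, i)`. -/
def T' (i j k : ι) (μ : Fin (B.N j k i)) : B.S hU j ⊗ B.S hU k ⟶ B.S hU i :=
  (tensorIso hU j k).inv ≫ wmap hU (B.vertex j k i μ) ≫ (simpleIso hU i).hom

lemma wmap_zero (X Y : C) : wmap hU (0 : X ⟶ Y) = 0 :=
  haveI := fib_additive hU
  (fib hU).map_zero _ _

lemma wmap_sum {X Y : C} {κ : Type*} (s : Finset κ) (f : κ → (X ⟶ Y)) :
    wmap hU (∑ k ∈ s, f k) = ∑ k ∈ s, wmap hU (f k) :=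
  haveI := fib_additive hU
  (fib hU).map_sum _ _

lemma T_comp_T' {i i' : ι} (j k : ι) (μ : Fin (B.N j k i)) (ν : Fin (B.N j k i')) :
    T hU i j k μ ≫ T' hU i' j k ν =
      (simpleIso hU i).inv ≫ wmap hU (B.dv j k i μ ≫ B.vertex j k i' ν) ≫
        (simpleIso hU i').hom := by
  rw [T_eq_tensorIso, T', Category.assoc, Category.assoc, Iso.hom_inv_id_assoc, wmap_comp,
    Category.assoc]

lemma T_T'_self {i : ι} (j k : ι) (μ : Fin (B.N j k i)) : T hU i j k μ ≫ T' hU i j k μ = 𝟙 _ := by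
  rw [T_comp_T', dv_vertex_self, wmap_id, Category.id_comp, Iso.inv_hom_id]

lemma T_T'_of_ne {i : ι} (j k : ι) {μ ν : Fin (B.N j k i)} (h : μ ≠ ν) :
    T hU i j k μ ≫ T' hU i j k ν = 0 := by
  rw [T_comp_T', dv_vertex_of_ne h, wmap_zero, Limits.zero_comp, Limits.comp_zero]

lemma T_T'_of_ne_label {i i' : ι} (h : i ≠ i') (j k : ι) (μ : Fin (B.N j k i))
    (ν : Fin (B.N j k i')) : T hU i j k μ ≫ T' hU i' j k ν = 0 := by
  rw [T_comp_T', hom_eq_zero h (B.dv j k i μ ≫ B.vertex j k i' ν), wmap_zero, Limits.zero_comp,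
    Limits.comp_zero]

lemma sum_T'_T (j k : ι) : ∑ i, ∑ μ, T' hU i j k μ ≫ T hU i j k μ = 𝟙 _ := by
  have h1 : ∀ i μ, T' hU i j k μ ≫ T hU i j k μ = (tensorIso hU j k).inv ≫
      wmap hU (B.vertex j k i μ ≫ B.dv j k i μ) ≫ (tensorIso hU j k).hom := by
    intro i μ
    rw [T_eq_tensorIso, T', Category.assoc, Category.assoc, Iso.hom_inv_id_assoc, wmap_comp,
      Category.assoc]
  simp only [h1]
  simp only [← Preadditive.comp_sum, ← Preadditive.sum_comp, ← wmap_sum]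
  rw [sum_vertex_dv, wmap_id, Category.id_comp, Iso.inv_hom_id]

lemma T_linearIndependent (i j k : ι) : LinearIndependent ℂ (T hU i j k) := by
  rw [Fintype.linearIndependent_iff]
  intro c hc ν
  have h1 := congrArg (fun f => f ≫ T' hU i j k ν) hc
  simp only [Preadditive.sum_comp, Limits.zero_comp, Linear.smul_comp] at h1
  rw [Finset.sum_eq_single ν (fun μ _ h => by rw [T_T'_of_ne hU j k h, smul_zero]) (by simp),
    T_T'_self] at h1
  exact (smul_eq_zero.1 h1).resolve_right (id_nonzero (B.S hU i))

lemma T_span (i j k : ι) : ⊤ ≤ Submodule.span ℂ (Set.range (T hU i j k)) := by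
  rintro t -
  -- Schur's lemma: the component of `t` along `t_{i'}^{jk,μ}` is a scalar, zero unless `i' = i`
  obtain ⟨f, hf⟩ := exists_wmap hU ((simpleIso hU i).hom ≫ t ≫ (tensorIso hU j k).inv)
  have h1 : t = (simpleIso hU i).inv ≫ wmap hU f ≫ (tensorIso hU j k).hom := by
    rw [hf]; simp
  have h2 : f = ∑ μ, B.scal i (f ≫ B.vertex j k i μ) • B.dv j k i μ := by
    conv_lhs => rw [← Category.comp_id f, ← sum_vertex_dv, Preadditive.comp_sum]
    rw [Finset.sum_eq_single i]
    · rw [Preadditive.comp_sum]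
      refine Finset.sum_congr rfl fun μ _ => ?_
      rw [← Category.assoc, scal_comp]
    · intro i' _ h
      rw [Preadditive.comp_sum]
      refine Finset.sum_eq_zero fun μ _ => ?_
      rw [← Category.assoc, hom_eq_zero (Ne.symm h) (f ≫ _), Limits.zero_comp]
    · simp
  have h3 : t = ∑ μ, B.scal i (f ≫ B.vertex j k i μ) • T hU i j k μ := by
    rw [h1]
    conv_lhs => rw [h2]
    simp only [wmap_sum, wmap_smul, Preadditive.comp_sum, Preadditive.sum_comp, Linear.comp_smul,
      Linear.smul_comp, T_eq_tensorIso]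
  rw [h3]
  exact Submodule.sum_mem _ fun μ _ =>
    Submodule.smul_mem _ _ (Submodule.subset_span (Set.mem_range_self μ))

/-- The image under the fibre functor of the relation `dualTree_assoc` between dual trees. -/
lemma T_sixJ (a b c d : ι) (t : (m : ι) × Fin (B.N a b m) × Fin (B.N m c d)) :
    T hU d t.1 c t.2.2 ≫ (T hU t.1 a b t.2.1 ▷ B.S hU c) ≫
      (α_ (B.S hU a) (B.S hU b) (B.S hU c)).hom =
    ∑ s : (n : ι) × Fin (B.N b c n) × Fin (B.N a n d), star (B.F a b c d s t) •
      (T hU d a s.1 s.2.2 ≫ (B.S hU a ◁ T hU s.1 b c s.2.1)) := by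
  have := fib_linear hU
  have := fib_additive hU
  simp only [T]
  rw [transport_comp_whiskerRight, dualTree_assoc hU]
  simp only [transport_comp_whiskerLeft, Functor.map_sum, Functor.map_smul, Preadditive.sum_comp,
    Preadditive.comp_sum, Linear.smul_comp, Linear.comp_smul]

/-- A representation with a complete system of inclusions and projections is a direct sum. -/
lemma nonempty_iso_directSum {Q : QuantumGroupoid B.H} {κ : Type w} [Fintype κ] [DecidableEq κ]
    (A : Q.Rep) (V : κ → Q.Rep) (t : ∀ k, V k ⟶ A) (t' : ∀ k, A ⟶ V k)
    (h_self : ∀ k, t k ≫ t' k = 𝟙 _) (h_ne : ∀ k l, k ≠ l → t k ≫ t' l = 0)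
    (h_sum : ∑ k, t' k ≫ t k = 𝟙 A) : Nonempty (A ≅ directSum V) := by
  have h_self' : ∀ k v, Hom.toLin (t' k) (Hom.toLin (t k) v) = v := fun k v =>
    congrArg (fun f => Hom.toLin f v) (h_self k)
  have h_ne' : ∀ k l, k ≠ l → ∀ v, Hom.toLin (t' l) (Hom.toLin (t k) v) = 0 := fun k l h v =>
    congrArg (fun f => Hom.toLin f v) (h_ne k l h)
  have h_sum' : ∀ v, ∑ k, Hom.toLin (t k) (Hom.toLin (t' k) v) = v := by
    intro v
    let ev : (A ⟶ A) →+ A.V :=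
      { toFun := fun f => Hom.toLin f v, map_zero' := rfl, map_add' := fun _ _ => rfl }
    have := congrArg ev h_sum
    rwa [map_sum] at this
  let g : ((k : κ) → (V k).V) →ₗ[ℂ] A.V := ∑ k, Hom.toLin (t k) ∘ₗ LinearMap.proj k
  have hg : ∀ v, g v = ∑ k, Hom.toLin (t k) (v k) := fun v => LinearMap.sum_apply _ _ _
  refine ⟨isoOfInverse ⟨LinearMap.pi fun k => Hom.toLin (t' k), fun h => LinearMap.ext fun v =>
    funext fun k => comm_apply (t' k) h v⟩ g ?_ ?_⟩
  · exact LinearMap.ext fun v => (hg _).trans (h_sum' v)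
  · refine LinearMap.ext fun v => funext fun l => ?_
    refine (congrArg (Hom.toLin (t' l)) (hg v)).trans ?_
    rw [map_sum]
    refine (Finset.sum_eq_single l ?_ ?_).trans (h_self' l (v l))
    · intro k _ h
      exact h_ne' k l h (v k)
    · simp

lemma fusion (j k : ι) : Nonempty (B.S hU j ⊗ B.S hU k ≅
    directSum (fun x : (i : ι) × Fin (B.N j k i) => B.S hU x.1)) := by
  refine nonempty_iso_directSum _ _ (fun x => T hU x.1 j k x.2) (fun x => T' hU x.1 j k x.2)
    (fun x => T_T'_self hU j k x.2) ?_ ?_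
  · rintro ⟨i, μ⟩ ⟨i', ν⟩ h
    by_cases hi : i = i'
    · subst hi
      exact T_T'_of_ne hU j k fun hμ => h (congrArg (Sigma.mk i) hμ)
    · exact T_T'_of_ne_label hU hi j k μ ν
  · rw [Fintype.sum_sigma]
    exact sum_T'_T hU j k

end SimpleReps

end

end FusionBasis

end

theorem mainTheorem2 {C : Type u} [Category.{v} C] [Abelian C] [Linear ℂ C] [MonoidalCategory C]
    [MonoidalPreadditive C] [MonoidalLinear ℂ C] [RigidCategory C] [UnitaryFusionCategory C]
    {ι : Type w} [Fintype ι] [DecidableEq ι] (B : FusionBasis C ι)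
    (hU : B.IsUnitary) (hR : B.IsReal) :
    -- `H_𝒞` is a `C*`-quantum groupoid
    ∃ Q : CStarQuantumGroupoid B.H, Q.comul = B.comul ∧ Q.counit = B.counit ∧
      -- the `V_i` represent the isomorphism classes of simple representations
      (∀ i, Simple (B.simpleRep Q.toQuantumGroupoid i)) ∧
      (∀ i j, Nonempty (B.simpleRep Q.toQuantumGroupoid i ≅ B.simpleRep Q.toQuantumGroupoid j) →
        i = j) ∧
      (∀ W : Q.toQuantumGroupoid.Rep, Simple W →
        ∃ i, Nonempty (W ≅ B.simpleRep Q.toQuantumGroupoid i)) ∧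
      -- fusion rules
      (∀ j k, Nonempty (B.simpleRep Q.toQuantumGroupoid j ⊗ B.simpleRep Q.toQuantumGroupoid k ≅
        QuantumGroupoid.Rep.directSum (fun x : (i : ι) × Fin (B.N j k i) =>
          B.simpleRep Q.toQuantumGroupoid x.1))) ∧
      -- `6j`-symbols, in the bases `T i j k μ` of `Hom(V_i, V_j ⊗ V_k)` given by the `F`-symbols
      (∃ T : ∀ i j k, Fin (B.N j k i) → (B.simpleRep Q.toQuantumGroupoid i ⟶
          B.simpleRep Q.toQuantumGroupoid j ⊗ B.simpleRep Q.toQuantumGroupoid k),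
        (∀ i j k μ a b α,
          QuantumGroupoid.Rep.incl (B.simpleRep Q.toQuantumGroupoid j)
            (B.simpleRep Q.toQuantumGroupoid k)
            (QuantumGroupoid.Rep.Hom.toLin (T i j k μ) (B.basisVec Q.toQuantumGroupoid i ⟨a, b, α⟩))
          = ∑ s : (p : ι) × Fin (B.N a j p) × Fin (B.N p k b), B.F a j k b ⟨i, μ, α⟩ s •
              (B.basisVec Q.toQuantumGroupoid j ⟨a, s.1, s.2.1⟩ ⊗ₜ[ℂ]
                B.basisVec Q.toQuantumGroupoid k ⟨s.1, b, s.2.2⟩)) ∧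
        (∀ i j k, LinearIndependent ℂ (T i j k) ∧ ⊤ ≤ Submodule.span ℂ (Set.range (T i j k))) ∧
        (∀ a b c d, ∀ t : (m : ι) × Fin (B.N a b m) × Fin (B.N m c d),
          T d t.1 c t.2.2 ≫ (T t.1 a b t.2.1 ▷ B.simpleRep Q.toQuantumGroupoid c) ≫
            (α_ (B.simpleRep Q.toQuantumGroupoid a) (B.simpleRep Q.toQuantumGroupoid b)
              (B.simpleRep Q.toQuantumGroupoid c)).hom =
          ∑ s : (n : ι) × Fin (B.N b c n) × Fin (B.N a n d), star (B.F a b c d s t) •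
            (T d a s.1 s.2.2 ≫ (B.simpleRep Q.toQuantumGroupoid a ◁ T s.1 b c s.2.1)))) ∧
      -- the equivalence with `𝒞`
      ∃ Φ : C ⥤ Q.toQuantumGroupoid.Rep, Φ.IsEquivalence ∧ Φ.Additive ∧ Φ.Linear ℂ ∧
        Nonempty Φ.Monoidal ∧
        ∀ i, Nonempty (Φ.obj (B.X i) ≅ B.simpleRep Q.toQuantumGroupoid i) :=
  ⟨B.groupoid hU, rfl, rfl, fun i => FusionBasis.simple_S hU i,
    fun _ _ ⟨f⟩ => FusionBasis.eq_of_iso_S hU f, fun U _ => FusionBasis.exists_iso_S hU U,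
    FusionBasis.fusion hU,
    ⟨FusionBasis.T hU, FusionBasis.incl_T hU,
      fun i j k => ⟨FusionBasis.T_linearIndependent hU i j k, FusionBasis.T_span hU i j k⟩,
      FusionBasis.T_sixJ hU⟩,
    FusionBasis.fib hU, FusionBasis.fib_isEquivalence hU, FusionBasis.fib_additive hU,
    FusionBasis.fib_linear hU, ⟨(FusionBasis.fibCore hU).toMonoidal⟩,
    fun i => ⟨FusionBasis.simpleIso hU i⟩⟩
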